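/- **Theorem 2.2 (Regularity).** *Setting.* Let $\Omega\subset\mathbb R^3$ be a nonempty bounded connected open set, $H:=L^2(\Omega)$ with inner product $(\cdot,\cdot)$ and norm $\|\cdot\|$, and let $A:D(A)\subset H\to H$ and $B:D(B)\subset H\to H$ be unbounded monotone selfadjoint linear operators with compact resolvents. Let $0\le\lambda_1\le\lambda_2\le\dots\to\infty$ and $0\le\lambda_1'\le\lambda_2'\le\dots\to\infty$ be their eigenvalues, with complete orthonormal systems of eigenvectors $e_j$ and $e_j'$. For $s>0$ let $V_A^s:=D(A^s)=\{v\in H:\sum_j|\lambda_j^s(v,e_j)|^2<\infty\}$ and $A^sv:=\sum_j\lambda_j^s(v,e_j)e_j$, and define $V_B^s:=D(B^s)$ and $B^s$ in the same way. Fix $r,\sigma>0$ and assume that either $\lambda_1>0$, or $0=\lambda_1<\lambda_2$, $e_1$ is constant and the constant functions belong to $V_B^\sigma$. For $s>0$, $V_B^s$ carries the norm $(\|v\|^2+\|B^sv\|^2)^{1/2}$, and $V_A^s$ the norm $\|v\|_{A,s}:=\|A^sv\|$ if $\lambda_1>0$ and $\|v\|_{A,s}:=(|(v,e_1)|^2+\|A^sv\|^2)^{1/2}$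 if $\lambda_1=0$. Let $V_A^{-r}$ be the dual of $V_A^r$, with the dual norm and the duality pairing $\langle\cdot,\cdot\rangle$; $H$ is identified with a subspace of $V_A^{-r}$ through $\langle w,v\rangle=(w,v)$ for $w\in H$, $v\in V_A^r$. Let $\tau\ge0$, $T>0$; let $\hat\beta:\mathbb R\to[0,+\infty]$ be convex and lower semicontinuous with $\hat\beta(0)=0$; let $\hat\pi\in C^1(\mathbb R)$ have a Lipschitz continuous derivative $\pi:=\hat\pi'$; and let $\liminf_{|s|\to\infty}(\hat\beta(s)+\hat\pi(s))/s^2>0$. Put $\beta:=\partial\hat\beta$ with effective domain $D(\beta)$, let $\beta^\circ(s)$ be the element of minimum modulus of $\beta(s)$ for $s\in D(\beta)$, and let $\beta_\lambda$ be the Yosida approximation of $\beta$ at level $\lambda>0$. *Data.* Let $u\in H^1(0,T;H)$ (taken as its continuous representative) and $y_0\in V_B^{2\sigma}$ with $\hat\beta(y_0)\in L^1(\Omega)$; if $\lambda_1=0$, assume that the mean value $m_0$ of $y_0$ over $\Omega$ lies in the interior of $D(\beta)$, and let $\delta_0>0$ be such that $[m_0-\delta_0,m_0+\delta_0]\subset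 D(\beta)$. Assume moreover that * if $\tau>0$, then $y_0\in D(\beta)$ a.e. in $\Omega$ and $\beta^\circ(y_0)\in H$; * if $\tau=0$, then there is a constant $M_0$ such that, for all sufficiently small $\lambda>0$ and $t>0$, the function $\mu_0^\lambda(t):=B^{2\sigma}y_0+\beta_\lambda(y_0)+\pi(y_0)-u(t)$ belongs to $V_A^r$ and $\|\mu_0^\lambda(t)\|_{A,r}\le M_0$. *Solutions.* A solution is a pair $(y,\mu)$ with $y\in H^1(0,T;V_A^{-r})\cap L^\infty(0,T;V_B^\sigma)$, $\tau\partial_ty\in L^2(0,T;H)$, $\mu\in L^2(0,T;V_A^r)$ and $\hat\beta(y)\in L^1(\Omega\times(0,T))$ such that $y(0)=y_0$ and, for a.e. $t\in(0,T)$, $$\langle\partial_ty(t),v\rangle+(A^r\mu(t),A^rv)=0\quad\text{for every }v\in V_A^r,$$ $$\tau(\partial_ty(t),y(t)-v)+(B^\sigma y(t),B^\sigma(y(t)-v))+\int_\Omega\hat\beta(y(t))+(\pi(y(t))-u(t),y(t)-v)\le(\mu(t),y(t)-v)+\int_\Omega\hat\beta(v)\quad\text{for every }v\in V_B^\sigma,$$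 where $\int_\Omega\hat\beta(v):=+\infty$ if $\hat\beta(v)\notin L^1(\Omega)$. *Conclusion.* Every solution $(y,\mu)$ satisfies $$\partial_ty\in L^\infty(0,T;V_A^{-r})\cap L^2(0,T;V_B^\sigma),\qquad\mu\in L^\infty(0,T;V_A^r),$$ and, if $\tau>0$, also $$\partial_ty\in L^\infty(0,T;H),\qquad\mu\in L^\infty(0,T;V_A^{2r}).$$ Moreover, $$\|\partial_ty\|_{L^\infty(0,T;V_A^{-r})}+\|\partial_ty\|_{L^2(0,T;V_B^\sigma)}+\|\mu\|_{L^\infty(0,T;V_A^r)}+\|\tau^{1/2}\partial_ty\|_{L^\infty(0,T;H)}+\|\tau^{1/2}\mu\|_{L^\infty(0,T;V_A^{2r})}\le K_3,$$ where the last two terms are understood to be $0$ if $\tau=0$, with a constant $K_3$ that depends only on the structure of the system ($\Omega,A,B,r,\sigma,\tau,\hat\beta,\hat\pi$), on $T$, on an upper bound for the norms of the data ($\|u\|_{L^2(0,T;H)}$, $\|\partial_tu\|_{L^2(0,T;H)}$, $\|y_0\|_{V_B^{2\sigma}}$, $\|\hat\beta(y_0)\|_{L^1(\Omega)}$ and,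 if $\tau>0$, $\|\beta^\circ(y_0)\|$), on $\delta_0$ if $\lambda_1=0$, and on $M_0$ if $\tau=0$. -/

import Mathlib

open MeasureTheory Filter Topology Set
open scoped ENNReal NNReal RealInnerProductSpace

noncomputable section

namespace FracCH

/-! ### Operators with compact resolvent, their eigensystems and their powers -/

section Abstract

variable {H : Type*} [NormedAddCommGroup H] [InnerProductSpace ℝ H] [CompleteSpace H]

/-- An unbounded monotone selfadjoint linear operator with compact resolvent. (For a monotone
selfadjoint operator the resolvents are compact as soon as `(I + A)⁻¹` is.) -/
structure IsAdmissibleOperator (A : H →ₗ.[ℝ] H) : Prop where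
  selfAdjoint : IsSelfAdjoint A
  monotone : ∀ v : A.domain, 0 ≤ ⟪A v, (v : H)⟫
  unbounded : ¬ ∃ C : ℝ, ∀ v : A.domain, ‖A v‖ ≤ C * ‖(v : H)‖
  compactResolvent : ∃ R : H →L[ℝ] H, IsCompactOperator R ∧
    ∀ v : H, ∃ h : R v ∈ A.domain, R v + A ⟨R v, h⟩ = v

/-- A complete orthonormal sequence of eigenvectors of `A`, ordered so that the eigenvalues are
nonnegative, nondecreasing and tend to infinity. The indices start from `0`, so that
`lam 0`, `lam 1` are the first two eigenvalues. -/
structure EigenSystem (A : H →ₗ.[ℝ] H) where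
  lam : ℕ → ℝ
  vec : ℕ → H
  mem_domain : ∀ j, vec j ∈ A.domain
  apply_vec : ∀ j, A ⟨vec j, mem_domain j⟩ = lam j • vec j
  orthonormal : Orthonormal ℝ vec
  nonneg : 0 ≤ lam 0
  mono : Monotone lam
  tendsto : Tendsto lam atTop atTop
  complete : (Submodule.span ℝ (range vec)).topologicalClosure = ⊤

/-- Enumeration in nondecreasing order of a family with finite sublevels. -/
theorem exists_monotone_enum {ι : Type*} [Infinite ι] (f : ι → ℝ)
    (hf : ∀ M : ℝ, {i | f i ≤ M}.Finite) :
    ∃ g : ℕ ≃ ι, Monotone (f ∘ g) ∧ Tendsto (f ∘ g) atTop atTop := by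
  classical
  have hc : Countable ι := by
    have h : (univ : Set ι) = ⋃ n : ℕ, {i | f i ≤ n} := by
      ext i
      simpa using exists_nat_ge (f i)
    exact countable_univ_iff.1 (h ▸ countable_iUnion fun n => (hf n).countable)
  obtain ⟨c, hcinj⟩ := exists_injective_nat ι
  let key : ι → ℝ ×ₗ ℕ := fun i => toLex (f i, c i)
  have hkey : Function.Injective key := fun i j h => hcinj (congrArg (fun z => (ofLex z).2) h)
  let : LinearOrder ι := LinearOrder.lift' key hkey
  have hle : ∀ i j : ι, i ≤ j → f i ≤ f j := fun i j h => by
    have h1 : key i ≤ key j := h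
    rcases Prod.Lex.le_iff.1 h1 with h2 | h2
    · exact h2.le
    · exact h2.1.le
  have hIic : ∀ j : ι, (Iic j).Finite := fun j => (hf (f j)).subset fun i hi => hle i j hi
  let : LocallyFiniteOrder ι :=
    LocallyFiniteOrder.ofFiniteIcc fun a b => (hIic b).subset fun i hi => hi.2
  have : NoMaxOrder ι := ⟨fun a => by
    obtain ⟨b, hb⟩ := (hIic a).exists_notMem
    exact ⟨b, not_le.1 hb⟩⟩
  obtain ⟨a⟩ : Nonempty ι := inferInstance
  obtain ⟨b, hb⟩ := (hIic a).exists_minimal ⟨a, le_refl a⟩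
  have hbot : ∀ i, b ≤ i := fun i => by
    by_contra h
    have h1 := (not_le.1 h)
    exact h (hb.2 (h1.le.trans hb.1) h1.le)
  let : OrderBot ι := { bot := b, bot_le := hbot }
  let := LinearLocallyFiniteOrder.succOrder ι
  let := LinearLocallyFiniteOrder.predOrder ι
  let g := (orderIsoNatOfLinearSuccPredArch (ι := ι)).symm
  have hm : Monotone (f ∘ g) := fun m n h => hle _ _ (g.monotone h)
  refine ⟨g.toEquiv, hm, tendsto_atTop_atTop_of_monotone hm fun M => ?_⟩
  obtain ⟨i, hi⟩ := (hf M).exists_notMem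
  exact ⟨g.symm i, by simpa using (not_le.1 hi).le⟩

/-- Every admissible operator has an eigensystem. -/
theorem IsAdmissibleOperator.nonempty_eigenSystem
    {A : H →ₗ.[ℝ] H} (hA : IsAdmissibleOperator A) :
    Nonempty (EigenSystem A) := by
  classical
  obtain ⟨R, hRc, hR⟩ := hA.compactResolvent
  have hAs : A.IsFormalAdjoint A := by
    have h := LinearPMap.adjoint_isFormalAdjoint hA.selfAdjoint.dense_domain
    rwa [LinearPMap.isSelfAdjoint_def.1 hA.selfAdjoint] at h
  have hRsym : (R : H →ₗ[ℝ] H).IsSymmetric := by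
    intro v w
    obtain ⟨hv, hv'⟩ := hR v
    obtain ⟨hw, hw'⟩ := hR w
    have h := hAs ⟨R v, hv⟩ ⟨R w, hw⟩
    change ⟪R v, w⟫ = ⟪v, R w⟫
    conv_lhs => rw [← hw']
    conv_rhs => rw [← hv']
    rw [inner_add_right, inner_add_left]
    congr 1
    exact h.symm
  have hRpos : ∀ v, ‖R v‖ ^ 2 ≤ ⟪R v, v⟫ := fun v => by
    obtain ⟨hv, hv'⟩ := hR v
    have h := hA.monotone ⟨R v, hv⟩
    have h2 : ⟪R v, v⟫ = ⟪R v, R v⟫ + ⟪R v, A ⟨R v, hv⟩⟫ := by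
      rw [← inner_add_right, hv']
    rw [h2, real_inner_self_eq_norm_sq, real_inner_comm]
    exact le_add_of_nonneg_right h
  have hRinj : ∀ v, R v = 0 → v = 0 := fun v h => by
    obtain ⟨hv, hv'⟩ := hR v
    have h0 : (⟨R v, hv⟩ : A.domain) = 0 := Subtype.ext h
    rw [h0, h, LinearPMap.map_zero, add_zero] at hv'
    exact hv'.symm
  have heig : ∀ (ρ : ℝ) (v : H), R v = ρ • v → v ≠ 0 → 0 < ρ ∧ ρ ≤ 1 := fun ρ v h hv => by
    have h1 := hRpos v
    have h2 : 0 < ‖v‖ ^ 2 := by positivity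
    rw [h, norm_smul, mul_pow, Real.norm_eq_abs, sq_abs, real_inner_smul_left,
      real_inner_self_eq_norm_sq] at h1
    have h3 : ρ ^ 2 ≤ ρ := le_of_mul_le_mul_right h1 h2
    have h4 : ρ ≠ 0 := fun h0 => hv (hRinj v (by rw [h, h0, zero_smul]))
    have h5 : 0 < ρ ^ 2 := by positivity
    constructor <;> nlinarith
  let E : ℝ → Submodule ℝ H := fun ρ => Module.End.eigenspace (R : Module.End ℝ H) ρ
  have hE : ∀ ρ v, v ∈ E ρ ↔ R v = ρ • v := fun ρ v => Module.End.mem_eigenspace_iff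
  have hfin : ∀ ρ, FiniteDimensional ℝ (E ρ) := fun ρ => by
    by_cases h : ρ = 0
    · have : E ρ = ⊥ := by
        rw [Submodule.eq_bot_iff]
        intro v hv
        rw [hE, h, zero_smul] at hv
        exact hRinj v hv
      rw [this]
      infer_instance
    · exact ContinuousLinearMap.finite_dimensional_eigenspace hRc ρ h
  let b : ∀ ρ, OrthonormalBasis (Fin (Module.finrank ℝ (E ρ))) ℝ (E ρ) :=
    fun ρ => stdOrthonormalBasis ℝ (E ρ)
  let ι := Σ ρ : ℝ, Fin (Module.finrank ℝ (E ρ))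
  let e : ι → H := fun a => (b a.1 a.2 : H)
  have hon : Orthonormal ℝ e :=
    (hRsym.orthogonalFamily_eigenspaces).orthonormal_sigma_orthonormal
      (v_family := fun ρ => b ρ) fun ρ => (b ρ).orthonormal
  have heR : ∀ a, R (e a) = a.1 • e a := fun a => (hE _ _).1 (b a.1 a.2).2
  have hne : ∀ a, e a ≠ 0 := fun a => hon.ne_zero a
  have hperp : (Submodule.span ℝ (range e))ᗮ = ⊥ := by
    have h := ContinuousLinearMap.orthogonalComplement_iSup_eigenspaces_eq_bot hRc hRsym
    rw [eq_bot_iff, ← h]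
    refine Submodule.orthogonal_le (iSup_le fun ρ v hv => ?_)
    have h1 := (b ρ).sum_repr ⟨v, hv⟩
    have h2 := congrArg (fun z : E ρ => (z : H)) h1
    simp only [Submodule.coe_sum, Submodule.coe_smul] at h2
    rw [← h2]
    exact Submodule.sum_mem _ fun i _ =>
      Submodule.smul_mem _ _ (Submodule.subset_span ⟨⟨ρ, i⟩, rfl⟩)
  have hdense : (Submodule.span ℝ (range e)).topologicalClosure = ⊤ :=
    Submodule.topologicalClosure_eq_top_iff.2 hperp
  have hinf : Infinite ι := by
    by_contra hι
    rw [not_infinite_iff_finite] at hι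
    have : FiniteDimensional ℝ (Submodule.span ℝ (range e)) :=
      FiniteDimensional.span_of_finite ℝ (finite_range e)
    have h1 : Submodule.span ℝ (range e) = ⊤ := by
      rw [← hdense]
      exact (Submodule.span ℝ (range e)).closed_of_finiteDimensional
        |>.submodule_topologicalClosure_eq.symm
    have : FiniteDimensional ℝ H := by
      rw [h1] at this
      exact Module.Finite.of_surjective (⊤ : Submodule ℝ H).subtype fun v => ⟨⟨v, trivial⟩, rfl⟩
    apply hA.unbounded
    exact ⟨‖LinearMap.toContinuousLinearMap A.toFun‖,
      fun v => (LinearMap.toContinuousLinearMap A.toFun).le_opNorm v⟩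
  let f : ι → ℝ := fun a => a.1⁻¹ - 1
  have hpos : ∀ a : ι, 0 < a.1 ∧ a.1 ≤ 1 := fun a => heig _ _ (heR a) (hne a)
  have hf : ∀ M : ℝ, {a | f a ≤ M}.Finite := fun M => by
    by_contra hM
    have hM : {a | f a ≤ M}.Infinite := hM
    let q := hM.natEmbedding
    obtain ⟨K, hK, hKsub⟩ := hRc.image_closedBall_subset_compact 1
    have hx : ∀ n, R (e (q n)) ∈ K := fun n =>
      hKsub ⟨e (q n), by simp [hon.1], rfl⟩
    obtain ⟨x, -, φ, hφ, hlim⟩ := hK.tendsto_subseq hx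
    have hcau := hlim.cauchySeq
    rw [Metric.cauchySeq_iff] at hcau
    have hM1 : 0 < M + 1 := by
      have h1 : f (q 0) ≤ M := (q 0).2
      have h2 := inv_pos.2 (hpos (q 0)).1
      simp only [f] at h1
      linarith
    obtain ⟨N, hN⟩ := hcau (M + 1)⁻¹ (inv_pos.2 hM1)
    have h := hN N le_rfl (N + 1) (Nat.le_succ N)
    set a := (q (φ N) : ι) with ha
    set a' := (q (φ (N + 1)) : ι) with ha'
    have hne' : a ≠ a' := fun h0 => by
      have := q.injective (Subtype.ext h0)
      exact absurd (hφ.injective this) (by simp)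
    have hρ : (M + 1)⁻¹ ≤ a.1 := by
      have h1 : f a ≤ M := (q (φ N)).2
      simp only [f] at h1
      have h2 : a.1⁻¹ ≤ M + 1 := by linarith
      exact inv_le_of_inv_le₀ (hpos a).1 h2
    have h1 : ‖R (e a) - R (e a')‖ ^ 2 = a.1 ^ 2 + a'.1 ^ 2 := by
      rw [heR, heR, norm_sub_sq_real, norm_smul, norm_smul, hon.1, hon.1, real_inner_smul_left,
        real_inner_smul_right, hon.2 hne']
      simp
    have h2 : ‖R (e a) - R (e a')‖ < (M + 1)⁻¹ := by
      simpa [dist_eq_norm] using h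
    have h3 := norm_nonneg (R (e a) - R (e a'))
    have h4 := inv_pos.2 hM1
    nlinarith [sq_nonneg a'.1]
  obtain ⟨g, hmono, htend⟩ := exists_monotone_enum f hf
  have hdom : ∀ a, ∃ h : e a ∈ A.domain, A ⟨e a, h⟩ = f a • e a := fun a => by
    obtain ⟨hv, hv'⟩ := hR (a.1⁻¹ • e a)
    have h1 : R (a.1⁻¹ • e a) = e a := by
      rw [map_smul, heR, smul_smul, inv_mul_cancel₀ (hpos a).1.ne', one_smul]
    have h2 : e a ∈ A.domain := h1 ▸ hv
    refine ⟨h2, ?_⟩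
    have h3 : (⟨R (a.1⁻¹ • e a), hv⟩ : A.domain) = ⟨e a, h2⟩ := Subtype.ext h1
    rw [h3, h1] at hv'
    rw [eq_sub_of_add_eq' hv', sub_smul, one_smul]
  exact ⟨{
    lam := f ∘ g
    vec := e ∘ g
    mem_domain := fun j => (hdom (g j)).1
    apply_vec := fun j => (hdom (g j)).2
    orthonormal := hon.comp g g.injective
    nonneg := by
      have h := one_le_inv₀ (hpos (g 0)).1 |>.2 (hpos (g 0)).2
      simp only [f, Function.comp]
      linarith
    mono := hmono
    tendsto := htend
    complete := by rw [g.surjective.range_comp]; exact hdense }⟩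

namespace EigenSystem

variable {A : H →ₗ.[ℝ] H} (S : EigenSystem A)

theorem lam_nonneg (j : ℕ) : 0 ≤ S.lam j := S.nonneg.trans (S.mono (Nat.zero_le j))

/-- The domain `D(A^s)`. -/
def domPow (s : ℝ) : Submodule ℝ H where
  carrier := {v | Summable fun j => (S.lam j ^ s * ⟪S.vec j, v⟫) ^ 2}
  zero_mem' := by simp [summable_zero]
  add_mem' := by
    intro v w hv hw
    refine Summable.of_nonneg_of_le (fun j => sq_nonneg _) (fun j => ?_)
      ((hv.mul_left 2).add (hw.mul_left 2))
    rw [inner_add_right]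
    nlinarith [sq_nonneg (S.lam j ^ s * ⟪S.vec j, v⟫ - S.lam j ^ s * ⟪S.vec j, w⟫)]
  smul_mem' := by
    intro c v hv
    refine (hv.mul_left (c ^ 2)).congr fun j => ?_
    rw [real_inner_smul_right]
    ring

theorem summable_pow {s : ℝ} {v : H} (hv : v ∈ S.domPow s) :
    Summable fun j => (S.lam j ^ s * ⟪S.vec j, v⟫) • S.vec j := by
  have h := S.orthonormal.orthogonalFamily.summable_iff_norm_sq_summable
    (fun j => S.lam j ^ s * ⟪S.vec j, v⟫)
  have h2 : Summable fun j => ‖S.lam j ^ s * ⟪S.vec j, v⟫‖ ^ 2 := by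
    have h3 : Summable fun j => (S.lam j ^ s * ⟪S.vec j, v⟫) ^ 2 := hv
    exact h3.congr fun j => by rw [Real.norm_eq_abs, sq_abs]
  simpa using h.2 h2

/-- The power `A^s` on its domain, given by the eigenvector expansion. -/
def pow (s : ℝ) : S.domPow s →ₗ[ℝ] H where
  toFun v := ∑' j, (S.lam j ^ s * ⟪S.vec j, (v : H)⟫) • S.vec j
  map_add' v w := by
    rw [← (S.summable_pow v.2).tsum_add (S.summable_pow w.2)]
    refine tsum_congr fun j => ?_
    rw [← add_smul, Submodule.coe_add, inner_add_right, mul_add]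
  map_smul' c v := by
    rw [RingHom.id_apply, ← tsum_const_smul'']
    refine tsum_congr fun j => ?_
    rw [smul_smul, Submodule.coe_smul, real_inner_smul_right]
    ring_nf

/-- The map `v ↦ (v, A^s v)` whose Euclidean norm is the graph norm. -/
def graphMap (s : ℝ) : S.domPow s →ₗ[ℝ] WithLp 2 (H × H) :=
  (WithLp.linearEquiv 2 ℝ (H × H)).symm.toLinearMap ∘ₗ
    (LinearMap.prod (S.domPow s).subtype (S.pow s))

theorem graphMap_injective (s : ℝ) : Function.Injective (S.graphMap s) := by
  intro v w h
  have h1 := congrArg (fun z => (WithLp.linearEquiv 2 ℝ (H × H) z).1) h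
  simpa [graphMap] using h1

/-- `D(A^s)` endowed with the graph norm `(‖v‖² + ‖A^s v‖²)^(1/2)`. -/
def GraphSpace (s : ℝ) : Type _ := S.domPow s

namespace GraphSpace

variable {S} {s : ℝ}

instance : NormedAddCommGroup (S.GraphSpace s) :=
  NormedAddCommGroup.induced (S.domPow s) (WithLp 2 (H × H)) (S.graphMap s)
    (S.graphMap_injective s)

instance : NormedSpace ℝ (S.GraphSpace s) :=
  NormedSpace.induced ℝ (S.domPow s) (WithLp 2 (H × H)) (S.graphMap s)

/-- The inclusion of `D(A^s)` into `H`. -/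
def toH : S.GraphSpace s →ₗ[ℝ] H := (S.domPow s).subtype

/-- `v ↦ A^s v`. -/
def op : S.GraphSpace s →ₗ[ℝ] H := S.pow s

theorem norm_sq (v : S.GraphSpace s) : ‖v‖ ^ 2 = ‖toH v‖ ^ 2 + ‖op v‖ ^ 2 := by
  have h := WithLp.prod_norm_sq_eq_of_L2 (S.graphMap s v)
  exact h

end GraphSpace

/-- The weights `λ_j^s`, replaced by `1` where `λ_j = 0`. -/
def weight (s : ℝ) (j : ℕ) : ℝ := if S.lam j = 0 then 1 else S.lam j ^ s

theorem weight_ne_zero (s : ℝ) (j : ℕ) : S.weight s j ≠ 0 := by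
  unfold weight
  split_ifs with h
  · exact one_ne_zero
  · exact (Real.rpow_pos_of_pos (lt_of_le_of_ne (S.lam_nonneg j) (Ne.symm h)) s).ne'

theorem memℓp_weight {s : ℝ} {v : H} (hv : v ∈ S.domPow s) :
    Memℓp (fun j => S.weight s j * ⟪S.vec j, v⟫) 2 := by
  refine memℓp_gen ?_
  have h1 : Summable fun j => ⟪S.vec j, v⟫ ^ 2 := by
    have := S.orthonormal.inner_products_summable v
    simpa [Real.norm_eq_abs, sq_abs] using this
  have h2 : Summable fun j => (S.lam j ^ s * ⟪S.vec j, v⟫) ^ 2 := hv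
  refine Summable.of_nonneg_of_le (fun j => by positivity) (fun j => ?_) (h1.add h2)
  simp only [ENNReal.toReal_ofNat, Real.rpow_ofNat, Real.norm_eq_abs, sq_abs]
  unfold weight
  split_ifs with h
  · rw [one_mul]
    exact le_add_of_nonneg_right (sq_nonneg _)
  · exact le_add_of_nonneg_left (sq_nonneg _)

/-- The weighted Fourier coefficients, as an element of `ℓ²`. -/
def coeffMap (s : ℝ) : S.domPow s →ₗ[ℝ] lp (fun _ : ℕ => ℝ) 2 where
  toFun v := ⟨fun j => S.weight s j * ⟪S.vec j, (v : H)⟫, S.memℓp_weight v.2⟩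
  map_add' v w := by
    ext j
    change S.weight s j * ⟪S.vec j, (v : H) + w⟫ = _ + _
    rw [inner_add_right, mul_add]
  map_smul' c v := by
    ext j
    change S.weight s j * ⟪S.vec j, c • (v : H)⟫ = c * _
    rw [real_inner_smul_right]
    ring

theorem coeffMap_injective (s : ℝ) : Function.Injective (S.coeffMap s) := by
  intro v w h
  have hj : ∀ j, ⟪S.vec j, (v : H)⟫ = ⟪S.vec j, (w : H)⟫ := fun j => by
    have h1 := congrArg (fun z : lp (fun _ : ℕ => ℝ) 2 => (z : ℕ → ℝ) j) h
    exact mul_left_cancel₀ (S.weight_ne_zero s j) h1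
  have hd : (v : H) - w ∈ (Submodule.span ℝ (range S.vec))ᗮ := by
    rw [Submodule.mem_orthogonal]
    intro z hz
    induction hz using Submodule.span_induction with
    | mem x hx =>
      obtain ⟨j, rfl⟩ := hx
      rw [inner_sub_right, hj, sub_self]
    | zero => exact inner_zero_left _
    | add x y _ _ hx hy => rw [inner_add_left, hx, hy, add_zero]
    | smul c x _ hx => rw [real_inner_smul_left, hx, mul_zero]
  rw [Submodule.topologicalClosure_eq_top_iff.1 S.complete] at hd
  exact Subtype.ext (sub_eq_zero.1 ((Submodule.mem_bot ℝ).1 hd))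

/-- `D(A^s)` endowed with the norm
`(∑_{λ_j = 0} |(v, e_j)|² + ∑_{λ_j > 0} |λ_j^s (v, e_j)|²)^(1/2)`.
If the first eigenvalue is positive, this is `‖A^s v‖`; if it is zero and simple, this is
`(|(v, e_1)|² + ‖A^s v‖²)^(1/2)` with `e_1` the first eigenvector. -/
def EnergySpace (s : ℝ) : Type _ := S.domPow s

namespace EnergySpace

variable {S} {s : ℝ}

instance : NormedAddCommGroup (S.EnergySpace s) :=
  NormedAddCommGroup.induced (S.domPow s) (lp (fun _ : ℕ => ℝ) 2) (S.coeffMap s)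
    (S.coeffMap_injective s)

instance : NormedSpace ℝ (S.EnergySpace s) :=
  NormedSpace.induced ℝ (S.domPow s) (lp (fun _ : ℕ => ℝ) 2) (S.coeffMap s)

/-- The inclusion of `D(A^s)` into `H`. -/
def toH : S.EnergySpace s →ₗ[ℝ] H := (S.domPow s).subtype

/-- `v ↦ A^s v`. -/
def op : S.EnergySpace s →ₗ[ℝ] H := S.pow s

end EnergySpace

/-- The dual of `D(A^s)` (the space with exponent `-s`), with the dual norm. -/
abbrev DualSpace (s : ℝ) : Type _ := StrongDual ℝ (S.EnergySpace s)

/-- The functional `f` on `D(A^s)` is the element `w` of `H`, under the usual identification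
`⟨w, v⟩ = (w, v)` of `H` with a subspace of the dual of `D(A^s)`. -/
def Represents {s : ℝ} (f : S.DualSpace s) (w : H) : Prop :=
  ∀ v : S.EnergySpace s, f v = ⟪w, EnergySpace.toH v⟫

end EigenSystem

end Abstract

/-! ### The nonlinearities -/

/-- The subdifferential of a convex function `ℝ → [0,+∞]`. -/
def subdiff (βh : ℝ → ℝ≥0∞) (s : ℝ) : Set ℝ :=
  {ξ | ∀ z : ℝ, (βh s : EReal) + ((ξ * (z - s) : ℝ) : EReal) ≤ (βh z : EReal)}

/-- The effective domain of the subdifferential. -/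
def subdiffDom (βh : ℝ → ℝ≥0∞) : Set ℝ := {s | (subdiff βh s).Nonempty}

/-- `ξ` is the element of minimum modulus of the subdifferential at `s`. -/
def IsMinSection (βh : ℝ → ℝ≥0∞) (s ξ : ℝ) : Prop :=
  ξ ∈ subdiff βh s ∧ ∀ η ∈ subdiff βh s, |ξ| ≤ |η|

/-- The resolvent `(I + lam β)⁻¹` of the subdifferential `β`: the point `p` with
`s ∈ p + lam β(p)`. -/
def resolvent (βh : ℝ → ℝ≥0∞) (lam s : ℝ) : ℝ :=
  Classical.epsilon fun p => (s - p) / lam ∈ subdiff βh p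

/-- The Yosida approximation of the subdifferential. -/
def yosida (βh : ℝ → ℝ≥0∞) (lam s : ℝ) : ℝ := (s - resolvent βh lam s) / lam

/-- The assumptions on the convex part `βh` and on the smooth perturbation `πh` of the
potential. -/
structure IsAdmissiblePotential (βh : ℝ → ℝ≥0∞) (πh : ℝ → ℝ) : Prop where
  convex : ConvexOn ℝ≥0 univ βh
  lsc : LowerSemicontinuous βh
  zero : βh 0 = 0
  contDiff : ContDiff ℝ 1 πh
  lipschitz : ∃ L : ℝ≥0, LipschitzWith L (deriv πh)
  coercive : 0 < liminf
    (fun s : ℝ => ((βh s : EReal) + (πh s : EReal)) / ((s ^ 2 : ℝ) : EReal))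
    (Bornology.cobounded ℝ)

/-! ### The evolution problem -/

/-- The space `L²(Ω)`, for `Ω` in `ℝ³`. -/
abbrev L2 (Ω : Set (EuclideanSpace ℝ (Fin 3))) : Type :=
  Lp ℝ 2 ((volume : Measure (EuclideanSpace ℝ (Fin 3))).restrict Ω)

/-- Lebesgue measure on `(0,T)`. -/
abbrev timeMeasure (T : ℝ) : Measure ℝ := volume.restrict (Ioo 0 T)

/-- The convex functional `v ↦ ∫_Ω βh(v)`, equal to `+∞` if `βh(v)` is not integrable. -/
def energy {Ω : Set (EuclideanSpace ℝ (Fin 3))} (βh : ℝ → ℝ≥0∞) (v : L2 Ω) : ℝ≥0∞ :=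
  ∫⁻ x in Ω, βh (v x)

/-- `u` belongs to `H¹(0,T;X)` and `du` is its derivative; `u` is the continuous
representative. -/
structure IsH1 {X : Type*} [NormedAddCommGroup X] [NormedSpace ℝ X] (T : ℝ) (u du : ℝ → X) :
    Prop where
  memLp : MemLp u 2 (timeMeasure T)
  memLp_deriv : MemLp du 2 (timeMeasure T)
  eq_integral : ∀ t ∈ Icc 0 T, u t = u 0 + ∫ s in (0 : ℝ)..t, du s

variable {Ω : Set (EuclideanSpace ℝ (Fin 3))} {A B : L2 Ω →ₗ.[ℝ] L2 Ω}

/-- `(y, μ)` is a solution of the Cauchy problem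
`⟨∂ₜy, v⟩ + (A^r μ, A^r v) = 0`,
`τ(∂ₜy, y - v) + (B^σ y, B^σ(y - v)) + ∫ βh(y) + (πh'(y) - u, y - v) ≤ (μ, y - v) + ∫ βh(v)`,
`y(0) = y0`, with the time derivative `dy = ∂ₜy`, a function with values in the dual of
`D(A^r)`. The membership of `y` in `H¹(0,T; D(A^r)*)`, with derivative `dy`, and the initial
condition are expressed through the continuous representative
`t ↦ y0 + ∫_0^t dy(s) ds` of `y`. -/
structure IsSolution (SA : EigenSystem A) (SB : EigenSystem B) (r σ τ T : ℝ)
    (βh : ℝ → ℝ≥0∞) (πh : ℝ → ℝ) (u : ℝ → L2 Ω) (y0 : L2 Ω)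
    (y : ℝ → SB.GraphSpace σ) (dy : ℝ → SA.DualSpace r) (μ : ℝ → SA.EnergySpace r) : Prop where
  y_memLp : MemLp y ∞ (timeMeasure T)
  dy_memLp : MemLp dy 2 (timeMeasure T)
  y_eq_integral : ∃ Y : ℝ → SA.DualSpace r, SA.Represents (Y 0) y0 ∧
    (∀ t ∈ Icc 0 T, Y t = Y 0 + ∫ s in (0 : ℝ)..t, dy s) ∧
    ∀ᵐ t ∂(timeMeasure T), SA.Represents (Y t) (EigenSystem.GraphSpace.toH (y t))
  mu_memLp : MemLp μ 2 (timeMeasure T)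
  energy_integrable : ∫⁻ t, energy βh (EigenSystem.GraphSpace.toH (y t)) ∂(timeMeasure T) < ∞
  first : ∀ᵐ t ∂(timeMeasure T), ∀ v : SA.EnergySpace r,
    dy t v + ⟪EigenSystem.EnergySpace.op (μ t), EigenSystem.EnergySpace.op v⟫ = 0
  /-- `tdy` is `τ ∂ₜy`, as an element of `L²(0,T;H)`. -/
  second : ∃ tdy : ℝ → L2 Ω, MemLp tdy 2 (timeMeasure T) ∧
    (∀ᵐ t ∂(timeMeasure T), SA.Represents (τ • dy t) (tdy t)) ∧
    ∀ᵐ t ∂(timeMeasure T), ∀ v : SB.GraphSpace σ,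
      ((⟪tdy t, EigenSystem.GraphSpace.toH (y t - v)⟫
        + ⟪EigenSystem.GraphSpace.op (y t), EigenSystem.GraphSpace.op (y t - v)⟫
        + ∫ x in Ω, (deriv πh (EigenSystem.GraphSpace.toH (y t) x) - u t x)
            * EigenSystem.GraphSpace.toH (y t - v) x : ℝ) : EReal)
        + (energy βh (EigenSystem.GraphSpace.toH (y t)) : EReal)
      ≤ ((⟪EigenSystem.EnergySpace.toH (μ t),
            EigenSystem.GraphSpace.toH (y t - v)⟫ : ℝ) : EReal)
        + (energy βh (EigenSystem.GraphSpace.toH v) : EReal)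

/-- The additional condition on the initial datum `y0 ∈ D(B^(2σ))` in the viscous case: the
minimal section of `β` at `y0` is in `L²(Ω)`, with norm at most `R`. -/
def ViscousData (βh : ℝ → ℝ≥0∞) (y0 : L2 Ω) (R : ℝ) : Prop :=
  ∃ b0 : L2 Ω, (∀ᵐ x ∂(volume.restrict Ω), IsMinSection βh (y0 x) (b0 x)) ∧ ‖b0‖ ≤ R

/-- The additional condition on the data in the nonviscous case: for all sufficiently small
`lam > 0` and `t > 0`, the function `B^(2σ) y0 + β_lam(y0) + πh'(y0) - u(t)` belongs to `D(A^r)`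
with norm at most `M0`. -/
def NonviscousData (SA : EigenSystem A) (SB : EigenSystem B) (r σ : ℝ)
    (βh : ℝ → ℝ≥0∞) (πh : ℝ → ℝ) (u : ℝ → L2 Ω) (y0 : SB.GraphSpace (2 * σ)) (M0 : ℝ) : Prop :=
  ∃ ε > 0, ∀ lam ∈ Ioo 0 ε, ∀ t ∈ Ioo 0 ε, ∃ m : SA.EnergySpace r,
    (∀ᵐ x ∂(volume.restrict Ω), EigenSystem.EnergySpace.toH m x =
      EigenSystem.GraphSpace.op y0 x + yosida βh lam (EigenSystem.GraphSpace.toH y0 x)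
        + deriv πh (EigenSystem.GraphSpace.toH y0 x) - u t x) ∧ ‖m‖ ≤ M0

end FracCH

end

/-! The difference-quotient argument applies directly to the given solution, with no regularization
of the problem. The space `D(A^r)` is isometric to `ℓ²` through weighted Fourier coefficients, and
so is its dual through the Riesz map. Both terms containing `∂ₜy` become a single one in `X = ℓ² ×
H`: with `j v = (v as a functional on D(A^r), √τ v)`, the function `G = (∂ₜy, √τ ∂ₜy)` is the
derivative of `j y`. The first equation says that, apart from its component along the kernel of
`A^r`, `μ` is minus the Riesz representative of `∂ₜy`. That component pairs to zero with differences
of states, because the component of `y` along the kernel is conserved.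

Let `y(t)` and `y(s)` test each other's inequality. The convex energies cancel, the operator `B^σ`
contributes `‖B^σ(y(t) - y(s))‖²`, and the Lipschitz perturbation is absorbed by Ehrling's
inequality (`GraphSpace.ehrling`). This yields (`GoodTime.difference_le`) `⟪G(t) - G(s), j(y(t) -
y(s))⟫ + ½‖y(t) - y(s)‖² ≤ C (‖j(y(t) - y(s))‖² + ‖u(t) - u(s)‖²)`. With the pair of times `t`, `t +
h`, integration and Grönwall bound the increments of `j y` uniformly, and those of `y` in `L²` with
values in `D(B^σ)`, by a multiple of `h`, provided that `‖j(y(h) - y0)‖ = O(h)`.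

The last bound is where the hypotheses on `y0` enter (`GoodTime.initial_le`). Testing with `y0`,
moving `B^σ` across since `y0 ∈ D(B^(2σ))`, and using a subgradient of the convex part at `y0`, one
gets `⟪G, j(y - y0)⟫ ≤ C‖j(y - y0)‖² + M‖j(y - y0)‖` for small times. For `τ > 0` the minimal
section is a subgradient, and the `H` norm is controlled by `τ^(-1/2)‖j ·‖`. For `τ = 0` the Yosida
approximations are subgradients up to an arbitrarily small error (`exists_energy_add_inner_le`), and
the bound `M₀` in `D(A^r)` is used by duality. Weak compactness and Fatou's lemma pass from the
quotients to `∂ₜy` (`exists_derivative_of_difference_inequality`).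

These bounds on `∂ₜy` control `μ` except for its kernel component. When the first eigenvalue
vanishes, that component is bounded by testing with constants on both sides of the mean value
(`exists_kernel_bound`). Finally `A^(2r) μ = -∂ₜy`, read coefficient by coefficient, gives the
regularity of `μ` in `D(A^(2r))`. All constants are fixed before the data and the solution are
introduced, which is the asserted uniformity. -/

namespace FracCH

/-! ### Calculus of primitives: chain rule, short-time growth, Grönwall -/

section Calculus

/-- Increments of `f` dominated by those of `g` inherit the `ε`–`δ` condition, with `ε` rescaled.
The use below takes for `g` the primitive of an integrable norm. -/
theorem absolutelyContinuousOnInterval_of_dist_le {X Y : Type*} [PseudoMetricSpace X]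
    [PseudoMetricSpace Y] {f : ℝ → X} {g : ℝ → Y} {a b C : ℝ}
    (hg : AbsolutelyContinuousOnInterval g a b)
    (h : ∀ s ∈ uIcc a b, ∀ t ∈ uIcc a b, dist (f s) (f t) ≤ C * dist (g s) (g t)) :
    AbsolutelyContinuousOnInterval f a b := by
  rw [absolutelyContinuousOnInterval_iff] at hg ⊢
  intro ε hε
  obtain ⟨δ, hδ, H⟩ := hg (ε / (|C| + 1)) (by positivity)
  refine ⟨δ, hδ, fun E hE hs => ?_⟩
  have h1 := H E hE hs
  have h2 : ∑ i ∈ Finset.range E.1, dist (f (E.2 i).1) (f (E.2 i).2)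
      ≤ (|C| + 1) * ∑ i ∈ Finset.range E.1, dist (g (E.2 i).1) (g (E.2 i).2) := by
    rw [Finset.mul_sum]
    refine Finset.sum_le_sum fun i hi => ?_
    have hE' := hE.1 i (Finset.mem_range.1 hi |> Finset.mem_range.2)
    refine (h _ hE'.1 _ hE'.2).trans ?_
    gcongr
    exact (le_abs_self C).trans (by linarith)
  calc _ ≤ _ := h2
    _ < (|C| + 1) * (ε / (|C| + 1)) := by gcongr
    _ = ε := by field_simp

variable {X : Type*} [NormedAddCommGroup X] [InnerProductSpace ℝ X]

theorem continuousOn_of_eq_integral {Y : Type*} [NormedAddCommGroup Y] [NormedSpace ℝ Y]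
    {f g : ℝ → Y} {b : ℝ} (hg : IntervalIntegrable g volume 0 b)
    (hf : ∀ t ∈ Icc 0 b, f t = f 0 + ∫ s in (0 : ℝ)..t, g s) :
    ContinuousOn f (Icc 0 b) := by
  rcases lt_or_ge b 0 with hb | hb
  · simp [Icc_eq_empty hb.not_ge]
  have h := intervalIntegral.continuousOn_primitive_interval' hg (left_mem_uIcc)
  rw [uIcc_of_le hb] at h
  exact (continuousOn_const.add h).congr hf

theorem intervalIntegrable_inner {f g : ℝ → X} {b : ℝ} (hb : 0 ≤ b)
    (hg : IntervalIntegrable g volume 0 b) (hf : ContinuousOn f (Icc 0 b)) :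
    IntervalIntegrable (fun s => ⟪g s, f s⟫) volume 0 b := by
  obtain ⟨M, hM⟩ := isCompact_Icc.exists_bound_of_continuousOn hf
  rw [intervalIntegrable_iff_integrableOn_Ioc_of_le hb] at hg ⊢
  have hfm : AEStronglyMeasurable f (volume.restrict (Ioc 0 b)) :=
    (hf.mono Ioc_subset_Icc_self).aestronglyMeasurable measurableSet_Ioc
  refine Integrable.mono' (g := fun s => M * ‖g s‖) (hg.norm.const_mul M)
    (hg.1.inner hfm) ?_
  filter_upwards [ae_restrict_mem measurableSet_Ioc] with s hs
  refine (norm_inner_le_norm _ _).trans ?_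
  rw [mul_comm]
  gcongr
  exact hM s (Ioc_subset_Icc_self hs)

variable [CompleteSpace X]

/-- The chain rule for the squared norm of a primitive. -/
theorem norm_sq_eq_add_integral_inner {f g : ℝ → X} {b : ℝ} (hb : 0 ≤ b)
    (hg : IntervalIntegrable g volume 0 b)
    (hf : ∀ t ∈ Icc 0 b, f t = f 0 + ∫ s in (0 : ℝ)..t, g s) :
    ‖f b‖ ^ 2 = ‖f 0‖ ^ 2 + 2 * ∫ s in (0 : ℝ)..b, ⟪g s, f s⟫ := by
  have hfc := continuousOn_of_eq_integral hg hf
  obtain ⟨M, hM⟩ := isCompact_Icc.exists_bound_of_continuousOn hfc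
  have hu : uIcc 0 b = Icc 0 b := uIcc_of_le hb
  have hgs : ∀ s ∈ Icc 0 b, ∀ t ∈ Icc 0 b, IntervalIntegrable g volume s t := fun s hs t ht =>
    hg.mono_set (by rw [hu]; exact uIcc_subset_Icc hs ht)
  have h0 : (0 : ℝ) ∈ Icc 0 b := ⟨le_rfl, hb⟩
  -- Since `‖f‖ ≤ M` on the compact interval, increments of `‖f‖²` are at most `2M` times those of
  -- `∫‖g‖`. Absolute continuity then recovers `‖f‖²` from its almost everywhere derivative.
  have hac : AbsolutelyContinuousOnInterval (fun t => ‖f t‖ ^ 2) 0 b := by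
    refine absolutelyContinuousOnInterval_of_dist_le (C := 2 * M)
      (hg.norm.absolutelyContinuousOnInterval_intervalIntegral left_mem_uIcc) ?_
    rw [hu]
    intro s hs t ht
    have h1 : f s - f t = ∫ x in t..s, g x := by
      rw [hf s hs, hf t ht, add_sub_add_left_eq_sub,
        intervalIntegral.integral_interval_sub_left (hgs 0 h0 s hs) (hgs 0 h0 t ht)]
    have h2 : ‖f s - f t‖ ≤ |∫ x in t..s, ‖g x‖| := by
      rw [h1]; exact intervalIntegral.norm_integral_le_abs_integral_norm
    rw [Real.dist_eq, Real.dist_eq,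
      intervalIntegral.integral_interval_sub_left (hgs 0 h0 s hs).norm (hgs 0 h0 t ht).norm]
    have h3 : ‖f s‖ ^ 2 - ‖f t‖ ^ 2 = ⟪f s + f t, f s - f t⟫ := by
      rw [inner_add_left, inner_sub_right, inner_sub_right, real_inner_self_eq_norm_sq,
        real_inner_self_eq_norm_sq, real_inner_comm (f s) (f t)]
      ring
    rw [h3]
    refine (abs_real_inner_le_norm _ _).trans ?_
    have h4 : ‖f s + f t‖ ≤ 2 * M := (norm_add_le _ _).trans (by linarith [hM s hs, hM t ht])
    exact mul_le_mul h4 h2 (norm_nonneg _) ((norm_nonneg _).trans h4)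
  have hd : ∀ᵐ t, t ∈ uIoc 0 b → deriv (fun t => ‖f t‖ ^ 2) t = 2 * ⟪g t, f t⟫ := by
    -- The endpoint is discarded because `f` is known to be a primitive only on `[0, b]`, and a
    -- two-sided derivative needs a neighbourhood.
    have hb' : ∀ᵐ t : ℝ, t ≠ b := by simp [ae_iff, measure_singleton]
    filter_upwards [hg.ae_hasDerivAt_integral, hb'] with t ht htb htm
    rw [uIoc_of_le hb] at htm
    have ht' : t ∈ Ioo 0 b := ⟨htm.1, lt_of_le_of_ne htm.2 htb⟩
    have h1 := (ht (by rw [hu]; exact Ioo_subset_Icc_self ht') 0 left_mem_uIcc).const_add (f 0)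
    have h2 : HasDerivAt f (g t) t := h1.congr_of_eventuallyEq (by
      filter_upwards [Ioo_mem_nhds ht'.1 ht'.2] with s hs
      exact hf s (Ioo_subset_Icc_self hs))
    rw [h2.norm_sq.deriv, real_inner_comm]
  have h := hac.integral_deriv_eq_sub
  rw [intervalIntegral.integral_congr_ae hd, intervalIntegral.integral_const_mul] at h
  linarith

/-- Growth of a primitive with vanishing initial value, for small times. -/
theorem norm_le_of_inner_le {f g : ℝ → X} {b C M : ℝ} (hb : 0 ≤ b) (hC : 0 ≤ C) (hM : 0 ≤ M)
    (hCb : 4 * C * b ≤ 1) (hg : IntervalIntegrable g volume 0 b)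
    (hf : ∀ t ∈ Icc 0 b, f t = ∫ s in (0 : ℝ)..t, g s)
    (h : ∀ᵐ t, t ∈ Ioc 0 b → ⟪g t, f t⟫ ≤ C * ‖f t‖ ^ 2 + M * ‖f t‖) :
    ‖f b‖ ≤ 4 * M * b := by
  have hf0 : f 0 = 0 := by rw [hf 0 ⟨le_rfl, hb⟩]; simp
  have hf' : ∀ t ∈ Icc 0 b, f t = f 0 + ∫ s in (0 : ℝ)..t, g s := fun t ht => by
    rw [hf0, zero_add, hf t ht]
  have hfc := continuousOn_of_eq_integral hg hf'
  -- At a maximum point of `‖f‖` the chain rule becomes a quadratic inequality for the maximum `N`,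
  -- namely `N² ≤ 2b(CN² + MN)`. The condition `4Cb ≤ 1` absorbs the quadratic part into half of
  -- `N²`.
  obtain ⟨t₀, ht₀, hmax⟩ := isCompact_Icc.exists_isMaxOn ⟨0, le_rfl, hb⟩ hfc.norm
  set N := ‖f t₀‖ with hN
  have hN0 : 0 ≤ N := norm_nonneg _
  have hmax' : ∀ t ∈ Icc 0 b, ‖f t‖ ≤ N := fun t ht => hmax ht
  have hsub : Icc 0 t₀ ⊆ Icc 0 b := Icc_subset_Icc_right ht₀.2
  have hg' : IntervalIntegrable g volume 0 t₀ := hg.mono_set (by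
    rw [uIcc_of_le hb, uIcc_of_le ht₀.1]; exact hsub)
  have h1 := norm_sq_eq_add_integral_inner ht₀.1 hg' fun t ht => hf' t (hsub ht)
  have h2 : ∫ s in (0 : ℝ)..t₀, ⟪g s, f s⟫ ≤ ∫ s in (0 : ℝ)..t₀, (C * N ^ 2 + M * N) := by
    refine intervalIntegral.integral_mono_ae_restrict ht₀.1
      (intervalIntegrable_inner ht₀.1 hg' (hfc.mono hsub)) (by simp) ?_
    rw [EventuallyLE, ae_restrict_iff' measurableSet_Icc]
    have h0 : ∀ᵐ t : ℝ, t ≠ 0 := by simp [ae_iff, measure_singleton]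
    filter_upwards [h, h0] with t ht ht0 htm
    have hm : t ∈ Icc 0 b := hsub htm
    refine (ht ⟨lt_of_le_of_ne htm.1 (Ne.symm ht0), hm.2⟩).trans ?_
    have := hmax' t hm
    gcongr
  rw [hf0, norm_zero] at h1
  rw [intervalIntegral.integral_const, smul_eq_mul, sub_zero] at h2
  have h3 : N ^ 2 ≤ 2 * (b * (C * N ^ 2 + M * N)) := by
    have : t₀ * (C * N ^ 2 + M * N) ≤ b * (C * N ^ 2 + M * N) := by
      have := ht₀.2
      gcongr
    nlinarith
  have h4 : N ^ 2 ≤ 4 * M * b * N := by nlinarith [sq_nonneg N]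
  have h5 : N ≤ 4 * M * b := by
    rcases hN0.eq_or_lt with h0 | h0
    · rw [← h0]; positivity
    · nlinarith
  exact (hmax' b ⟨hb, le_rfl⟩).trans h5

/-- Grönwall's inequality in integral form. -/
theorem le_mul_exp_of_le_add_integral {q : ℝ → ℝ} {a b C : ℝ} (hC : 0 ≤ C)
    (hq : ContinuousOn q (Icc 0 b))
    (h : ∀ t ∈ Icc 0 b, q t ≤ a + C * ∫ s in (0 : ℝ)..t, q s) :
    ∀ t ∈ Icc 0 b, q t ≤ a * Real.exp (C * t) := by
  rcases lt_or_ge b 0 with hb | hb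
  · simp [Icc_eq_empty hb.not_ge]
  have hqi : IntervalIntegrable q volume 0 b := by
    apply ContinuousOn.intervalIntegrable
    rwa [uIcc_of_le hb]
  -- The differential form of Grönwall is applied to the right-hand side `Q`, since `q` itself is
  -- only continuous.
  set Q : ℝ → ℝ := fun t => a + C * ∫ s in (0 : ℝ)..t, q s with hQ
  have hQc : ContinuousOn Q (Icc 0 b) := by
    have h := intervalIntegral.continuousOn_primitive_interval' hqi left_mem_uIcc
    rw [uIcc_of_le hb] at h
    exact continuousOn_const.add (continuousOn_const.mul h)
  have hder : ∀ t ∈ Ico 0 b, HasDerivWithinAt Q (C * q t) (Ici t) t := fun t ht => by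
    have hI : IntervalIntegrable q volume 0 t := hqi.mono_set (by
      rw [uIcc_of_le hb, uIcc_of_le ht.1]; exact Icc_subset_Icc_right ht.2.le)
    have hct : ContinuousWithinAt q (Ioi t) t :=
      ((hq t ⟨ht.1, ht.2.le⟩).mono_of_mem_nhdsWithin (by
        refine mem_nhdsWithin.2 ⟨Iio b, isOpen_Iio, ht.2, fun s hs => ?_⟩
        exact ⟨ht.1.trans (le_of_lt hs.2), hs.1.le⟩))
    have hsm : StronglyMeasurableAtFilter q (𝓝[Ioi t] t) := by
      refine ⟨Ioo t b, Ioo_mem_nhdsGT ht.2, ?_⟩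
      exact (hq.mono fun s hs => ⟨ht.1.trans hs.1.le, hs.2.le⟩).aestronglyMeasurable
        measurableSet_Ioo
    have := intervalIntegral.integral_hasDerivWithinAt_right hI (s := Ici t) (t := Ioi t) hsm hct
    exact (this.const_mul C).const_add a
  intro t ht
  have hg := le_gronwallBound_of_liminf_deriv_right_le (f := Q) (f' := fun t => C * q t)
    (δ := a) (K := C) (ε := 0) (a := 0) (b := b) hQc
    (fun x hx r hr => (hder x hx).liminf_right_slope_le hr) (by simp [hQ])
    (fun x hx => by
      have := h x ⟨hx.1, hx.2.le⟩
      rw [add_zero]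
      gcongr) t ht
  rw [gronwallBound_ε0, sub_zero] at hg
  exact (h t ht).trans hg

end Calculus

/-! ### Time translations and `L²` bounds for increments -/

section DifferenceQuotients

theorem lintegral_sq_le_iff {α Y : Type*} [MeasurableSpace α] [NormedAddCommGroup Y]
    {m : Measure α} {f : α → Y} {c : ℝ≥0∞} :
    ∫⁻ t, ‖f t‖ₑ ^ 2 ∂m ≤ c ^ 2 ↔ eLpNorm f 2 m ≤ c := by
  have h := eLpNorm_nnreal_pow_eq_lintegral (f := f) (μ := m) (p := 2) two_ne_zero
  simp only [NNReal.coe_ofNat, ENNReal.rpow_ofNat, ENNReal.coe_ofNat] at h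
  rw [← h]
  exact ENNReal.pow_le_pow_left_iff two_ne_zero

/-- Tonelli after a translation: every point `s` is counted for a set of times `t` of length `h`. A
measurable representative is used because `φ` is only almost everywhere measurable. -/
theorem lintegral_lintegral_Ioc_le {φ : ℝ → ℝ≥0∞} (hφ : AEMeasurable φ) (h : ℝ) :
    ∫⁻ t, ∫⁻ s in Ioc t (t + h), φ s ≤ ENNReal.ofReal h * ∫⁻ s, φ s := by
  have h1 : ∀ t, ∫⁻ s in Ioc t (t + h), φ s = ∫⁻ s in Ioc 0 h, hφ.mk φ (t + s) := fun t => by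
    rw [lintegral_congr_ae (ae_restrict_of_ae hφ.ae_eq_mk)]
    have := (measurePreserving_add_left (volume : Measure ℝ) t).setLIntegral_comp_preimage_emb
      (MeasurableEquiv.addLeft t).measurableEmbedding (hφ.mk φ) (Ioc t (t + h))
    rw [← this]
    congr 2
    ext s
    simp
  have hm : Measurable (fun p : ℝ × ℝ => hφ.mk φ (p.1 + p.2)) :=
    hφ.measurable_mk.comp (measurable_fst.add measurable_snd)
  simp_rw [h1]
  rw [lintegral_lintegral_swap hm.aemeasurable]
  simp_rw [lintegral_add_right_eq_self (hφ.mk φ)]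
  rw [setLIntegral_const, Real.volume_Ioc, sub_zero, mul_comm, lintegral_congr_ae hφ.ae_eq_mk]

theorem sq_lintegral_le {α : Type*} [MeasurableSpace α] {m : Measure α} {φ : α → ℝ≥0∞}
    (hφ : AEMeasurable φ m) : (∫⁻ s, φ s ∂m) ^ 2 ≤ m univ * ∫⁻ s, φ s ^ 2 ∂m := by
  have h := ENNReal.lintegral_mul_le_Lp_mul_Lq m Real.HolderConjugate.two_two
    (f := fun _ => 1) (g := φ) aemeasurable_const hφ
  simp only [Pi.mul_apply, one_mul, lintegral_const, ENNReal.rpow_ofNat, one_pow] at h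
  calc (∫⁻ s, φ s ∂m) ^ 2 ≤ (m univ ^ (1 / 2 : ℝ) * (∫⁻ s, φ s ^ 2 ∂m) ^ (1 / 2 : ℝ)) ^ 2 := by
        gcongr
    _ = m univ * ∫⁻ s, φ s ^ 2 ∂m := by
        rw [mul_pow, ← ENNReal.rpow_natCast, ← ENNReal.rpow_natCast, ← ENNReal.rpow_mul,
          ← ENNReal.rpow_mul]
        norm_num

variable {T : ℝ}

theorem intervalIntegrable_of_memLp {Y : Type*} [NormedAddCommGroup Y] {f : ℝ → Y}
    (hf : MemLp f 2 (timeMeasure T)) {s t : ℝ} (hs : s ∈ Icc 0 T) (ht : t ∈ Icc 0 T) :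
    IntervalIntegrable f volume s t := by
  have h1 : IntegrableOn f (Ioo 0 T) := hf.integrable (by norm_num)
  have h2 : IntegrableOn f (Icc 0 T) := by
    rwa [integrableOn_Icc_iff_integrableOn_Ioo]
  rw [intervalIntegrable_iff]
  exact h2.mono_set (uIoc_subset_uIcc.trans (uIcc_subset_Icc hs ht))

/-- Each of the two factors `h` has its own source: Cauchy–Schwarz on `(t, t + h]`, and Tonelli over
the sliding window. -/
theorem lintegral_sq_sub_le {Y : Type*} [NormedAddCommGroup Y] [NormedSpace ℝ Y]
    {u du : ℝ → Y} (hu : IsH1 T u du) {h : ℝ} (hh : 0 < h) :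
    ∫⁻ t in Ioo 0 (T - h), ‖u (t + h) - u t‖ₑ ^ 2
      ≤ ENNReal.ofReal h ^ 2 * ∫⁻ t in Ioo 0 T, ‖du t‖ₑ ^ 2 := by
  set φ : ℝ → ℝ≥0∞ := (Ioo 0 T).indicator fun s => ‖du s‖ₑ ^ 2 with hφ
  have hφm : AEMeasurable φ :=
    (aemeasurable_indicator_iff measurableSet_Ioo).2 (hu.memLp_deriv.1.enorm.pow_const 2)
  have h1 : ∀ t ∈ Ioo 0 (T - h), ‖u (t + h) - u t‖ₑ ^ 2
      ≤ ENNReal.ofReal h * ∫⁻ s in Ioc t (t + h), φ s := fun t ht => by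
    have hsub : Ioc t (t + h) ⊆ Ioo 0 T := fun s hs => ⟨ht.1.trans hs.1, by
      have := hs.2; have := ht.2; linarith⟩
    have e0 : (0 : ℝ) ∈ Icc 0 T := ⟨le_rfl, by linarith [ht.1, ht.2]⟩
    have e1 : t ∈ Icc 0 T := ⟨ht.1.le, by linarith [ht.2]⟩
    have e2 : t + h ∈ Icc 0 T := ⟨by linarith [ht.1], by linarith [ht.2]⟩
    have hi {a b : ℝ} := intervalIntegrable_of_memLp hu.memLp_deriv (s := a) (t := b)
    have e : u (t + h) - u t = ∫ s in Ioc t (t + h), du s := by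
      rw [hu.eq_integral _ e2, hu.eq_integral _ e1, add_sub_add_left_eq_sub,
        intervalIntegral.integral_interval_sub_left (hi e0 e2) (hi e0 e1),
        intervalIntegral.integral_of_le (by linarith)]
    have hm : AEMeasurable (fun s => ‖du s‖ₑ) (volume.restrict (Ioc t (t + h))) :=
      (hu.memLp_deriv.1.mono_measure (Measure.restrict_mono hsub le_rfl)).enorm
    calc ‖u (t + h) - u t‖ₑ ^ 2 ≤ (∫⁻ s in Ioc t (t + h), ‖du s‖ₑ) ^ 2 := by
          rw [e]; gcongr; exact enorm_integral_le_lintegral_enorm _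
      _ ≤ _ := sq_lintegral_le hm
      _ = _ := by
          rw [Measure.restrict_apply_univ, Real.volume_Ioc, add_sub_cancel_left]
          congr 1
          refine setLIntegral_congr_fun measurableSet_Ioc fun s hs => ?_
          simp only [hφ]
          rw [indicator_of_mem (hsub hs)]
  calc _ ≤ ∫⁻ t in Ioo 0 (T - h), ENNReal.ofReal h * ∫⁻ s in Ioc t (t + h), φ s :=
        setLIntegral_mono' measurableSet_Ioo h1
    _ ≤ ∫⁻ t, ENNReal.ofReal h * ∫⁻ s in Ioc t (t + h), φ s := setLIntegral_le_lintegral _ _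
    _ = ENNReal.ofReal h * ∫⁻ t, ∫⁻ s in Ioc t (t + h), φ s :=
        lintegral_const_mul' _ _ ENNReal.ofReal_ne_top
    _ ≤ ENNReal.ofReal h * (ENNReal.ofReal h * ∫⁻ s, φ s) := by
        gcongr; exact lintegral_lintegral_Ioc_le hφm h
    _ = _ := by
        rw [← mul_assoc, ← sq, hφ, lintegral_indicator measurableSet_Ioo]

/-- Translations preserve null sets, so a property valid at almost every time holds at `t` and `t +
h` together for almost every `t`. This permits the two-time inequality to be integrated. -/
theorem ae_and_ae_add {P : ℝ → Prop} (hP : ∀ᵐ t ∂(timeMeasure T), P t) {h : ℝ} (hh : 0 < h) :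
    ∀ᵐ t, t ∈ Ioo 0 (T - h) → P t ∧ P (t + h) := by
  rw [ae_restrict_iff' measurableSet_Ioo] at hP
  have h2 := (measurePreserving_add_right (volume : Measure ℝ) h).quasiMeasurePreserving.ae hP
  filter_upwards [hP, h2] with t h1 h2 ht
  exact ⟨h1 ⟨ht.1, by linarith [ht.2]⟩, h2 ⟨by linarith [ht.1], by linarith [ht.2]⟩⟩

theorem aestronglyMeasurable_comp_add {Y : Type*} [TopologicalSpace Y] {f : ℝ → Y}
    (hf : AEStronglyMeasurable f (timeMeasure T)) {h : ℝ} (hh : 0 < h) :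
    AEStronglyMeasurable (fun t => f (t + h)) (volume.restrict (Ioo 0 (T - h))) := by
  have h1 := (measurePreserving_add_right (volume : Measure ℝ) h).restrict_preimage
    (s := Ioo 0 T) measurableSet_Ioo
  have h2 := hf.comp_measurePreserving h1
  refine h2.mono_measure (Measure.restrict_mono (fun t ht => ?_) le_rfl)
  exact ⟨by linarith [ht.1], by linarith [ht.2]⟩

end DifferenceQuotients

/-! ### Uniform estimates of the increments -/

section Abstract

variable {X V U : Type*} [NormedAddCommGroup X] [InnerProductSpace ℝ X] [CompleteSpace X]
  [NormedAddCommGroup V] [InnerProductSpace ℝ V]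
  [NormedAddCommGroup U] [NormedSpace ℝ U] {T : ℝ}

theorem integral_norm_sq_sub_le {u du : ℝ → U} (hu : IsH1 T u du) {R : ℝ} (hR : 0 ≤ R)
    (hdu : eLpNorm du 2 (timeMeasure T) ≤ ENNReal.ofReal R) {h b : ℝ} (hh : 0 < h)
    (hb : b ∈ Icc 0 (T - h)) :
    IntervalIntegrable (fun t => ‖u (t + h) - u t‖ ^ 2) volume 0 b ∧
    ∫ t in (0 : ℝ)..b, ‖u (t + h) - u t‖ ^ 2 ≤ h ^ 2 * R ^ 2 := by
  have h0T : (0 : ℝ) ≤ T := by linarith [hb.1, hb.2]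
  have huc := continuousOn_of_eq_integral (intervalIntegrable_of_memLp hu.memLp_deriv
    ⟨le_rfl, h0T⟩ ⟨h0T, le_rfl⟩) hu.eq_integral
  have hc : ContinuousOn (fun t => ‖u (t + h) - u t‖ ^ 2) (Icc 0 b) := by
    refine ((ContinuousOn.sub (huc.comp (by fun_prop) fun t ht => ?_)
      (huc.mono fun t ht => ?_)).norm).pow 2
    · exact ⟨by linarith [ht.1], by linarith [ht.2, hb.2]⟩
    · exact ⟨ht.1, by linarith [ht.2, hb.2]⟩
  have hi : IntervalIntegrable (fun t => ‖u (t + h) - u t‖ ^ 2) volume 0 b := by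
    apply ContinuousOn.intervalIntegrable
    rwa [uIcc_of_le hb.1]
  refine ⟨hi, ?_⟩
  rw [intervalIntegral.integral_of_le hb.1, integral_Ioc_eq_integral_Ioo]
  have hi' : IntegrableOn (fun t => ‖u (t + h) - u t‖ ^ 2) (Ioo 0 b) :=
    ((intervalIntegrable_iff_integrableOn_Ioo_of_le hb.1).1 hi)
  rw [← ENNReal.ofReal_le_ofReal_iff (by positivity), ofReal_integral_eq_lintegral_ofReal hi'
    (ae_of_all _ fun t => by positivity)]
  calc _ = ∫⁻ t in Ioo 0 b, ‖u (t + h) - u t‖ₑ ^ 2 := by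
        refine lintegral_congr fun t => ?_
        rw [ENNReal.ofReal_pow (norm_nonneg _), ofReal_norm]
    _ ≤ ∫⁻ t in Ioo 0 (T - h), ‖u (t + h) - u t‖ₑ ^ 2 :=
        lintegral_mono_set (Ioo_subset_Ioo_right hb.2)
    _ ≤ ENNReal.ofReal h ^ 2 * ∫⁻ t in Ioo 0 T, ‖du t‖ₑ ^ 2 := lintegral_sq_sub_le hu hh
    _ ≤ ENNReal.ofReal h ^ 2 * ENNReal.ofReal R ^ 2 := by
        gcongr
        exact lintegral_sq_le_iff.2 hdu
    _ = _ := by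
        rw [← ENNReal.ofReal_pow hh.le, ← ENNReal.ofReal_pow hR, ← ENNReal.ofReal_mul (by positivity)]

/-- Estimate of the differences `y (t + h) - y t`, given an estimate of the first one. -/
theorem difference_estimate (j : V →L[ℝ] X) {C M R : ℝ} (hC : 0 ≤ C) (hR : 0 ≤ R)
    {G : ℝ → X} {y : ℝ → V} {u du : ℝ → U} {P : ℝ → Prop} {y0 : V}
    (hG : MemLp G 2 (timeMeasure T)) (hy : AEStronglyMeasurable y (timeMeasure T))
    (hu : IsH1 T u du) (hdu : eLpNorm du 2 (timeMeasure T) ≤ ENNReal.ofReal R)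
    (hP : ∀ᵐ t ∂(timeMeasure T), P t)
    (hF : ∀ t, P t → j (y t - y0) = ∫ s in (0 : ℝ)..t, G s)
    (h1 : ∀ s t, P s → P t → ⟪G t - G s, j (y t - y s)⟫ + 1 / 2 * ‖y t - y s‖ ^ 2
      ≤ C * (‖j (y t - y s)‖ ^ 2 + ‖u t - u s‖ ^ 2))
    {h : ℝ} (hh : 0 < h) (hhT : h < T)
    (h0 : ‖∫ s in (0 : ℝ)..h, G s‖ ≤ 4 * M * h) :
    (∀ t ∈ Icc 0 (T - h), ‖(∫ s in (0 : ℝ)..t + h, G s) - ∫ s in (0 : ℝ)..t, G s‖ ^ 2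
      ≤ (16 * M ^ 2 + 2 * C * R ^ 2) * Real.exp (2 * C * T) * h ^ 2) ∧
    ∫⁻ t in Ioo 0 (T - h), ‖y (t + h) - y t‖ₑ ^ 2
      ≤ ENNReal.ofReal ((16 * M ^ 2 + 2 * C * R ^ 2
        + 2 * C * T * ((16 * M ^ 2 + 2 * C * R ^ 2) * Real.exp (2 * C * T))) * h ^ 2) := by
  set D := 16 * M ^ 2 + 2 * C * R ^ 2 with hD
  have hD0 : 0 ≤ D := by positivity
  have hT : 0 < T := hh.trans hhT
  have hTh : 0 ≤ T - h := by linarith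
  set F : ℝ → X := fun t => ∫ s in (0 : ℝ)..t, G s with hFdef
  set f : ℝ → X := fun t => F (t + h) - F t with hf
  set g : ℝ → X := fun t => G (t + h) - G t with hg
  have m0 : (0 : ℝ) ∈ Icc 0 T := ⟨le_rfl, hT.le⟩
  have hGi {a b : ℝ} := intervalIntegrable_of_memLp hG (s := a) (t := b)
  have hgi : IntervalIntegrable g volume 0 (T - h) := by
    refine IntervalIntegrable.sub ?_ (hGi m0 ⟨hTh, by linarith⟩)
    have := (hGi (a := h) (b := T) ⟨hh.le, hhT.le⟩ ⟨hT.le, le_rfl⟩).comp_add_right h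
    simpa using this
  have hf0 : ‖f 0‖ ≤ 4 * M * h := by simpa [hf, hFdef] using h0
  have hfe : ∀ t ∈ Icc 0 (T - h), f t = f 0 + ∫ s in (0 : ℝ)..t, g s := fun t ht => by
    have e1 : t ∈ Icc 0 T := ⟨ht.1, by linarith [ht.2]⟩
    have e2 : t + h ∈ Icc 0 T := ⟨by linarith [ht.1], by linarith [ht.2]⟩
    have eh : h ∈ Icc 0 T := ⟨hh.le, hhT.le⟩
    have hs : IntervalIntegrable (fun s => G (s + h)) volume 0 t := by
      have := (hGi eh e2).comp_add_right h
      simpa using this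
    rw [hg, intervalIntegral.integral_sub hs (hGi m0 e1), intervalIntegral.integral_comp_add_right,
      zero_add, ← intervalIntegral.integral_interval_sub_left (hGi m0 e2) (hGi m0 eh)]
    simp only [hf, hFdef, zero_add, intervalIntegral.integral_same]
    abel
  have hfc := continuousOn_of_eq_integral hgi hfe
  have hae := ae_and_ae_add hP hh
  have hkm : AEStronglyMeasurable (fun t => ‖y (t + h) - y t‖ ^ 2)
      (volume.restrict (Ioo 0 (T - h))) := by
    refine (((aestronglyMeasurable_comp_add hy hh).sub (hy.mono_measure
      (Measure.restrict_mono (Ioo_subset_Ioo_right (by linarith)) le_rfl))).norm).pow 2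
  -- The two-time inequality for the pair `t`, `t + h`, doubled and solved for the squared increment
  -- of `y`.
  have hpt : ∀ᵐ t, t ∈ Ioo 0 (T - h) → ‖y (t + h) - y t‖ ^ 2
      ≤ 2 * C * ‖f t‖ ^ 2 + 2 * C * ‖u (t + h) - u t‖ ^ 2 - 2 * ⟪g t, f t⟫ := by
    filter_upwards [hae] with t ht htm
    obtain ⟨p1, p2⟩ := ht htm
    have e : j (y (t + h) - y t) = f t := by
      have : y (t + h) - y t = (y (t + h) - y0) - (y t - y0) := by abel
      rw [this, map_sub, hF _ p2, hF _ p1]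
    have := h1 t (t + h) p1 p2
    rw [e] at this
    simp only [hg]
    linarith
  have hint : ∀ b ∈ Icc 0 (T - h), IntervalIntegrable (fun t => ‖y (t + h) - y t‖ ^ 2) volume 0 b ∧
      ‖f b‖ ^ 2 + ∫ t in (0 : ℝ)..b, ‖y (t + h) - y t‖ ^ 2
        ≤ D * h ^ 2 + 2 * C * ∫ t in (0 : ℝ)..b, ‖f t‖ ^ 2 := fun b hb => by
    have hsub : Icc 0 b ⊆ Icc 0 (T - h) := Icc_subset_Icc_right hb.2
    have hgi' : IntervalIntegrable g volume 0 b := hgi.mono_set (by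
      rw [uIcc_of_le hTh, uIcc_of_le hb.1]; exact hsub)
    have i1 : IntervalIntegrable (fun t => ‖f t‖ ^ 2) volume 0 b := by
      apply ContinuousOn.intervalIntegrable
      rw [uIcc_of_le hb.1]
      exact ((hfc.mono hsub).norm).pow 2
    obtain ⟨i2, i2'⟩ := integral_norm_sq_sub_le hu hR hdu hh hb
    have i3 := intervalIntegrable_inner hb.1 hgi' (hfc.mono hsub)
    have i4 := ((i1.const_mul (2 * C)).add (i2.const_mul (2 * C))).sub (i3.const_mul 2)
    have hle : ∀ᵐ t ∂(volume.restrict (Ioo 0 b)), ‖y (t + h) - y t‖ ^ 2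
      ≤ 2 * C * ‖f t‖ ^ 2 + 2 * C * ‖u (t + h) - u t‖ ^ 2 - 2 * ⟪g t, f t⟫ := by
      rw [ae_restrict_iff' measurableSet_Ioo]
      filter_upwards [hpt] with t ht htm
      exact ht ⟨htm.1, htm.2.trans_le hb.2⟩
    -- `y` is only assumed measurable, so integrability of the squared increment is itself a
    -- consequence of the pointwise bound.
    have i5 : IntervalIntegrable (fun t => ‖y (t + h) - y t‖ ^ 2) volume 0 b := by
      rw [intervalIntegrable_iff_integrableOn_Ioo_of_le hb.1] at i4 ⊢
      refine Integrable.mono' i4 (hkm.mono_measure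
        (Measure.restrict_mono (Ioo_subset_Ioo_right hb.2) le_rfl)) ?_
      filter_upwards [hle] with t ht
      rw [Real.norm_of_nonneg (by positivity)]
      exact ht
    refine ⟨i5, ?_⟩
    have hm : ∫ t in (0 : ℝ)..b, ‖y (t + h) - y t‖ ^ 2
        ≤ ∫ t in (0 : ℝ)..b, (2 * C * ‖f t‖ ^ 2 + 2 * C * ‖u (t + h) - u t‖ ^ 2
          - 2 * ⟪g t, f t⟫) := by
      rw [intervalIntegral.integral_of_le hb.1, intervalIntegral.integral_of_le hb.1,
        integral_Ioc_eq_integral_Ioo, integral_Ioc_eq_integral_Ioo]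
      exact integral_mono_ae ((intervalIntegrable_iff_integrableOn_Ioo_of_le hb.1).1 i5)
        ((intervalIntegrable_iff_integrableOn_Ioo_of_le hb.1).1 i4) hle
    rw [intervalIntegral.integral_sub ((i1.const_mul _).add (i2.const_mul _)) (i3.const_mul 2),
      intervalIntegral.integral_add (i1.const_mul _) (i2.const_mul _),
      intervalIntegral.integral_const_mul, intervalIntegral.integral_const_mul,
      intervalIntegral.integral_const_mul] at hm
    -- The chain rule turns `-2∫⟪g, f⟫` into `‖f 0‖² - ‖f b‖²`. In `D`, the summand `16M²` comes
    -- from `‖f 0‖ ≤ 4Mh` and `2CR²` from the increments of `u`.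
    have hsq := norm_sq_eq_add_integral_inner hb.1 hgi' fun t ht => hfe t (hsub ht)
    have h5 : ‖f 0‖ ^ 2 ≤ 16 * M ^ 2 * h ^ 2 := by
      calc ‖f 0‖ ^ 2 ≤ (4 * M * h) ^ 2 := by gcongr
        _ = _ := by ring
    have h6 : 2 * C * ∫ t in (0 : ℝ)..b, ‖u (t + h) - u t‖ ^ 2 ≤ 2 * C * (h ^ 2 * R ^ 2) := by
      gcongr
    rw [hD]
    linarith
  have hk0 : ∀ b ∈ Icc 0 (T - h), 0 ≤ ∫ t in (0 : ℝ)..b, ‖y (t + h) - y t‖ ^ 2 := fun b hb =>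
    intervalIntegral.integral_nonneg hb.1 fun t _ => by positivity
  -- Grönwall is run for `‖f‖²` alone, dropping the nonnegative integral of the increments of `y`;
  -- that integral is recovered afterwards at `b = T - h`.
  have hgr := le_mul_exp_of_le_add_integral (q := fun t => ‖f t‖ ^ 2) (a := D * h ^ 2)
    (b := T - h) (C := 2 * C) (by positivity) (hfc.norm.pow 2) fun t ht => by
      have := (hint t ht).2
      have := hk0 t ht
      linarith
  have hfin : ∀ t ∈ Icc 0 (T - h), ‖f t‖ ^ 2 ≤ D * Real.exp (2 * C * T) * h ^ 2 := fun t ht => by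
    refine (hgr t ht).trans ?_
    have : Real.exp (2 * C * t) ≤ Real.exp (2 * C * T) := by
      have : t ≤ T := by linarith [ht.2]
      gcongr
    calc D * h ^ 2 * Real.exp (2 * C * t) ≤ D * h ^ 2 * Real.exp (2 * C * T) := by gcongr
      _ = _ := by ring
  refine ⟨hfin, ?_⟩
  have mT : T - h ∈ Icc 0 (T - h) := ⟨hTh, le_rfl⟩
  obtain ⟨i5, i6⟩ := hint _ mT
  have hfi : ∫ t in (0 : ℝ)..(T - h), ‖f t‖ ^ 2
      ≤ T * (D * Real.exp (2 * C * T) * h ^ 2) := by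
    have : ∫ t in (0 : ℝ)..(T - h), ‖f t‖ ^ 2
        ≤ ∫ t in (0 : ℝ)..(T - h), D * Real.exp (2 * C * T) * h ^ 2 := by
      refine intervalIntegral.integral_mono_on hTh ?_ (by simp) hfin
      apply ContinuousOn.intervalIntegrable
      rw [uIcc_of_le hTh]
      exact hfc.norm.pow 2
    refine this.trans ?_
    rw [intervalIntegral.integral_const, smul_eq_mul, sub_zero]
    gcongr
    linarith
  calc ∫⁻ t in Ioo 0 (T - h), ‖y (t + h) - y t‖ₑ ^ 2
      = ∫⁻ t in Ioo 0 (T - h), ENNReal.ofReal (‖y (t + h) - y t‖ ^ 2) := by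
        refine lintegral_congr fun t => ?_
        rw [ENNReal.ofReal_pow (norm_nonneg _), ofReal_norm]
    _ = ENNReal.ofReal (∫ t in Ioo 0 (T - h), ‖y (t + h) - y t‖ ^ 2) := by
        rw [ofReal_integral_eq_lintegral_ofReal
          ((intervalIntegrable_iff_integrableOn_Ioo_of_le hTh).1 i5)
          (ae_of_all _ fun t => by positivity)]
    _ ≤ _ := by
        apply ENNReal.ofReal_le_ofReal
        rw [intervalIntegral.integral_of_le hTh, integral_Ioc_eq_integral_Ioo] at i6
        have : 2 * C * ∫ t in (0 : ℝ)..(T - h), ‖f t‖ ^ 2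
            ≤ 2 * C * (T * (D * Real.exp (2 * C * T) * h ^ 2)) := by gcongr
        nlinarith [sq_nonneg ‖f (T - h)‖]

end Abstract

/-! ### Weak limits of difference quotients and the time derivative -/

section Abstract

/-- Lusin–Souslin: a continuous injection of a complete separable space is a measurable embedding,
so measurability of `j ∘ z` descends to `z`. -/
theorem aestronglyMeasurable_of_comp {X V : Type*} [NormedAddCommGroup X] [NormedSpace ℝ X]
    [NormedAddCommGroup V] [NormedSpace ℝ V] [CompleteSpace V] [SecondCountableTopology V]
    (j : V →L[ℝ] X) (hj : Function.Injective j) {m : Measure ℝ} {z : ℝ → V} {G : ℝ → X} (hG : AEStronglyMeasurable G m)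
    (h : ∀ᵐ t ∂m, j (z t) = G t) : AEStronglyMeasurable z m := by
  borelize V
  borelize X
  have hemb := j.continuous.measurableEmbedding hj
  have h1 : AEMeasurable (j ∘ z) m := hG.aemeasurable.congr (h.mono fun t ht => ht.symm)
  exact (hemb.aemeasurable_comp_iff.1 h1).aestronglyMeasurable

variable {X V U : Type*} [NormedAddCommGroup X] [InnerProductSpace ℝ X] [CompleteSpace X]
  [NormedAddCommGroup V] [InnerProductSpace ℝ V] [CompleteSpace V]
  [NormedAddCommGroup U] [NormedSpace ℝ U] {T : ℝ}

/-- Weak compactness of balls of a Hilbert space. -/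
theorem exists_norm_le_of_frequently (j : V →L[ℝ] X) {x : ℕ → V} {p : X} {c : ℝ}
    (hx : ∃ᶠ n in atTop, ‖x n‖ ≤ c) (hp : Tendsto (fun n => j (x n)) atTop (𝓝 p)) :
    ∃ v, j v = p ∧ ‖v‖ ≤ c := by
  set l : Filter ℕ := atTop ⊓ 𝓟 {n | ‖x n‖ ≤ c} with hl
  have hne : l.NeBot := by
    rw [hl, ← frequently_mem_iff_neBot]; exact hx
  -- An ultrafilter concentrated on the indices where the bound holds replaces the choice of a
  -- weakly convergent subsequence.
  let Ul := Ultrafilter.of l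
  have hUl : (Ul : Filter ℕ) ≤ l := Ultrafilter.of_le l
  let a : ℕ → WeakDual ℝ V := fun n => StrongDual.toWeakDual (InnerProductSpace.toDual ℝ V (x n))
  have hK := WeakDual.isCompact_closedBall (𝕜 := ℝ) (E := V) 0 c
  have hmem : (Ul.map a : Filter (WeakDual ℝ V))
      ≤ 𝓟 (WeakDual.toStrongDual ⁻¹' Metric.closedBall 0 c) := by
    rw [le_principal_iff]
    have : {n | ‖x n‖ ≤ c} ∈ (Ul : Filter ℕ) := hUl (mem_inf_of_right (mem_principal_self _))
    refine Ultrafilter.mem_map.2 (mem_of_superset this fun n hn => ?_)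
    simpa [a] using hn
  obtain ⟨φ, hφ, hlim⟩ := hK.ultrafilter_le_nhds _ hmem
  have hlim' : Tendsto a Ul (𝓝 φ) := hlim
  refine ⟨(InnerProductSpace.toDual ℝ V).symm (WeakDual.toStrongDual φ), ?_, ?_⟩
  -- Testing against `ξ` in `X` amounts to testing against the adjoint image of `ξ` in `V`; hence
  -- the weak limit in `V` and the given limit in `X` agree.
  · refine ext_inner_right ℝ fun ξ => ?_
    have h1 : Tendsto (fun n => a n (ContinuousLinearMap.adjoint j ξ)) Ul
        (𝓝 (φ (ContinuousLinearMap.adjoint j ξ))) :=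
      ((WeakDual.eval_continuous _).tendsto φ).comp hlim'
    have h2 : Tendsto (fun n => ⟪j (x n), ξ⟫) Ul (𝓝 ⟪p, ξ⟫) :=
      ((hp.inner tendsto_const_nhds).mono_left (hUl.trans inf_le_left))
    have h3 : (fun n => a n (ContinuousLinearMap.adjoint j ξ)) = fun n => ⟪j (x n), ξ⟫ := by
      ext n
      change ⟪x n, ContinuousLinearMap.adjoint j ξ⟫ = _
      rw [ContinuousLinearMap.adjoint_inner_right]
    rw [h3] at h1
    rw [← tendsto_nhds_unique h1 h2, ← ContinuousLinearMap.adjoint_inner_right,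
      InnerProductSpace.toDual_symm_apply]
    rfl
  · rw [LinearIsometryEquiv.norm_map]
    simpa using hφ

/-- Every level above the lower limit is attained infinitely often as a bound, hence yields a
preimage of `p` below that level. Injectivity makes all these preimages the same, so the level may
decrease to the lower limit. -/
theorem exists_enorm_le_liminf (j : V →L[ℝ] X) (hj : Function.Injective j) {x : ℕ → V} {p : X}
    (hx : liminf (fun n => ‖x n‖ₑ) atTop < ∞)
    (hp : Tendsto (fun n => j (x n)) atTop (𝓝 p)) :
    ∃ v, j v = p ∧ ‖v‖ₑ ≤ liminf (fun n => ‖x n‖ₑ) atTop := by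
  have key : ∀ c : ℝ≥0, liminf (fun n => ‖x n‖ₑ) atTop < c → ∃ v, j v = p ∧ ‖v‖ₑ ≤ c := by
    intro c hc
    have hf : ∃ᶠ n in atTop, ‖x n‖ ≤ c := by
      refine (frequently_lt_of_liminf_lt (by isBoundedDefault) hc).mono fun n hn => ?_
      have : ‖x n‖₊ < c := by exact_mod_cast hn
      exact_mod_cast this.le
    obtain ⟨v, hv, hv'⟩ := exists_norm_le_of_frequently j hf hp
    refine ⟨v, hv, ?_⟩
    have : ‖v‖₊ ≤ c := by exact_mod_cast hv'
    exact_mod_cast this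
  obtain ⟨c, hc, -⟩ := ENNReal.lt_iff_exists_nnreal_btwn.1 hx
  obtain ⟨v, hv, -⟩ := key c hc
  refine ⟨v, hv, ENNReal.le_of_forall_pos_le_add fun ε hε hfin => ?_⟩
  lift liminf (fun n => ‖x n‖ₑ) atTop to ℝ≥0 using hfin.ne with L hL
  obtain ⟨w, hw, hw'⟩ := key (L + ε) (by exact_mod_cast lt_add_of_pos_right L hε)
  rw [hj (hv.trans hw.symm)]
  exact_mod_cast hw'

variable [SecondCountableTopology V]

/-- Regularity of the time derivative by difference quotients. -/
theorem exists_derivative_of_difference_inequality (j : V →L[ℝ] X) (hj : Function.Injective j)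
    (hT : 0 < T) {C M R : ℝ} (hC : 0 ≤ C) (hM : 0 ≤ M) (hR : 0 ≤ R) :
    ∃ K : ℝ, 0 ≤ K ∧ ∀ (G : ℝ → X) (y : ℝ → V) (u du : ℝ → U) (P : ℝ → Prop) (y0 : V) (ε : ℝ),
      0 < ε → MemLp G 2 (timeMeasure T) → AEStronglyMeasurable y (timeMeasure T) →
      IsH1 T u du → eLpNorm du 2 (timeMeasure T) ≤ ENNReal.ofReal R →
      (∀ᵐ t ∂(timeMeasure T), P t) →
      (∀ t, P t → j (y t - y0) = ∫ s in (0 : ℝ)..t, G s) →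
      (∀ s t, P s → P t → ⟪G t - G s, j (y t - y s)⟫ + 1 / 2 * ‖y t - y s‖ ^ 2
        ≤ C * (‖j (y t - y s)‖ ^ 2 + ‖u t - u s‖ ^ 2)) →
      (∀ t, P t → t < ε → ⟪G t, j (y t - y0)⟫
        ≤ C * ‖j (y t - y0)‖ ^ 2 + M * ‖j (y t - y0)‖) →
      ∃ z : ℝ → V, MemLp z 2 (timeMeasure T) ∧ eLpNorm z 2 (timeMeasure T) ≤ ENNReal.ofReal K ∧
        ∀ᵐ t ∂(timeMeasure T), j (z t) = G t ∧ ‖G t‖ ≤ K := by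
  set D := 16 * M ^ 2 + 2 * C * R ^ 2 with hD
  have hD0 : 0 ≤ D := by positivity
  set K1 := D * Real.exp (2 * C * T) with hK1
  have hK10 : 0 ≤ K1 := by positivity
  set K2 := D + 2 * C * T * K1 with hK2
  have hK20 : 0 ≤ K2 := by positivity
  refine ⟨√K1 + √K2, by positivity, ?_⟩
  intro G y u du P y0 ε hε hG hy hu hdu hP hF h1 h2
  set F : ℝ → X := fun t => ∫ s in (0 : ℝ)..t, G s with hFdef
  -- The three entries keep the steps inside the range of the initial inequality, inside `(0, T)`,
  -- and small enough for the absorption condition `4Ch ≤ 1`.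
  set h₀ : ℝ := min (ε / 2) (min (T / 2) (1 / (4 * C + 1))) with hh₀
  have hh₀0 : 0 < h₀ := by positivity
  set h : ℕ → ℝ := fun n => h₀ / (n + 1) with hh
  have hpos : ∀ n, 0 < h n := fun n => by positivity
  have hle : ∀ n, h n ≤ h₀ := fun n => div_le_self hh₀0.le (by
    have : (0 : ℝ) ≤ n := n.cast_nonneg
    linarith)
  have hε' : ∀ n, h n < ε := fun n => (hle n).trans_lt
    ((min_le_left _ _).trans_lt (by linarith))
  have hT' : ∀ n, h n < T := fun n => (hle n).trans_lt
    ((min_le_right _ _).trans_lt ((min_le_left _ _).trans_lt (by linarith)))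
  have hC' : ∀ n, 4 * C * h n ≤ 1 := fun n => by
    have e : h n ≤ 1 / (4 * C + 1) := (hle n).trans ((min_le_right _ _).trans (min_le_right _ _))
    have e2 : 0 < 4 * C + 1 := by positivity
    rw [le_div_iff₀ e2] at e
    nlinarith [hpos n]
  have hlim : Tendsto h atTop (𝓝 0) := by
    have := tendsto_one_div_add_atTop_nhds_zero_nat (𝕜 := ℝ)
    have := this.const_mul h₀
    simpa [hh, div_eq_mul_inv] using this
  have hP' := hP
  rw [ae_restrict_iff' measurableSet_Ioo] at hP'
  have hinit : ∀ n, ‖F (h n)‖ ≤ 4 * M * h n := fun n => by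
    refine norm_le_of_inner_le (f := F) (hpos n).le hC hM (hC' n) (intervalIntegrable_of_memLp hG
      ⟨le_rfl, hT.le⟩ ⟨(hpos n).le, (hT' n).le⟩) (fun t _ => rfl) ?_
    filter_upwards [hP'] with t ht htm
    have hp := ht ⟨htm.1, htm.2.trans_lt (hT' n)⟩
    have := h2 t hp (htm.2.trans_lt (hε' n))
    rwa [hF t hp] at this
  have hest := fun n => difference_estimate j hC hR hG hy hu hdu hP hF h1 (hpos n) (hT' n) (hinit n)
  rw [← hD, ← hK1, ← hK2] at hest
  set ζ : ℕ → ℝ → V := fun n t => (h n)⁻¹ • (y (t + h n) - y t) with hζ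
  have hderiv : ∀ᵐ t ∂(timeMeasure T), Tendsto (fun n => (h n)⁻¹ • (F (t + h n) - F t)) atTop
      (𝓝 (G t)) := by
    rw [ae_restrict_iff' measurableSet_Ioo]
    have hGi := intervalIntegrable_of_memLp hG (s := 0) (t := T) ⟨le_rfl, hT.le⟩ ⟨hT.le, le_rfl⟩
    filter_upwards [hGi.ae_hasDerivAt_integral] with t ht htm
    have hd := ht (by rw [uIcc_of_le hT.le]; exact Ioo_subset_Icc_self htm) 0 left_mem_uIcc
    refine hd.tendsto_slope_zero.comp ?_
    rw [tendsto_nhdsWithin_iff]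
    exact ⟨hlim, Eventually.of_forall fun n => (hpos n).ne'⟩
  have hevT : ∀ t ∈ Ioo 0 T, ∀ᶠ n in atTop, t + h n < T := fun t ht => by
    have := hlim.const_add t
    rw [add_zero] at this
    exact this.eventually_lt_const ht.2
  have hbound : ∀ᵐ t ∂(timeMeasure T), ‖G t‖ ≤ √K1 := by
    filter_upwards [hderiv, ae_restrict_mem measurableSet_Ioo] with t ht htm
    refine le_of_tendsto ht.norm ?_
    filter_upwards [hevT t htm] with n hn
    have := (hest n).1 t ⟨htm.1.le, by linarith⟩
    rw [norm_smul, norm_inv, Real.norm_of_nonneg (hpos n).le, inv_mul_le_iff₀ (hpos n)]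
    refine le_of_sq_le_sq ?_ (by have := hpos n; positivity)
    rw [mul_pow, Real.sq_sqrt hK10]
    linarith
  have hconv : ∀ᵐ t ∂(timeMeasure T), Tendsto (fun n => j (ζ n t)) atTop (𝓝 (G t)) := by
    have hall : ∀ᵐ t, ∀ n, t ∈ Ioo 0 (T - h n) → P t ∧ P (t + h n) :=
      ae_all_iff.2 fun n => ae_and_ae_add hP (hpos n)
    filter_upwards [hderiv, ae_restrict_mem measurableSet_Ioo, ae_restrict_of_ae hall]
      with t ht htm hpt
    refine ht.congr' ?_
    filter_upwards [hevT t htm] with n hn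
    obtain ⟨p1, p2⟩ := hpt n ⟨htm.1, by linarith⟩
    have : y (t + h n) - y t = (y (t + h n) - y0) - (y t - y0) := by abel
    simp only [hζ]
    rw [map_smul, this, map_sub, hF _ p2, hF _ p1]
  -- The quotients are controlled only up to time `T - h n`. Extension by zero puts Fatou's lemma on
  -- the fixed interval, and for each `t < T` the cutoff is eventually inactive.
  set ξ : ℕ → ℝ → ℝ≥0∞ := fun n => (Ioo 0 (T - h n)).indicator fun t => ‖ζ n t‖ₑ ^ 2 with hξ
  have hξm : ∀ n, AEMeasurable (ξ n) := fun n => by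
    refine (aemeasurable_indicator_iff measurableSet_Ioo).2 ?_
    refine AEMeasurable.pow_const ?_ 2
    refine AEStronglyMeasurable.enorm ?_
    exact AEStronglyMeasurable.const_smul ((aestronglyMeasurable_comp_add hy (hpos n)).sub
      (hy.mono_measure (Measure.restrict_mono
        (Ioo_subset_Ioo_right (by linarith [hpos n])) le_rfl))) _
  have hξi : ∀ n, ∫⁻ t, ξ n t ∂(timeMeasure T) ≤ ENNReal.ofReal K2 := fun n => by
    calc ∫⁻ t, ξ n t ∂(timeMeasure T) ≤ ∫⁻ t, ξ n t := setLIntegral_le_lintegral _ _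
      _ = ∫⁻ t in Ioo 0 (T - h n), ‖ζ n t‖ₑ ^ 2 := lintegral_indicator measurableSet_Ioo _
      _ = ∫⁻ t in Ioo 0 (T - h n), ENNReal.ofReal ((h n)⁻¹ ^ 2) * ‖y (t + h n) - y t‖ₑ ^ 2 := by
          refine lintegral_congr fun t => ?_
          rw [hζ, enorm_smul, mul_pow, Real.enorm_of_nonneg (inv_nonneg.2 (hpos n).le),
            ENNReal.ofReal_pow (inv_nonneg.2 (hpos n).le)]
      _ = ENNReal.ofReal ((h n)⁻¹ ^ 2) * ∫⁻ t in Ioo 0 (T - h n), ‖y (t + h n) - y t‖ₑ ^ 2 :=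
          lintegral_const_mul' _ _ ENNReal.ofReal_ne_top
      _ ≤ ENNReal.ofReal ((h n)⁻¹ ^ 2) * ENNReal.ofReal (K2 * h n ^ 2) := by
          gcongr
          exact (hest n).2
      _ = ENNReal.ofReal K2 := by
          rw [← ENNReal.ofReal_mul (by positivity)]
          congr 1
          have := (hpos n).ne'
          field_simp
  have hfatou : ∫⁻ t, liminf (fun n => ξ n t) atTop ∂(timeMeasure T) ≤ ENNReal.ofReal K2 := by
    refine (lintegral_liminf_le' fun n => (hξm n).restrict).trans ?_
    exact (liminf_le_liminf (Eventually.of_forall hξi)).trans (by simp)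
  have hfin : ∀ᵐ t ∂(timeMeasure T), liminf (fun n => ξ n t) atTop < ∞ := by
    refine ae_lt_top' ?_ (hfatou.trans_lt ENNReal.ofReal_lt_top).ne
    refine ⟨fun t => liminf (fun n => (hξm n).mk _ t) atTop,
      Measurable.liminf fun n => (hξm n).measurable_mk, ae_restrict_of_ae ?_⟩
    filter_upwards [ae_all_iff.2 fun n => (hξm n).ae_eq_mk] with t ht
    simp only [ht]
  have hex : ∀ᵐ t ∂(timeMeasure T), ∃ v, j v = G t ∧
      ‖v‖ₑ ^ 2 ≤ liminf (fun n => ξ n t) atTop := by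
    filter_upwards [hfin, hconv, ae_restrict_mem measurableSet_Ioo] with t ht hc htm
    have e : liminf (fun n => ξ n t) atTop = (liminf (fun n => ‖ζ n t‖ₑ) atTop) ^ 2 := by
      have e1 : liminf (fun n => ξ n t) atTop = liminf (fun n => ‖ζ n t‖ₑ ^ 2) atTop := by
        refine liminf_congr ?_
        filter_upwards [hevT t htm] with n hn
        simp only [hξ]
        rw [indicator_of_mem]
        exact ⟨htm.1, by linarith⟩
      rw [e1]
      have hmono : Monotone fun a : ℝ≥0∞ => a ^ 2 := fun a b hab => by
        simp only
        gcongr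
      exact (hmono.map_liminf_of_continuousAt (F := atTop) (fun n => ‖ζ n t‖ₑ)
        (ENNReal.continuous_pow 2).continuousAt).symm
    rw [e] at ht ⊢
    obtain ⟨v, hv, hv'⟩ := exists_enorm_le_liminf j hj (by
      by_contra hcon
      rw [not_lt_top_iff] at hcon
      rw [hcon] at ht
      simp at ht) hc
    exact ⟨v, hv, by gcongr⟩
  -- The values are chosen time by time, without regard to measurability, which is then inherited
  -- from `G` through the injection `j`.
  obtain ⟨z, hzs⟩ := Filter.skolem.1 hex
  have hzm := aestronglyMeasurable_of_comp j hj hG.1 (hzs.mono fun t ht => ht.1)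
  have hzn : eLpNorm z 2 (timeMeasure T) ≤ ENNReal.ofReal √K2 := by
    rw [← lintegral_sq_le_iff, ← ENNReal.ofReal_pow (Real.sqrt_nonneg _), Real.sq_sqrt hK20]
    exact (lintegral_mono_ae (hzs.mono fun t ht => ht.2)).trans hfatou
  refine ⟨z, ⟨hzm, hzn.trans_lt ENNReal.ofReal_lt_top⟩, hzn.trans (ENNReal.ofReal_le_ofReal
    (by linarith [Real.sqrt_nonneg K1])), ?_⟩
  filter_upwards [hzs, hbound] with t h3 h4
  exact ⟨h3.1, h4.trans (by linarith [Real.sqrt_nonneg K2])⟩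

end Abstract

end FracCH

noncomputable section

namespace FracCH

/-! ### Fourier coefficients, graph spaces and Ehrling's inequality -/

section Spectral

variable {H : Type*} [NormedAddCommGroup H] [InnerProductSpace ℝ H] [CompleteSpace H]

namespace EigenSystem

variable {A : H →ₗ.[ℝ] H} (S : EigenSystem A)

/-- The eigenvectors as a Hilbert basis. -/
def basis : HilbertBasis ℕ ℝ H := HilbertBasis.mk S.orthonormal S.complete.ge

theorem basis_repr_apply (v : H) (j : ℕ) : S.basis.repr v j = ⟪S.vec j, v⟫ := by
  rw [HilbertBasis.repr_apply_apply, basis, HilbertBasis.coe_mk]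

theorem hasSum_inner (v w : H) :
    HasSum (fun j => ⟪S.vec j, v⟫ * ⟪S.vec j, w⟫) ⟪v, w⟫ := by
  have h := S.basis.hasSum_inner_mul_inner v w
  simp only [basis, HilbertBasis.coe_mk] at h
  simpa only [real_inner_comm v] using h

theorem hasSum_sq (v : H) : HasSum (fun j => ⟪S.vec j, v⟫ ^ 2) (‖v‖ ^ 2) := by
  simpa only [← sq, real_inner_self_eq_norm_sq] using S.hasSum_inner v v

theorem inner_vec_pow {s : ℝ} (v : S.domPow s) (j : ℕ) :
    ⟪S.vec j, S.pow s v⟫ = S.lam j ^ s * ⟪S.vec j, (v : H)⟫ := by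
  have h := (S.summable_pow v.2).hasSum.mapL (innerSL ℝ (S.vec j))
  have h2 : HasSum (fun i => innerSL ℝ (S.vec j) ((S.lam i ^ s * ⟪S.vec i, (v : H)⟫) • S.vec i))
      (S.lam j ^ s * ⟪S.vec j, (v : H)⟫) := by
    have h3 : ∀ i, innerSL ℝ (S.vec j) ((S.lam i ^ s * ⟪S.vec i, (v : H)⟫) • S.vec i)
        = if i = j then S.lam j ^ s * ⟪S.vec j, (v : H)⟫ else 0 := fun i => by
      rw [innerSL_apply_apply, real_inner_smul_right, orthonormal_iff_ite.1 S.orthonormal j i]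
      rcases eq_or_ne i j with rfl | hij
      · simp
      · simp [hij, hij.symm]
    simp only [h3]
    exact hasSum_ite_eq j _
  exact h.unique h2

theorem mem_domPow_of_inner_eq {s : ℝ} {v w : H}
    (h : ∀ j, ⟪S.vec j, w⟫ = S.lam j ^ s * ⟪S.vec j, v⟫) : v ∈ S.domPow s := by
  change Summable _
  simpa only [h] using (S.hasSum_sq w).summable

theorem eq_of_inner_vec {v w : H} (h : ∀ j, ⟪S.vec j, v⟫ = ⟪S.vec j, w⟫) : v = w := by
  refine S.basis.repr.injective (lp.ext (funext fun j => ?_))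
  rw [basis_repr_apply, basis_repr_apply, h]

theorem rpow_two_mul (s : ℝ) (j : ℕ) : S.lam j ^ (2 * s) = S.lam j ^ s * S.lam j ^ s := by
  rw [two_mul]
  rcases eq_or_ne s 0 with rfl | hs
  · simp
  rcases (S.lam_nonneg j).eq_or_lt with h | h
  · rw [← h, Real.zero_rpow hs, Real.zero_rpow (by simpa using hs), zero_mul]
  · exact Real.rpow_add h s s

theorem domPow_two_mul_le (s : ℝ) : S.domPow (2 * s) ≤ S.domPow s := fun v hv => by
  refine Summable.of_nonneg_of_le (fun j => sq_nonneg _) (fun j => ?_)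
    ((S.hasSum_sq v).summable.add hv)
  rw [rpow_two_mul]
  set a := S.lam j ^ s
  set b := ⟪S.vec j, v⟫
  have h1 : a ^ 2 ≤ 1 + (a * a) ^ 2 := by nlinarith [sq_nonneg (a ^ 2 - 1), sq_nonneg a]
  nlinarith [mul_le_mul_of_nonneg_right h1 (sq_nonneg b)]

/-! #### The graph space -/

namespace GraphSpace

variable {S} {s : ℝ}

theorem inner_vec_op (v : S.GraphSpace s) (j : ℕ) :
    ⟪S.vec j, op v⟫ = S.lam j ^ s * ⟪S.vec j, toH v⟫ := S.inner_vec_pow v j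

theorem toH_mk {v : H} (hv : v ∈ S.domPow s) : toH (⟨v, hv⟩ : S.GraphSpace s) = v := rfl

theorem toH_injective : Function.Injective (toH : S.GraphSpace s → H) := Subtype.val_injective

instance : InnerProductSpace ℝ (S.GraphSpace s) where
  inner v w := ⟪S.graphMap s v, S.graphMap s w⟫
  norm_sq_eq_re_inner v := (real_inner_self_eq_norm_sq (S.graphMap s v)).symm
  conj_inner_symm v w := real_inner_comm (S.graphMap s v) (S.graphMap s w)
  add_left v w z := by
    refine (congrArg (fun p => ⟪p, S.graphMap s z⟫)
      ((S.graphMap s).map_add (v : S.domPow s) (w : S.domPow s))).trans ?_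
    exact inner_add_left _ _ _
  smul_left v w c := by
    refine (congrArg (fun p => ⟪p, S.graphMap s w⟫)
      ((S.graphMap s).map_smul c (v : S.domPow s))).trans ?_
    exact inner_smul_left _ _ _

/-- The graph map as a linear isometry. -/
def graphIsometry : S.GraphSpace s →ₗᵢ[ℝ] WithLp 2 (H × H) where
  toLinearMap := S.graphMap s
  norm_map' _ := rfl

/-- Countably many closed conditions on the Fourier coefficients describe the graph, so it is closed
in `H × H`, and the graph space is complete. -/
theorem range_graphIsometry :
    range (graphIsometry : S.GraphSpace s →ₗᵢ[ℝ] WithLp 2 (H × H)) =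
      ⋂ j, {p | ⟪S.vec j, p.snd⟫ = S.lam j ^ s * ⟪S.vec j, p.fst⟫} := by
  ext p
  simp only [mem_range, mem_iInter, mem_ofPred_eq]
  constructor
  · rintro ⟨v, rfl⟩ j
    exact inner_vec_op v j
  · intro h
    let v : S.GraphSpace s := ⟨p.fst, S.mem_domPow_of_inner_eq h⟩
    refine ⟨v, ?_⟩
    have h1 : op v = p.snd := S.eq_of_inner_vec fun j => by rw [inner_vec_op, h]; rfl
    apply (WithLp.equiv 2 (H × H)).injective
    exact Prod.ext rfl h1

instance : CompleteSpace (S.GraphSpace s) := by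
  rw [completeSpace_iff_isComplete_range
    (graphIsometry (S := S) (s := s)).isometry.isUniformInducing, range_graphIsometry]
  refine IsClosed.isComplete (isClosed_iInter fun j => isClosed_eq ?_ ?_)
  · exact continuous_const.inner (WithLp.continuous_snd 2 H H)
  · exact continuous_const.mul (continuous_const.inner (WithLp.continuous_fst 2 H H))

instance [SecondCountableTopology H] : SecondCountableTopology (S.GraphSpace s) :=
  have : SecondCountableTopology (WithLp 2 (H × H)) :=
    (WithLp.homeomorphProd 2 H H).secondCountableTopology
  (graphIsometry (S := S) (s := s)).isometry.isEmbedding.isInducing.secondCountableTopology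

theorem norm_toH_le (v : S.GraphSpace s) : ‖toH v‖ ≤ ‖v‖ :=
  le_of_sq_le_sq (by rw [norm_sq]; nlinarith [sq_nonneg ‖op v‖]) (norm_nonneg _)

theorem norm_op_le (v : S.GraphSpace s) : ‖op v‖ ≤ ‖v‖ :=
  le_of_sq_le_sq (by rw [norm_sq]; nlinarith [sq_nonneg ‖toH v‖]) (norm_nonneg _)

/-- The continuous inclusion of `D(A^s)` into `H`. -/
def toHL : S.GraphSpace s →L[ℝ] H :=
  LinearMap.mkContinuous toH 1 fun v => by rw [one_mul]; exact norm_toH_le v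

theorem toHL_apply (v : S.GraphSpace s) : toHL v = toH v := rfl

/-- The inclusion of `D(A^(2s))` into `D(A^s)`. -/
def ofTwoMul (v : S.GraphSpace (2 * s)) : S.GraphSpace s := ⟨toH v, S.domPow_two_mul_le s v.2⟩

theorem toH_ofTwoMul (v : S.GraphSpace (2 * s)) : toH (ofTwoMul v) = toH v :=
  toH_mk _

/-- Comparison of coefficients, using `λ^(2s) = λ^s λ^s`. This is how the smoothness of the initial
datum is exploited: one factor moves from the test function onto the datum. -/
theorem inner_op_ofTwoMul (v : S.GraphSpace (2 * s)) (w : S.GraphSpace s) :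
    ⟪op (ofTwoMul v), op w⟫ = ⟪op v, toH w⟫ := by
  refine (S.hasSum_inner _ _).unique ?_
  convert! S.hasSum_inner (op v) (toH w) using 2 with j
  rw [inner_vec_op, inner_vec_op, inner_vec_op, toH_ofTwoMul, rpow_two_mul]
  ring

theorem norm_ofTwoMul_le (v : S.GraphSpace (2 * s)) : ‖ofTwoMul v‖ ≤ 2 * ‖v‖ := by
  refine le_of_sq_le_sq ?_ (by positivity)
  rw [norm_sq, ← real_inner_self_eq_norm_sq (op _), inner_op_ofTwoMul, toH_ofTwoMul]
  have h1 := real_inner_le_norm (op v) (toH v)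
  have h2 := norm_toH_le v
  have h3 := norm_op_le v
  nlinarith [norm_nonneg (op v), norm_nonneg (toH v), norm_nonneg v,
    mul_le_mul h3 h2 (norm_nonneg _) (norm_nonneg _), mul_le_mul h2 h2 (norm_nonneg _) (norm_nonneg _)]

/-- Ehrling's inequality for the compact embedding of `D(A^s)` into `H`. -/
theorem ehrling {E : Type*} [NormedAddCommGroup E] [InnerProductSpace ℝ E] [CompleteSpace E]
    (i : H →L[ℝ] E) (hi : Function.Injective i) (hs : 0 < s) {ε : ℝ} (hε : 0 < ε) :
    ∃ C : ℝ, 0 ≤ C ∧ ∀ v : S.GraphSpace s,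
      ‖toH v‖ ^ 2 ≤ ε * ‖op v‖ ^ 2 + C * ‖i (toH v)‖ ^ 2 := by
  have hlim : Tendsto (fun j => S.lam j ^ s) atTop atTop := (tendsto_rpow_atTop hs).comp S.tendsto
  -- From the index `N` on, `λ_j^(2s) ≥ 2/ε`, so the high modes cost at most `ε/2` times `‖op v‖²`.
  -- Finitely many modes remain.
  obtain ⟨N, hN⟩ := (hlim.eventually_ge_atTop (√(2 / ε))).exists
  have hN' : ∀ j, N ≤ j → 2 / ε ≤ (S.lam j ^ s) ^ 2 := fun j hj => by
    have h1 : √(2 / ε) ≤ S.lam j ^ s := hN.trans (by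
      have := S.lam_nonneg N
      have := S.mono hj
      gcongr)
    calc 2 / ε = √(2 / ε) ^ 2 := (Real.sq_sqrt (by positivity)).symm
      _ ≤ _ := by gcongr
  -- Each low mode leaves an error `2η²‖w‖²`; this `η` makes the sum of `N` of them at most half of
  -- `‖w‖²`.
  set η : ℝ := √(1 / (4 * (N + 1))) with hη
  have hη0 : 0 < η := by positivity
  -- Injectivity of `i` means dense range of its adjoint. Each low eigenvector is therefore nearly
  -- of the form `i* x`, and its coefficient is nearly `⟪x, i w⟫`, which only sees the weak norm.
  have hdense : Dense (range (ContinuousLinearMap.adjoint i)) := by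
    have h1 : (LinearMap.range (ContinuousLinearMap.adjoint i).toLinearMap)ᗮ = ⊥ := by
      rw [Submodule.eq_bot_iff]
      intro w hw
      rw [Submodule.mem_orthogonal] at hw
      apply hi
      rw [map_zero, ← inner_self_eq_zero (𝕜 := ℝ), ← ContinuousLinearMap.adjoint_inner_left]
      exact hw _ ⟨_, rfl⟩
    have := Submodule.topologicalClosure_eq_top_iff.2 h1
    exact Submodule.dense_iff_topologicalClosure_eq_top.2 this
  have hap : ∀ j, ∃ x : E, ‖S.vec j - ContinuousLinearMap.adjoint i x‖ < η := fun j => by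
    obtain ⟨_, ⟨x, rfl⟩, hx⟩ := hdense.exists_dist_lt (S.vec j) hη0
    exact ⟨x, by rwa [← dist_eq_norm]⟩
  choose x hx using hap
  set D : ℝ := ∑ j ∈ Finset.range N, ‖x j‖ ^ 2 with hD
  -- The low modes give `2D`, doubled when half of `‖w‖²` is absorbed on the left; the same doubling
  -- turns `ε/2` into `ε`.
  refine ⟨4 * D, by positivity, fun v => ?_⟩
  set w := toH v with hw
  have hcoef : ∀ j, ⟪S.vec j, w⟫ ^ 2 ≤ 2 * (‖x j‖ ^ 2 * ‖i w‖ ^ 2) + 2 * η ^ 2 * ‖w‖ ^ 2 := fun j => by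
    have h1 : ⟪S.vec j, w⟫ = ⟪x j, i w⟫ + ⟪S.vec j - ContinuousLinearMap.adjoint i (x j), w⟫ := by
      rw [inner_sub_left, ContinuousLinearMap.adjoint_inner_left]; ring
    have h2 : ⟪x j, i w⟫ ^ 2 ≤ ‖x j‖ ^ 2 * ‖i w‖ ^ 2 := by
      rw [← mul_pow, ← sq_abs]
      gcongr
      exact abs_real_inner_le_norm _ _
    have h3 : ⟪S.vec j - ContinuousLinearMap.adjoint i (x j), w⟫ ^ 2 ≤ η ^ 2 * ‖w‖ ^ 2 := by
      rw [← mul_pow, ← sq_abs]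
      gcongr
      refine (abs_real_inner_le_norm _ _).trans ?_
      have := (hx j).le
      gcongr
    rw [h1]
    nlinarith [sq_nonneg (⟪x j, i w⟫ - ⟪S.vec j - ContinuousLinearMap.adjoint i (x j), w⟫)]
  have hsum : ∑ j ∈ Finset.range N, ⟪S.vec j, w⟫ ^ 2
      ≤ 2 * D * ‖i w‖ ^ 2 + 1 / 2 * ‖w‖ ^ 2 := by
    refine (Finset.sum_le_sum fun j _ => hcoef j).trans ?_
    rw [Finset.sum_add_distrib, ← Finset.mul_sum, ← Finset.sum_mul, Finset.sum_const,
      Finset.card_range, nsmul_eq_mul, ← hD]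
    have h1 : (N : ℝ) * (2 * η ^ 2) ≤ 1 / 2 := by
      rw [hη, Real.sq_sqrt (by positivity)]
      have : (0 : ℝ) ≤ N := N.cast_nonneg
      rw [mul_one_div, mul_div_assoc', div_le_div_iff₀ (by positivity) (by positivity)]
      nlinarith
    nlinarith [mul_le_mul_of_nonneg_right h1 (sq_nonneg ‖w‖)]
  have htail : ∑' j, ⟪S.vec (j + N), w⟫ ^ 2 ≤ ε / 2 * ‖op v‖ ^ 2 := by
    have hsw := (S.hasSum_sq w).summable
    have hso := (S.hasSum_sq (op v)).summable
    have h1 : ∑' j, ⟪S.vec (j + N), op v⟫ ^ 2 ≤ ‖op v‖ ^ 2 := by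
      rw [← (S.hasSum_sq (op v)).tsum_eq, ← hso.sum_add_tsum_nat_add N]
      exact le_add_of_nonneg_left (Finset.sum_nonneg fun j _ => sq_nonneg _)
    calc ∑' j, ⟪S.vec (j + N), w⟫ ^ 2 ≤ ∑' j, ε / 2 * ⟪S.vec (j + N), op v⟫ ^ 2 := by
          refine Summable.tsum_le_tsum (fun j => ?_) ((summable_nat_add_iff N).2 hsw)
            (((summable_nat_add_iff N).2 hso).mul_left _)
          rw [inner_vec_op, mul_pow, ← hw]
          have h2 := hN' (j + N) (by omega)
          rw [div_le_iff₀ hε] at h2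
          nlinarith [mul_le_mul_of_nonneg_right h2 (sq_nonneg ⟪S.vec (j + N), w⟫)]
      _ = ε / 2 * ∑' j, ⟪S.vec (j + N), op v⟫ ^ 2 := tsum_mul_left
      _ ≤ _ := by gcongr
  have htot : ‖w‖ ^ 2 = ∑ j ∈ Finset.range N, ⟪S.vec j, w⟫ ^ 2 + ∑' j, ⟪S.vec (j + N), w⟫ ^ 2 := by
    rw [← (S.hasSum_sq w).tsum_eq, ← (S.hasSum_sq w).summable.sum_add_tsum_nat_add N]
  nlinarith

end GraphSpace

/-! #### The energy space and its dual -/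

theorem weight_pos (s : ℝ) (j : ℕ) : 0 < S.weight s j := by
  unfold weight
  split_ifs with h
  · exact one_pos
  · exact Real.rpow_pos_of_pos (lt_of_le_of_ne (S.lam_nonneg j) (Ne.symm h)) s

/-- Only finitely many indices precede the point where `λ_j^s ≥ 1`, and a finite set of positive
weights has a positive minimum. This makes the inclusion into `H` bounded and the weighted
coefficients onto. -/
theorem exists_le_weight {s : ℝ} (hs : 0 < s) : ∃ c : ℝ, 0 < c ∧ ∀ j, c ≤ S.weight s j := by
  have hlim : Tendsto (fun j => S.lam j ^ s) atTop atTop := (tendsto_rpow_atTop hs).comp S.tendsto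
  obtain ⟨N, hN⟩ := (hlim.eventually_ge_atTop 1).exists_forall_of_atTop
  obtain ⟨j₀, -, h₀⟩ := (Finset.range (N + 1)).exists_min_image (S.weight s) ⟨0, by simp⟩
  refine ⟨min (S.weight s j₀) 1, lt_min (S.weight_pos s j₀) one_pos, fun j => ?_⟩
  by_cases hj : j < N + 1
  · exact (min_le_left _ _).trans (h₀ j (by simpa using hj))
  · refine (min_le_right _ _).trans ?_
    unfold weight
    split_ifs
    · exact le_rfl
    · exact hN j (by omega)

end EigenSystem

end Spectral

/-! ### The energy space and its dual as `ℓ²`, the kernel of the power, and its inversion -/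

section Spectral

set_option linter.unusedSectionVars false

variable {H : Type*} [NormedAddCommGroup H] [InnerProductSpace ℝ H] [CompleteSpace H]

namespace EigenSystem

variable {A : H →ₗ.[ℝ] H} (S : EigenSystem A) {s : ℝ}

theorem inner_vec_vec (i j : ℕ) : ⟪S.vec i, S.vec j⟫ = if i = j then (1 : ℝ) else 0 :=
  orthonormal_iff_ite.1 S.orthonormal i j

theorem vec_mem_domPow (s : ℝ) (j : ℕ) : S.vec j ∈ S.domPow s := by
  refine S.mem_domPow_of_inner_eq (w := S.lam j ^ s • S.vec j) fun i => ?_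
  rw [real_inner_smul_right, inner_vec_vec]
  rcases eq_or_ne i j with rfl | hij
  · rfl
  · simp [hij]

namespace EnergySpace

variable {S}

/-- An element of `H` that belongs to `D(A^s)`, as an element of the energy space. -/
def ofMem {v : H} (hv : v ∈ S.domPow s) : S.EnergySpace s := ⟨v, hv⟩

theorem toH_ofMem {v : H} (hv : v ∈ S.domPow s) : toH (ofMem hv) = v := rfl

theorem inner_vec_op (v : S.EnergySpace s) (j : ℕ) :
    ⟪S.vec j, op v⟫ = S.lam j ^ s * ⟪S.vec j, toH v⟫ := S.inner_vec_pow v j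

/-- The weighted coefficients as a linear isometry. -/
def coeffIsometry : S.EnergySpace s →ₗᵢ[ℝ] lp (fun _ : ℕ => ℝ) 2 where
  toLinearMap := S.coeffMap s
  norm_map' _ := rfl

theorem coeffIsometry_apply (v : S.EnergySpace s) (j : ℕ) :
    coeffIsometry v j = S.weight s j * ⟪S.vec j, toH v⟫ := rfl

/-- Division by weights bounded below keeps a sequence in `ℓ²`. The energy space thus becomes a
Hilbert space, in which all later computations are made. -/
theorem coeffIsometry_surjective (hs : 0 < s) :
    Function.Surjective (coeffIsometry : S.EnergySpace s →ₗᵢ[ℝ] lp (fun _ : ℕ => ℝ) 2) := by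
  intro a
  obtain ⟨c, hc, hcw⟩ := S.exists_le_weight hs
  have hb : Memℓp (fun j => a j / S.weight s j) 2 := by
    refine ((lp.memℓp a).const_smul c⁻¹).mono' fun j => ?_
    rw [Pi.smul_apply, smul_eq_mul, norm_mul, norm_div, Real.norm_of_nonneg (S.weight_pos s j).le,
      Real.norm_of_nonneg (inv_nonneg.2 hc.le), div_eq_inv_mul]
    gcongr
    exact hcw j
  set b : lp (fun _ : ℕ => ℝ) 2 := ⟨fun j => a j / S.weight s j, hb⟩ with hbdef
  set v := S.basis.repr.symm b with hv
  have hcoef : ∀ j, ⟪S.vec j, v⟫ = a j / S.weight s j := fun j => by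
    rw [← S.basis_repr_apply, hv, LinearIsometryEquiv.apply_symm_apply]
  have hw : ∀ j, S.lam j ^ s * ⟪S.vec j, v⟫ = if S.lam j = 0 then 0 else a j := fun j => by
    rw [hcoef]
    unfold weight
    split_ifs with h
    · rw [h, Real.zero_rpow hs.ne', zero_mul]
    · have : S.lam j ^ s ≠ 0 :=
        (Real.rpow_pos_of_pos (lt_of_le_of_ne (S.lam_nonneg j) (Ne.symm h)) s).ne'
      field_simp
  have hmem : v ∈ S.domPow s := by
    have h2 : Summable fun j => (a j) ^ 2 := by
      simpa using (lp.memℓp a).summable (by norm_num)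
    refine Summable.of_nonneg_of_le (fun j => sq_nonneg _) (fun j => ?_) h2
    rw [hw]
    split_ifs
    · simpa using sq_nonneg (a j)
    · exact le_rfl
  refine ⟨ofMem hmem, lp.ext (funext fun j => ?_)⟩
  rw [coeffIsometry_apply, toH_ofMem, hcoef, mul_div_cancel₀ _ (S.weight_ne_zero s j)]

/-- The weighted coefficients identify `D(A^s)` with `ℓ²`. -/
def coeffEquiv (hs : 0 < s) : S.EnergySpace s ≃ₗᵢ[ℝ] lp (fun _ : ℕ => ℝ) 2 :=
  LinearIsometryEquiv.ofSurjective coeffIsometry (coeffIsometry_surjective hs)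

theorem coeffEquiv_apply (hs : 0 < s) (v : S.EnergySpace s) (j : ℕ) :
    coeffEquiv hs v j = S.weight s j * ⟪S.vec j, toH v⟫ := rfl

theorem hasSum_inner_coeffEquiv (hs : 0 < s) (v w : S.EnergySpace s) :
    HasSum (fun j => (S.weight s j * ⟪S.vec j, toH v⟫) * (S.weight s j * ⟪S.vec j, toH w⟫))
      ⟪coeffEquiv hs v, coeffEquiv hs w⟫ := by
  have h := lp.hasSum_inner (𝕜 := ℝ) (coeffEquiv hs v) (coeffEquiv hs w)
  refine h.congr_fun fun j => ?_
  rw [coeffEquiv_apply, coeffEquiv_apply]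
  simp [mul_comm]

theorem exists_norm_toH_le (hs : 0 < s) : ∃ C : ℝ, ∀ v : S.EnergySpace s, ‖toH v‖ ≤ C * ‖v‖ := by
  obtain ⟨c, hc, hcw⟩ := S.exists_le_weight hs
  refine ⟨c⁻¹, fun v => ?_⟩
  rw [← (coeffEquiv hs).norm_map v, le_inv_mul_iff₀ hc]
  refine le_of_sq_le_sq ?_ (norm_nonneg _)
  rw [mul_pow, ← real_inner_self_eq_norm_sq (coeffEquiv hs v)]
  refine hasSum_le (fun j => ?_) ((S.hasSum_sq (toH v)).mul_left (c ^ 2))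
    (hasSum_inner_coeffEquiv hs v v)
  have h1 : c ^ 2 ≤ S.weight s j ^ 2 := by
    have := hcw j
    gcongr
  nlinarith [mul_le_mul_of_nonneg_right h1 (sq_nonneg ⟪S.vec j, toH v⟫)]

/-- The continuous inclusion of `D(A^s)` into `H`. -/
def toHL (hs : 0 < s) : S.EnergySpace s →L[ℝ] H :=
  LinearMap.mkContinuousOfExistsBound toH (exists_norm_toH_le hs)

theorem toHL_apply (hs : 0 < s) (v : S.EnergySpace s) : toHL hs v = toH v := rfl

end EnergySpace

open EnergySpace

theorem eq_of_inner_coeffEquiv (hs : 0 < s) {a b : lp (fun _ : ℕ => ℝ) 2}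
    (h : ∀ v : S.EnergySpace s, ⟪a, coeffEquiv hs v⟫ = ⟪b, coeffEquiv hs v⟫) : a = b := by
  refine ext_inner_right ℝ fun c => ?_
  rw [← (coeffEquiv (S := S) hs).apply_symm_apply c]
  exact h _

theorem exists_riesz (hs : 0 < s) (f : S.DualSpace s) :
    ∃ a : lp (fun _ : ℕ => ℝ) 2, ∀ v : S.EnergySpace s, ⟪a, coeffEquiv hs v⟫ = f v := by
  refine ⟨(InnerProductSpace.toDual ℝ _).symm
    (f.comp ((coeffEquiv (S := S) hs).symm.toContinuousLinearEquiv : _ →L[ℝ] S.EnergySpace s)),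
    fun v => ?_⟩
  rw [InnerProductSpace.toDual_symm_apply]
  exact congrArg f ((coeffEquiv hs).symm_apply_apply v)

/-- The Riesz map from the dual of `D(A^s)` to `ℓ²`. -/
def riesz (hs : 0 < s) : S.DualSpace s →ₗᵢ[ℝ] lp (fun _ : ℕ => ℝ) 2 where
  toFun f := (S.exists_riesz hs f).choose
  map_add' f g := S.eq_of_inner_coeffEquiv hs fun v => by
    rw [inner_add_left, (S.exists_riesz hs _).choose_spec, (S.exists_riesz hs _).choose_spec,
      (S.exists_riesz hs _).choose_spec, add_apply]
  map_smul' c f := S.eq_of_inner_coeffEquiv hs fun v => by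
    rw [RingHom.id_apply, real_inner_smul_left, (S.exists_riesz hs _).choose_spec,
      (S.exists_riesz hs _).choose_spec, smul_apply, smul_eq_mul]
  norm_map' f := by
    have h := (S.exists_riesz hs f).choose_spec
    set a := (S.exists_riesz hs f).choose
    change ‖a‖ = _
    refine le_antisymm ?_ (ContinuousLinearMap.opNorm_le_bound _ (norm_nonneg _) fun v => ?_)
    · have h1 := h ((coeffEquiv hs).symm a)
      rw [LinearIsometryEquiv.apply_symm_apply, real_inner_self_eq_norm_sq] at h1
      have h2 := (le_abs_self _).trans (f.le_opNorm ((coeffEquiv hs).symm a))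
      rw [LinearIsometryEquiv.norm_map, ← h1] at h2
      rcases (norm_nonneg a).eq_or_lt with h3 | h3
      · rw [← h3]; exact norm_nonneg f
      · nlinarith
    · rw [← h v, ← (coeffEquiv hs).norm_map v]
      exact norm_inner_le_norm _ _

theorem inner_riesz (hs : 0 < s) (f : S.DualSpace s) (v : S.EnergySpace s) :
    ⟪S.riesz hs f, coeffEquiv hs v⟫ = f v := (S.exists_riesz hs f).choose_spec v

/-- The embedding of `H` into the dual of `D(A^s)`, the latter identified with `ℓ²`. -/
def embed (hs : 0 < s) : H →L[ℝ] lp (fun _ : ℕ => ℝ) 2 :=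
  ContinuousLinearMap.adjoint
    ((toHL hs).comp ((coeffEquiv (S := S) hs).symm.toContinuousLinearEquiv :
      _ →L[ℝ] S.EnergySpace s))

theorem inner_embed (hs : 0 < s) (w : H) (v : S.EnergySpace s) :
    ⟪S.embed hs w, coeffEquiv hs v⟫ = ⟪w, toH v⟫ := by
  rw [embed, ContinuousLinearMap.adjoint_inner_left, ContinuousLinearMap.comp_apply, toHL_apply]
  simp

/-- Converts the identification of `H` with functionals on `D(A^s)` into an equation in `ℓ²`, which
can be integrated in time. -/
theorem represents_iff (hs : 0 < s) {f : S.DualSpace s} {w : H} :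
    S.Represents f w ↔ S.riesz hs f = S.embed hs w := by
  constructor
  · intro h
    refine S.eq_of_inner_coeffEquiv hs fun v => ?_
    rw [inner_riesz, inner_embed, h]
  · intro h v
    rw [← S.inner_riesz hs, h, inner_embed]

/-- The eigenvectors belong to `D(A^s)` and separate the points of `H`. -/
theorem embed_injective (hs : 0 < s) : Function.Injective (S.embed hs) := by
  intro v w h
  refine S.eq_of_inner_vec fun j => ?_
  have h1 := S.inner_embed hs v (ofMem (S.vec_mem_domPow s j))
  have h2 := S.inner_embed hs w (ofMem (S.vec_mem_domPow s j))
  rw [toH_ofMem] at h1 h2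
  rw [real_inner_comm, ← h1, h, h2, real_inner_comm]

theorem lam_pos_of_ne_zero (hsimple : 0 < S.lam 0 ∨ S.lam 0 = 0 ∧ 0 < S.lam 1) {j : ℕ}
    (hj : j ≠ 0) : 0 < S.lam j := by
  rcases hsimple with h | h
  · exact h.trans_le (S.mono (Nat.zero_le j))
  · exact h.2.trans_le (S.mono (Nat.one_le_iff_ne_zero.2 hj))

theorem weight_of_pos {j : ℕ} (h : 0 < S.lam j) (s : ℝ) : S.weight s j = S.lam j ^ s := by
  rw [weight, if_neg h.ne']

/-- The kernel of `A^s`, in the coefficient space. -/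
theorem exists_kernel_vector (hsimple : 0 < S.lam 0 ∨ S.lam 0 = 0 ∧ 0 < S.lam 1) (hs : 0 < s) :
    ∃ k : lp (fun _ : ℕ => ℝ) 2, (S.lam 0 ≠ 0 → k = 0) ∧ (S.lam 0 = 0 → ‖k‖ = 1) ∧
      (S.lam 0 = 0 → ∀ w : H, ⟪k, S.embed hs w⟫ = ⟪S.vec 0, w⟫) ∧
      ∀ v w : S.EnergySpace s, ⟪op v, op w⟫ = ⟪coeffEquiv hs v, coeffEquiv hs w⟫
        - ⟪k, coeffEquiv hs v⟫ * ⟪k, coeffEquiv hs w⟫ := by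
  have hop : ∀ v w : S.EnergySpace s, HasSum (fun j => (S.lam j ^ s * ⟪S.vec j, toH v⟫) *
      (S.lam j ^ s * ⟪S.vec j, toH w⟫)) ⟪op v, op w⟫ := fun v w => by
    simpa only [inner_vec_op] using S.hasSum_inner (op v) (op w)
  by_cases h0 : S.lam 0 = 0
  -- The weight of the first eigenvector is `1` here, whereas `0^s = 0`: the energy inner product
  -- and `⟪op v, op w⟫` differ exactly by this one mode.
  · set e : S.EnergySpace s := ofMem (S.vec_mem_domPow s 0) with he
    have hk : ∀ v : S.EnergySpace s, ⟪coeffEquiv hs e, coeffEquiv hs v⟫ = ⟪S.vec 0, toH v⟫ := by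
      intro v
      refine (hasSum_inner_coeffEquiv hs e v).unique ?_
      have h1 : ∀ j, (S.weight s j * ⟪S.vec j, toH e⟫) * (S.weight s j * ⟪S.vec j, toH v⟫)
          = if j = 0 then ⟪S.vec 0, toH v⟫ else 0 := fun j => by
        rw [he, toH_ofMem, inner_vec_vec]
        rcases eq_or_ne j 0 with rfl | hj
        · simp [weight, h0]
        · simp [hj]
      simp only [h1]
      exact hasSum_ite_eq 0 _
    refine ⟨coeffEquiv hs e, fun h => absurd h0 h, fun _ => ?_, fun _ w => ?_, fun v w => ?_⟩
    · have h1 := hk e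
      rw [he, toH_ofMem, inner_vec_vec, if_pos rfl, ← he, real_inner_self_eq_norm_sq] at h1
      exact (pow_eq_one_iff_of_nonneg (norm_nonneg _) two_ne_zero).1 h1
    · rw [real_inner_comm, inner_embed, he, toH_ofMem, real_inner_comm]
    · rw [hk, hk]
      refine (hop v w).unique ?_
      refine ((hasSum_inner_coeffEquiv hs v w).sub
        (hasSum_ite_eq 0 (⟪S.vec 0, toH v⟫ * ⟪S.vec 0, toH w⟫))).congr_fun fun j => ?_
      rcases eq_or_ne j 0 with rfl | hj
      · simp [weight, h0, Real.zero_rpow hs.ne']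
      · rw [S.weight_of_pos (S.lam_pos_of_ne_zero hsimple hj)]
        simp [hj]
  · have hpos : ∀ j, 0 < S.lam j := fun j => by
      rcases eq_or_ne j 0 with rfl | hj
      · exact lt_of_le_of_ne S.nonneg (Ne.symm h0)
      · exact S.lam_pos_of_ne_zero hsimple hj
    refine ⟨0, fun _ => rfl, fun h => absurd h h0, fun h => absurd h h0, fun v w => ?_⟩
    simp only [inner_zero_left, mul_zero, sub_zero]
    refine (hop v w).unique ((hasSum_inner_coeffEquiv hs v w).congr_fun fun j => ?_)
    rw [S.weight_of_pos (hpos j)]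

/-- The solution `m` of `A^s m = -z` whose component along the first eigenvector is `a`
if the first eigenvalue vanishes. -/
def inversePow (hs : 0 < s) (z : H) (a : ℝ) : S.EnergySpace s :=
  (coeffEquiv hs).symm (-S.basis.repr z +
    a • (if S.lam 0 = 0 then lp.single 2 0 (1 : ℝ) else 0))

theorem norm_inversePow_le (hs : 0 < s) (z : H) (a : ℝ) :
    ‖S.inversePow hs z a‖ ≤ ‖z‖ + |a| := by
  rw [inversePow, LinearIsometryEquiv.norm_map]
  refine (norm_add_le _ _).trans ?_
  rw [norm_neg, LinearIsometryEquiv.norm_map, norm_smul, Real.norm_eq_abs]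
  gcongr
  refine mul_le_of_le_one_right (abs_nonneg a) ?_
  split_ifs
  · rw [lp.norm_single (by norm_num)]
    simp
  · simp

/-- Testing with eigenvectors gives `⟪e_j, z⟫ + λ_j^(2s) ⟪e_j, m⟫ = 0`, which determines every
coefficient of `m` with `λ_j > 0`. If the first eigenvalue vanishes, it forces `z` to have no first
component, and the first component of `m` has to be prescribed. -/
theorem toH_inversePow (hsimple : 0 < S.lam 0 ∨ S.lam 0 = 0 ∧ 0 < S.lam 1)
    (hs2 : 0 < 2 * s) {m : S.EnergySpace s} {z : H}
    (h : ∀ v : S.EnergySpace s, ⟪z, toH v⟫ + ⟪op m, op v⟫ = 0) :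
    toH (S.inversePow hs2 z ⟪S.vec 0, toH m⟫) = toH m := by
  have hj : ∀ j, ⟪S.vec j, z⟫ + S.lam j ^ (2 * s) * ⟪S.vec j, toH m⟫ = 0 := fun j => by
    have h1 := h (ofMem (S.vec_mem_domPow s j))
    have h2 : op (ofMem (S.vec_mem_domPow s j)) = S.lam j ^ s • S.vec j := by
      refine S.eq_of_inner_vec fun i => ?_
      rw [inner_vec_op, toH_ofMem, real_inner_smul_right, inner_vec_vec]
      rcases eq_or_ne i j with rfl | hij
      · rfl
      · simp [hij]
    rw [h2, toH_ofMem, real_inner_smul_right, real_inner_comm, real_inner_comm (S.vec j) (op m),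
      inner_vec_op] at h1
    rw [rpow_two_mul]
    linarith
  refine S.eq_of_inner_vec fun j => ?_
  have h1 := coeffEquiv_apply hs2 (S.inversePow hs2 z ⟪S.vec 0, toH m⟫) j
  rw [inversePow, LinearIsometryEquiv.apply_symm_apply, lp.coeFn_add, Pi.add_apply, lp.coeFn_neg,
    Pi.neg_apply, basis_repr_apply, lp.coeFn_smul, Pi.smul_apply, smul_eq_mul] at h1
  apply mul_left_cancel₀ (S.weight_ne_zero (2 * s) j)
  rw [← inversePow] at h1
  rw [← h1]
  have h2 := hj j
  by_cases h0 : S.lam j = 0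
  · have hj0 : j = 0 := by
      by_contra hne
      exact (S.lam_pos_of_ne_zero hsimple hne).ne' h0
    subst hj0
    rw [h0, Real.zero_rpow hs2.ne', zero_mul, add_zero] at h2
    rw [h2]
    simp [weight, h0]
  · rw [S.weight_of_pos (lt_of_le_of_ne (S.lam_nonneg j) (Ne.symm h0))]
    have : (if S.lam 0 = 0 then lp.single 2 0 (1 : ℝ) else 0 : lp (fun _ : ℕ => ℝ) 2) j = 0 := by
      split_ifs with h00
      · have hj0 : j ≠ 0 := fun hj0 => h0 (hj0 ▸ h00)
        simp [lp.single_apply, hj0]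
      · rfl
    rw [this, mul_zero, add_zero]
    linarith

end EigenSystem

end Spectral

/-! ### Subgradients, Yosida approximation and superposition operators -/

section Potential

variable {βh : ℝ → ℝ≥0∞} {πh : ℝ → ℝ}

theorem toReal_add_mul_le {s ξ z : ℝ} (hξ : ξ ∈ subdiff βh s) (hs : βh s ≠ ∞) (hz : βh z ≠ ∞) :
    (βh s).toReal + ξ * (z - s) ≤ (βh z).toReal := by
  have h := hξ z
  rw [← EReal.coe_ennreal_toReal hs, ← EReal.coe_ennreal_toReal hz] at h
  exact_mod_cast h

theorem ne_top_of_mem_subdiff {s ξ z : ℝ} (hξ : ξ ∈ subdiff βh s) (hz : βh z ≠ ∞) :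
    βh s ≠ ∞ := by
  intro hs
  have h := hξ z
  rw [hs, EReal.coe_ennreal_top, EReal.top_add_coe, ← EReal.coe_ennreal_toReal hz, top_le_iff] at h
  exact EReal.coe_ne_top _ h

/-- The point `p` minimizes the Moreau functional `βh(p) + (p - s)²/(2 lam)`; the inclusion is its
optimality condition. -/
theorem IsAdmissiblePotential.exists_resolvent (h : IsAdmissiblePotential βh πh) {lam : ℝ}
    (hl : 0 < lam) (s : ℝ) : ∃ p, (s - p) / lam ∈ subdiff βh p := by
  set f : ℝ → ℝ≥0∞ := fun p => βh p + ENNReal.ofReal ((p - s) ^ 2 / (2 * lam)) with hf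
  have hfl : LowerSemicontinuous f := by
    refine h.lsc.add (Continuous.lowerSemicontinuous ?_)
    exact ENNReal.continuous_ofReal.comp (by fun_prop)
  -- A point outside this interval is farther from `s` than `0` is, and `βh 0 = 0`, so the minimum
  -- over the interval is global.
  obtain ⟨p, -, hp⟩ := (hfl.lowerSemicontinuousOn _).exists_isMinOn
    (s := Icc (s - |s|) (s + |s|)) ⟨s, by simp, by simp⟩ isCompact_Icc
  have h0m : (0 : ℝ) ∈ Icc (s - |s|) (s + |s|) :=
    ⟨by linarith [le_abs_self s], by linarith [neg_abs_le s]⟩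
  have hmin : ∀ q, f p ≤ f q := fun q => by
    by_cases hq : q ∈ Icc (s - |s|) (s + |s|)
    · exact hp hq
    · refine (hp h0m).trans ?_
      simp only [hf]
      rw [h.zero, zero_add]
      refine le_trans (ENNReal.ofReal_le_ofReal ?_) le_add_self
      have : |s| ≤ |q - s| := by
        by_contra hc
        rw [not_le, abs_lt] at hc
        exact hq ⟨by linarith [hc.1], by linarith [hc.2]⟩
      have h2 : (0 - s) ^ 2 ≤ (q - s) ^ 2 := by
        rw [zero_sub, neg_sq]
        exact sq_le_sq.2 this
      exact div_le_div_of_nonneg_right h2 (by positivity)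
  have hpt : βh p ≠ ∞ := by
    intro ht
    have := hmin 0
    simp only [hf] at this
    rw [ht, h.zero, zero_add, top_add, top_le_iff] at this
    exact ENNReal.ofReal_ne_top this
  refine ⟨p, fun z => ?_⟩
  by_cases hz : βh z = ∞
  · rw [hz, EReal.coe_ennreal_top]
    exact le_top
  rw [← EReal.coe_ennreal_toReal hpt, ← EReal.coe_ennreal_toReal hz]
  norm_cast
  set a := (βh p).toReal
  set b := (βh z).toReal
  -- Minimality compared along the segment from `p` to `z`, with convexity, after division by `θ`.
  -- The quadratic remainder disappears as `θ → 0`.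
  have hineq : ∀ θ : ℝ, 0 < θ → θ ≤ 1 →
      0 ≤ (b - a + (p - s) / lam * (z - p)) + θ * ((z - p) ^ 2 / (2 * lam)) := fun θ h0 h1 => by
    set q := (1 - θ) * p + θ * z with hq
    have hc := h.convex.2 (mem_univ p) (mem_univ z) (zero_le : 0 ≤ (1 - θ).toNNReal)
      (zero_le : 0 ≤ θ.toNNReal) (by
        rw [← Real.toNNReal_add (by linarith) h0.le, sub_add_cancel, Real.toNNReal_one])
    have e1 : (1 - θ).toNNReal • p + θ.toNNReal • z = q := by
      rw [NNReal.smul_def, NNReal.smul_def, Real.coe_toNNReal _ (by linarith),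
        Real.coe_toNNReal _ h0.le]
      rfl
    rw [e1] at hc
    have e2 : (1 - θ).toNNReal • βh p + θ.toNNReal • βh z
        = ENNReal.ofReal ((1 - θ) * a + θ * b) := by
      rw [ENNReal.ofReal_add (mul_nonneg (by linarith) ENNReal.toReal_nonneg)
        (mul_nonneg h0.le ENNReal.toReal_nonneg), ENNReal.ofReal_mul (by linarith),
        ENNReal.ofReal_mul h0.le, ENNReal.ofReal_toReal hpt, ENNReal.ofReal_toReal hz]
      rfl
    rw [e2] at hc
    have hm := hmin q
    simp only [hf] at hm
    have hm2 := hm.trans (add_le_add hc le_rfl)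
    rw [← ENNReal.ofReal_toReal hpt, ← ENNReal.ofReal_add ENNReal.toReal_nonneg (by positivity),
      ← ENNReal.ofReal_add (add_nonneg (mul_nonneg (by linarith) ENNReal.toReal_nonneg)
        (mul_nonneg h0.le ENNReal.toReal_nonneg)) (by positivity),
      ENNReal.ofReal_le_ofReal_iff (add_nonneg (add_nonneg (mul_nonneg (by linarith)
        ENNReal.toReal_nonneg) (mul_nonneg h0.le ENNReal.toReal_nonneg)) (by positivity))] at hm2
    have e3 : (q - s) ^ 2 / (2 * lam) = (p - s) ^ 2 / (2 * lam)
        + θ * ((p - s) / lam * (z - p)) + θ * (θ * ((z - p) ^ 2 / (2 * lam))) := by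
      rw [hq]; field_simp; ring
    rw [e3] at hm2
    have : 0 ≤ θ * ((b - a + (p - s) / lam * (z - p)) + θ * ((z - p) ^ 2 / (2 * lam))) := by
      change a + _ ≤ _ at hm2
      linarith
    exact nonneg_of_mul_nonneg_right this h0
  have hlim : Tendsto (fun θ : ℝ => (b - a + (p - s) / lam * (z - p))
      + θ * ((z - p) ^ 2 / (2 * lam))) (𝓝[>] 0) (𝓝 (b - a + (p - s) / lam * (z - p))) := by
    have : Continuous fun θ : ℝ => (b - a + (p - s) / lam * (z - p))
      + θ * ((z - p) ^ 2 / (2 * lam)) := by fun_prop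
    have := this.tendsto 0
    rw [zero_mul, add_zero] at this
    exact this.mono_left nhdsWithin_le_nhds
  have hfin : 0 ≤ b - a + (p - s) / lam * (z - p) := by
    refine ge_of_tendsto hlim ?_
    filter_upwards [Ioo_mem_nhdsGT (one_pos (α := ℝ))] with θ hθ
    exact hineq θ hθ.1 hθ.2.le
  have e4 : (p - s) / lam * (z - p) = -((s - p) / lam * (z - p)) := by ring
  rw [e4] at hfin
  linarith

theorem IsAdmissiblePotential.yosida_mem_subdiff (h : IsAdmissiblePotential βh πh) {lam : ℝ}
    (hl : 0 < lam) (s : ℝ) : yosida βh lam s ∈ subdiff βh (s - lam * yosida βh lam s) := by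
  have h1 : s - lam * yosida βh lam s = resolvent βh lam s := by
    unfold yosida
    field_simp
    ring
  rw [h1]
  exact Classical.epsilon_spec (p := fun p => (s - p) / lam ∈ subdiff βh p)
    (h.exists_resolvent hl s)

/-- Uniform choice of admissible constants on both sides of the mean value. -/
theorem exists_grid_bound (h0 : βh 0 = 0) {δ : ℝ} (hδ : 0 < δ) (Q : ℝ) :
    ∃ M : ℝ, 0 ≤ M ∧ ∀ m : ℝ, |m| ≤ Q → Icc (m - δ) (m + δ) ⊆ subdiffDom βh →
      (∃ g ∈ Icc (m + δ / 2) (m + δ), βh g ≤ ENNReal.ofReal M) ∧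
      ∃ g ∈ Icc (m - δ) (m - δ / 2), βh g ≤ ENNReal.ofReal M := by
  obtain ⟨N, hN⟩ := exists_nat_ge ((Q + δ) / (δ / 2))
  set I := Finset.Icc (-(N : ℤ)) N with hI
  -- One sum over the whole grid of mesh `δ/2` depends on `δ` and `Q` but not on the mean `m`. Grid
  -- points of infinite value contribute `0` through `toReal`; the bound is invoked only at points
  -- of the domain, where the value is finite.
  set M := ∑ k ∈ I, (βh (k * (δ / 2))).toReal with hM
  refine ⟨M, Finset.sum_nonneg fun k _ => ENNReal.toReal_nonneg, fun m hm hsub => ?_⟩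
  have key : ∀ k : ℤ, (k : ℝ) * (δ / 2) ∈ Icc (m - δ) (m + δ) →
      βh (k * (δ / 2)) ≤ ENNReal.ofReal M := fun k hk => by
    obtain ⟨ξ, hξ⟩ := hsub hk
    have hfin := ne_top_of_mem_subdiff hξ (z := 0) (by simp [h0])
    rw [← ENNReal.ofReal_toReal hfin]
    refine ENNReal.ofReal_le_ofReal ?_
    have hkI : k ∈ I := by
      have h1 : |(k : ℝ)| ≤ N := by
        refine le_trans ?_ hN
        rw [le_div_iff₀ (by positivity), ← abs_of_pos (half_pos hδ), ← abs_mul, abs_le]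
        have := abs_le.1 hm
        exact ⟨by linarith [hk.1], by linarith [hk.2]⟩
      rw [abs_le] at h1
      rw [hI, Finset.mem_Icc]
      exact ⟨by exact_mod_cast h1.1, by exact_mod_cast h1.2⟩
    exact Finset.single_le_sum (f := fun k : ℤ => (βh (k * (δ / 2))).toReal)
      (fun k _ => ENNReal.toReal_nonneg) hkI
  have hδ2 : 0 < δ / 2 := by positivity
  constructor
  -- An interval of length `δ/2` always contains a point of the grid of that mesh.
  · set k := ⌈(m + δ / 2) / (δ / 2)⌉ with hk
    have h1 : m + δ / 2 ≤ k * (δ / 2) := by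
      rw [← div_le_iff₀ hδ2]; exact Int.le_ceil _
    have h2 : k * (δ / 2) ≤ m + δ := by
      have := Int.ceil_lt_add_one ((m + δ / 2) / (δ / 2))
      rw [← hk, ← sub_lt_iff_lt_add, lt_div_iff₀ hδ2] at this
      linarith
    exact ⟨k * (δ / 2), ⟨h1, h2⟩, key k ⟨by linarith, h2⟩⟩
  · set k := ⌊(m - δ / 2) / (δ / 2)⌋ with hk
    have h1 : k * (δ / 2) ≤ m - δ / 2 := by
      rw [← le_div_iff₀ hδ2]; exact Int.floor_le _
    have h2 : m - δ ≤ k * (δ / 2) := by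
      have := Int.lt_floor_add_one ((m - δ / 2) / (δ / 2))
      rw [← hk, div_lt_iff₀ hδ2] at this
      linarith
    exact ⟨k * (δ / 2), ⟨h2, h1⟩, key k ⟨h2, by linarith⟩⟩

variable {Ω : Set (EuclideanSpace ℝ (Fin 3))}

theorem inner_eq_integral (v w : L2 Ω) : ⟪v, w⟫ = ∫ x in Ω, v x * w x := by
  rw [L2.inner_def]
  refine integral_congr_ae (ae_of_all _ fun x => ?_)
  simp [mul_comm]

theorem integrable_mul (v w : L2 Ω) :
    Integrable (fun x => v x * w x) (volume.restrict Ω) :=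
  (Lp.memLp v).integrable_mul (Lp.memLp w)

theorem aemeasurable_comp (h : IsAdmissiblePotential βh πh) (v : L2 Ω) :
    AEMeasurable (fun x => βh (v x)) (volume.restrict Ω) :=
  h.lsc.measurable.comp_aemeasurable (Lp.aestronglyMeasurable v).aemeasurable

theorem ae_ne_top (h : IsAdmissiblePotential βh πh) {v : L2 Ω} (hv : energy βh v ≠ ∞) :
    ∀ᵐ x ∂(volume.restrict Ω), βh (v x) ≠ ∞ :=
  (ae_lt_top' (aemeasurable_comp h v) hv).mono fun _ hx => hx.ne

/-- The subgradient inequality for the integral functional. -/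
theorem energy_add_inner_le (h : IsAdmissiblePotential βh πh) {p q b : L2 Ω}
    (hp : energy βh p ≠ ∞) (hq : energy βh q ≠ ∞)
    (hb : ∀ᵐ x ∂(volume.restrict Ω), b x ∈ subdiff βh (p x)) :
    (energy βh p).toReal + ⟪b, q - p⟫ ≤ (energy βh q).toReal := by
  have e : ∀ v : L2 Ω, energy βh v ≠ ∞ → (energy βh v).toReal = ∫ x in Ω, (βh (v x)).toReal ∧
      Integrable (fun x => (βh (v x)).toReal) (volume.restrict Ω) := fun v hv =>
    ⟨(integral_toReal (aemeasurable_comp h v) ((ae_ne_top h hv).mono fun x hx => hx.lt_top)).symm,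
      integrable_toReal_of_lintegral_ne_top (aemeasurable_comp h v) hv⟩
  obtain ⟨e1, i1⟩ := e p hp
  obtain ⟨e2, i2⟩ := e q hq
  rw [e1, e2, inner_eq_integral, ← integral_add i1 (integrable_mul _ _)]
  refine integral_mono_ae (i1.add (integrable_mul _ _)) i2 ?_
  filter_upwards [hb, ae_ne_top h hp, ae_ne_top h hq, Lp.coeFn_sub q p] with x h1 h2 h3 h4
  rw [h4, Pi.sub_apply]
  exact toReal_add_mul_le h1 h2 h3

/-- Approximate subgradients at `y0` given by the Yosida approximation. -/
theorem exists_energy_add_inner_le (h : IsAdmissiblePotential βh πh) {y0 q : L2 Ω}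
    (hy0 : energy βh y0 ≠ ∞) (hq : energy βh q ≠ ∞) {ε : ℝ} (hε : 0 < ε) (b : ℝ → L2 Ω)
    (hb : ∀ lam ∈ Ioo 0 ε, ∀ᵐ x ∂(volume.restrict Ω), b lam x = yosida βh lam (y0 x))
    {η : ℝ} (hη : 0 < η) :
    ∃ lam ∈ Ioo 0 ε, (energy βh y0).toReal + ⟪b lam, q - y0⟫ ≤ (energy βh q).toReal + η := by
  -- The shift by `2` keeps every level strictly below `ε`.
  set l : ℕ → ℝ := fun n => ε / (n + 2) with hl
  have hlpos : ∀ n, 0 < l n := fun n => by positivity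
  have hlm : ∀ n, l n ∈ Ioo 0 ε := fun n => ⟨hlpos n, div_lt_self hε (by
    have : (0 : ℝ) ≤ n := n.cast_nonneg
    linarith)⟩
  have hl0 : Tendsto l atTop (𝓝 0) := by
    refine tendsto_const_nhds.div_atTop ?_
    exact tendsto_atTop_add_const_right _ _ tendsto_natCast_atTop_atTop
  -- The resolvent of `y0`: at this point `b (l n)` is an exact subgradient.
  set p : ℕ → L2 Ω := fun n => y0 - l n • b (l n) with hp
  have hpx : ∀ᵐ x ∂(volume.restrict Ω), ∀ n, b (l n) x = yosida βh (l n) (y0 x) ∧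
      p n x = y0 x - l n * b (l n) x := by
    refine ae_all_iff.2 fun n => ?_
    filter_upwards [hb _ (hlm n), Lp.coeFn_sub y0 (l n • b (l n)),
      Lp.coeFn_smul (l n) (b (l n))] with x h1 h2 h3
    refine ⟨h1, ?_⟩
    simp only [hp]
    rw [h2, Pi.sub_apply, h3, Pi.smul_apply, smul_eq_mul]
  have hsub : ∀ᵐ x ∂(volume.restrict Ω), ∀ n, b (l n) x ∈ subdiff βh (p n x) := by
    filter_upwards [hpx] with x hx n
    rw [(hx n).2, (hx n).1]
    exact h.yosida_mem_subdiff (hlpos n) _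
  have hle : ∀ᵐ x ∂(volume.restrict Ω), ∀ n, βh (p n x) ≤ βh (y0 x) ∧
      l n * b (l n) x ^ 2 ≤ (βh (y0 x)).toReal := by
    filter_upwards [hpx, hsub, ae_ne_top h hy0] with x hx h1 h2 n
    have h3 := ne_top_of_mem_subdiff (h1 n) h2
    have h4 := toReal_add_mul_le (h1 n) h3 h2
    rw [(hx n).2] at h4
    have h5 : b (l n) x * (y0 x - (y0 x - l n * b (l n) x)) = l n * b (l n) x ^ 2 := by ring
    rw [h5, ← (hx n).2] at h4
    have h6 : 0 ≤ l n * b (l n) x ^ 2 := mul_nonneg (hlpos n).le (sq_nonneg _)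
    refine ⟨(ENNReal.toReal_le_toReal h3 h2).1 (by linarith), ?_⟩
    linarith [ENNReal.toReal_nonneg (a := βh (p n x))]
  have hpfin : ∀ n, energy βh (p n) ≠ ∞ := fun n =>
    ((lintegral_mono_ae (hle.mono fun x hx => (hx n).1)).trans_lt hy0.lt_top).ne
  have hlim : ∀ᵐ x ∂(volume.restrict Ω), βh (y0 x) ≤ liminf (fun n => βh (p n x)) atTop := by
    filter_upwards [hpx, hle] with x hx h1
    have h2 : Tendsto (fun n => p n x) atTop (𝓝 (y0 x)) := by
      have h3 : Tendsto (fun n => l n * b (l n) x) atTop (𝓝 0) := by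
        have h4 : Tendsto (fun n => √(l n * (βh (y0 x)).toReal)) atTop (𝓝 0) := by
          have := (Real.continuous_sqrt.tendsto 0).comp
            (by simpa using hl0.mul_const (βh (y0 x)).toReal :
              Tendsto (fun n => l n * (βh (y0 x)).toReal) atTop (𝓝 0))
          rw [Real.sqrt_zero] at this
          exact this
        refine squeeze_zero_norm (fun n => ?_) h4
        rw [Real.norm_eq_abs]
        refine Real.abs_le_sqrt ?_
        have := mul_le_mul_of_nonneg_left (h1 n).2 (hlpos n).le
        nlinarith
      have := h3.const_sub (y0 x)
      rw [sub_zero] at this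
      exact this.congr fun n => ((hx n).2).symm
    refine le_of_forall_lt fun c hc => ?_
    obtain ⟨d, hd1, hd2⟩ := exists_between hc
    refine hd1.trans_le (le_liminf_of_le (by isBoundedDefault) ?_)
    exact (h2.eventually (h.lsc (y0 x) d hd2)).mono fun n hn => hn.le
  have hfatou : energy βh y0 ≤ liminf (fun n => energy βh (p n)) atTop :=
    (lintegral_mono_ae hlim).trans (lintegral_liminf_le' fun n => aemeasurable_comp h (p n))
  -- Otherwise every `p n` would have energy lower by `η` than the finite energy of `y0`, against
  -- lower semicontinuity and Fatou's lemma.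
  obtain ⟨n, hn⟩ : ∃ n, energy βh y0 ≤ energy βh (p n) + ENNReal.ofReal η := by
    by_contra hcon
    push Not at hcon
    have h1 : liminf (fun n => energy βh (p n)) atTop ≤ energy βh y0 - ENNReal.ofReal η := by
      refine (liminf_le_liminf (Eventually.of_forall fun n => ?_)).trans
        (liminf_const (f := (atTop : Filter ℕ)) _).le
      exact ENNReal.le_sub_of_add_le_right ENNReal.ofReal_ne_top (hcon n).le
    have h2 : energy βh y0 ≠ 0 := (bot_lt_of_lt (hcon 0)).ne'
    exact absurd (hfatou.trans h1) (not_le.2 (ENNReal.sub_lt_self hy0 h2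
      (ENNReal.ofReal_pos.2 hη).ne'))
  refine ⟨l n, hlm n, ?_⟩
  have h1 := energy_add_inner_le h (hpfin n) hq (hsub.mono fun x hx => hx n)
  have h2 : (energy βh y0).toReal ≤ (energy βh (p n)).toReal + η := by
    have := ENNReal.toReal_mono (ENNReal.add_ne_top.2 ⟨hpfin n, ENNReal.ofReal_ne_top⟩) hn
    rwa [ENNReal.toReal_add (hpfin n) ENNReal.ofReal_ne_top, ENNReal.toReal_ofReal hη.le] at this
  -- Replacing `p n` by `y0` in the subgradient inequality produces the term `l n ‖b‖²`, whose sign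
  -- is favourable.
  have h3 : q - p n = (q - y0) + l n • b (l n) := by simp only [hp]; abel
  rw [h3, inner_add_right, real_inner_smul_right, real_inner_self_eq_norm_sq] at h1
  have h4 : 0 ≤ l n * ‖b (l n)‖ ^ 2 := mul_nonneg (hlpos n).le (sq_nonneg _)
  linarith

/-- The superposition operator of a Lipschitz function. -/
theorem exists_superposition (hΩ : volume Ω ≠ ∞) {g : ℝ → ℝ} {L : ℝ≥0} (hg : LipschitzWith L g) :
    ∃ N : L2 Ω → L2 Ω, (∀ v : L2 Ω, N v =ᵐ[volume.restrict Ω] fun x => g (v x)) ∧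
      ∀ v w, ‖N v - N w‖ ≤ L * ‖v - w‖ := by
  have : IsFiniteMeasure (volume.restrict Ω) := ⟨by
    rw [Measure.restrict_apply_univ]; exact hΩ.lt_top⟩
  -- Composition preserves `L²` for Lipschitz functions vanishing at `0`; the constant `g 0` is
  -- added back as an element of `L²`, since `Ω` has finite measure.
  set g₀ : ℝ → ℝ := fun s => g s - g 0 with hg₀
  have hL : LipschitzWith L g₀ := LipschitzWith.of_dist_le_mul fun s t => by
    simp only [hg₀]
    rw [dist_sub_right]
    exact hg.dist_le_mul s t
  have hz : g₀ 0 = 0 := sub_self _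
  refine ⟨fun v => hL.compLp hz v + (memLp_const (g 0)).toLp, fun v => ?_, fun v w => ?_⟩
  · filter_upwards [Lp.coeFn_add (hL.compLp hz v) ((memLp_const (g 0)).toLp),
      hL.coeFn_compLp hz v, (memLp_const (μ := volume.restrict Ω) (p := 2) (g 0)).coeFn_toLp]
      with x h1 h2 h3
    rw [h1, Pi.add_apply, h2, h3]
    simp [hg₀]
  · rw [add_sub_add_right_eq_sub]
    exact hL.norm_compLp_sub_le hz v w

end Potential

open EigenSystem

/-! ### The product space carrying both time-derivative terms -/

section PhaseSpace

set_option linter.unusedSectionVars false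

variable {E H : Type*} [NormedAddCommGroup E] [InnerProductSpace ℝ E]
  [NormedAddCommGroup H] [InnerProductSpace ℝ H]

/-- The map `v ↦ (i v, √τ v)`. -/
def phaseMap (i : H →L[ℝ] E) (τ : ℝ) : H →L[ℝ] WithLp 2 (E × H) :=
  ((WithLp.prodContinuousLinearEquiv 2 ℝ E H).symm : (E × H) →L[ℝ] WithLp 2 (E × H)).comp
    (i.prod (√τ • ContinuousLinearMap.id ℝ H))

theorem phaseMap_apply (i : H →L[ℝ] E) (τ : ℝ) (v : H) :
    phaseMap i τ v = WithLp.toLp 2 (i v, √τ • v) := rfl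

theorem phaseMap_injective {i : H →L[ℝ] E} (hi : Function.Injective i) (τ : ℝ) :
    Function.Injective (phaseMap i τ) := fun v w h => by
  have := congrArg (fun p : WithLp 2 (E × H) => p.fst) h
  exact hi this

theorem norm_fst_le_toLp (a : E) (b : H) : ‖a‖ ≤ ‖WithLp.toLp 2 (a, b)‖ := by
  refine le_of_sq_le_sq ?_ (norm_nonneg _)
  rw [WithLp.prod_norm_sq_eq_of_L2]
  exact le_add_of_nonneg_right (sq_nonneg _)

theorem norm_snd_le_toLp (a : E) (b : H) : ‖b‖ ≤ ‖WithLp.toLp 2 (a, b)‖ := by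
  refine le_of_sq_le_sq ?_ (norm_nonneg _)
  rw [WithLp.prod_norm_sq_eq_of_L2]
  exact le_add_of_nonneg_left (sq_nonneg _)

/-- The factors `√τ` cancel when `τ > 0`. For `τ = 0` both are `0`, which is correct only because
then `w = 0`; the viscous and nonviscous cases thus share one formula. -/
theorem inner_toLp_phaseMap (i : H →L[ℝ] E) {τ : ℝ} (hτ : 0 ≤ τ) {a : E} {w : H}
    (hw : τ = 0 → w = 0) (v : H) :
    ⟪WithLp.toLp 2 (a, (√τ)⁻¹ • w), phaseMap i τ v⟫ = ⟪a, i v⟫ + ⟪w, v⟫ := by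
  rw [phaseMap_apply, WithLp.prod_inner_apply]
  change ⟪a, i v⟫ + ⟪(√τ)⁻¹ • w, √τ • v⟫ = _
  rw [real_inner_smul_left, real_inner_smul_right, ← mul_assoc]
  rcases hτ.eq_or_lt with h | h
  · rw [hw h.symm]; simp
  · rw [inv_mul_cancel₀ (Real.sqrt_pos.2 h).ne', one_mul]

variable [CompleteSpace E] [CompleteSpace H] {T : ℝ}

theorem memLp_toLp {ψ : ℝ → E} {w : ℝ → H} (hψ : MemLp ψ 2 (timeMeasure T))
    (hw : MemLp w 2 (timeMeasure T)) (c : ℝ) :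
    MemLp (fun t => WithLp.toLp 2 (ψ t, c • w t)) 2 (timeMeasure T) := by
  refine MemLp.of_le_mul (g := fun t => ‖ψ t‖ + ‖c • w t‖) (c := 1)
    (hψ.norm.add (hw.const_smul c).norm) ?_ (ae_of_all _ fun t => ?_)
  · exact (WithLp.prod_continuous_toLp 2 E H).comp_aestronglyMeasurable
      (hψ.1.prodMk (hw.1.const_smul c))
  · rw [one_mul, Real.norm_of_nonneg (by positivity)]
    refine le_of_sq_le_sq ?_ (by positivity)
    rw [WithLp.prod_norm_sq_eq_of_L2]
    change ‖ψ t‖ ^ 2 + ‖c • w t‖ ^ 2 ≤ _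
    nlinarith [norm_nonneg (ψ t), norm_nonneg (c • w t),
      mul_nonneg (norm_nonneg (ψ t)) (norm_nonneg (c • w t))]

/-- Only the dual component of `y` is known to be a primitive. The `H` component is checked after
applying the injective `i`, where `i w = τ ψ` and `τ / √τ = √τ`, also for `τ = 0`. -/
theorem phaseMap_eq_integral {i : H →L[ℝ] E} (hi : Function.Injective i) {τ : ℝ}
    {ψ : ℝ → E} {w : ℝ → H} (hψ : MemLp ψ 2 (timeMeasure T)) (hw : MemLp w 2 (timeMeasure T))
    (hiw : ∀ᵐ t ∂(timeMeasure T), i (w t) = τ • ψ t) {t : ℝ} (ht : t ∈ Icc 0 T) {d : H}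
    (hd : i d = ∫ s in (0 : ℝ)..t, ψ s) :
    phaseMap i τ d = ∫ s in (0 : ℝ)..t, WithLp.toLp 2 (ψ s, (√τ)⁻¹ • w s) := by
  have h0 : (0 : ℝ) ∈ Icc 0 T := ⟨le_rfl, ht.1.trans ht.2⟩
  have hG := intervalIntegrable_of_memLp (memLp_toLp hψ hw (√τ)⁻¹) h0 ht
  have h1 := (WithLp.fstL 2 ℝ E H).intervalIntegral_comp_comm hG
  have h2 := (WithLp.sndL 2 ℝ E H).intervalIntegral_comp_comm hG
  apply (WithLp.equiv 2 (E × H)).injective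
  refine Prod.ext ?_ ?_
  · exact hd.trans h1
  · refine Eq.trans ?_ h2
    apply hi
    change i (√τ • d) = i (∫ s in (0 : ℝ)..t, (√τ)⁻¹ • w s)
    have hI : IntervalIntegrable (fun s => (√τ)⁻¹ • w s) volume 0 t :=
      intervalIntegrable_of_memLp (hw.const_smul (√τ)⁻¹) h0 ht
    rw [← i.intervalIntegral_comp_comm hI,
      map_smul, hd, ← intervalIntegral.integral_smul]
    refine intervalIntegral.integral_congr_ae ?_
    rw [ae_restrict_iff' measurableSet_Ioo] at hiw
    have hT' : ∀ᵐ s : ℝ, s ≠ T := by simp [ae_iff, measure_singleton]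
    filter_upwards [hiw, hT'] with s hs hsT hsm
    rw [uIoc_of_le ht.1] at hsm
    rw [map_smul, hs ⟨hsm.1, lt_of_le_of_ne (hsm.2.trans ht.2) hsT⟩, smul_smul, ← div_eq_inv_mul,
      Real.div_sqrt]

theorem norm_integral_le {Y : Type*} [NormedAddCommGroup Y] [NormedSpace ℝ Y] {f : ℝ → Y}
    (hf : MemLp f 2 (timeMeasure T)) {R : ℝ} (hR : 0 ≤ R)
    (hfR : eLpNorm f 2 (timeMeasure T) ≤ ENNReal.ofReal R) {t : ℝ} (ht : t ∈ Icc 0 T) :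
    ‖∫ s in (0 : ℝ)..t, f s‖ ≤ √T * R := by
  have hT : 0 ≤ T := ht.1.trans ht.2
  have h1 : ‖∫ s in (0 : ℝ)..t, f s‖ₑ ≤ ∫⁻ s in Ioo 0 T, ‖f s‖ₑ := by
    rw [intervalIntegral.integral_of_le ht.1, integral_Ioc_eq_integral_Ioo]
    exact (enorm_integral_le_lintegral_enorm _).trans
      (lintegral_mono_set (Ioo_subset_Ioo_right ht.2))
  have h2 := sq_lintegral_le hf.1.enorm
  have h3 : ‖∫ s in (0 : ℝ)..t, f s‖ₑ ^ 2 ≤ ENNReal.ofReal ((√T * R) ^ 2) := by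
    calc _ ≤ (∫⁻ s in Ioo 0 T, ‖f s‖ₑ) ^ 2 := by gcongr
      _ ≤ _ := h2
      _ ≤ ENNReal.ofReal T * ENNReal.ofReal R ^ 2 := by
          gcongr
          · rw [Measure.restrict_apply_univ, Real.volume_Ioo, sub_zero]
          · exact lintegral_sq_le_iff.2 hfR
      _ = _ := by
          rw [← ENNReal.ofReal_pow hR, ← ENNReal.ofReal_mul hT, mul_pow, Real.sq_sqrt hT]
  rw [← ofReal_norm, ← ENNReal.ofReal_pow (norm_nonneg _),
    ENNReal.ofReal_le_ofReal_iff (by positivity)] at h3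
  exact le_of_sq_le_sq h3 (by positivity)

/-- Uniform bound for a function in `H¹(0,T)`. -/
theorem IsH1.norm_le {Y : Type*} [NormedAddCommGroup Y] [NormedSpace ℝ Y] {u du : ℝ → Y}
    (hu : IsH1 T u du) (hT : 0 < T) {R : ℝ} (hR : 0 ≤ R)
    (h1 : eLpNorm u 2 (timeMeasure T) ≤ ENNReal.ofReal R)
    (h2 : eLpNorm du 2 (timeMeasure T) ≤ ENNReal.ofReal R) {t : ℝ} (ht : t ∈ Icc 0 T) :
    ‖u t‖ ≤ (R + 1) / √T + 2 * (√T * R) := by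
  -- If `‖u‖` exceeded this value everywhere, its `L²` norm would be at least `R + 1`; the extra `1`
  -- makes the contradiction strict even for `R = 0`.
  have hs : ∃ s ∈ Ioo 0 T, ‖u s‖ ≤ (R + 1) / √T := by
    by_contra hcon
    push Not at hcon
    have h3 : ENNReal.ofReal ((R + 1) ^ 2) ≤ ENNReal.ofReal (R ^ 2) := by
      calc ENNReal.ofReal ((R + 1) ^ 2)
          = ∫⁻ s in Ioo 0 T, ENNReal.ofReal (((R + 1) / √T) ^ 2) := by
            rw [setLIntegral_const, Real.volume_Ioo, sub_zero, ← ENNReal.ofReal_mul (by positivity),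
              div_pow, Real.sq_sqrt hT.le, div_mul_cancel₀ _ hT.ne']
        _ ≤ ∫⁻ s in Ioo 0 T, ‖u s‖ₑ ^ 2 := by
            refine setLIntegral_mono' measurableSet_Ioo fun s hs => ?_
            rw [← ofReal_norm, ← ENNReal.ofReal_pow (norm_nonneg _)]
            have := (hcon s hs).le
            gcongr
        _ ≤ ENNReal.ofReal R ^ 2 := lintegral_sq_le_iff.2 h1
        _ = _ := by rw [ENNReal.ofReal_pow hR]
    rw [ENNReal.ofReal_le_ofReal_iff (by positivity)] at h3
    nlinarith
  obtain ⟨s, hs, hus⟩ := hs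
  have e1 := hu.eq_integral t ht
  have e2 := hu.eq_integral s (Ioo_subset_Icc_self hs)
  have e3 : u t = u s + (∫ x in (0 : ℝ)..t, du x) - ∫ x in (0 : ℝ)..s, du x := by
    rw [e1, e2]; abel
  rw [e3]
  have n1 := norm_integral_le hu.memLp_deriv hR h2 ht
  have n2 := norm_integral_le hu.memLp_deriv hR h2 (Ioo_subset_Icc_self hs)
  refine (norm_sub_le _ _).trans ?_
  have := norm_add_le (u s) (∫ x in (0 : ℝ)..t, du x)
  linarith

end PhaseSpace

open EigenSystem

/-! ### Estimates at fixed times -/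

section Estimates

variable {Ω : Set (EuclideanSpace ℝ (Fin 3))} {A B : L2 Ω →ₗ.[ℝ] L2 Ω}

/-- The system at a fixed time, in Hilbert space terms: `ψ` is the Riesz representative of `∂ₜy`,
`w` is `τ ∂ₜy`, `N` is the superposition operator of `πh'` and `k` spans the kernel of `A^r`. -/
structure GoodTime (SA : EigenSystem A) (SB : EigenSystem B) {r : ℝ} (hr : 0 < r) (σ τ : ℝ)
    (βh : ℝ → ℝ≥0∞) (N : L2 Ω → L2 Ω) (k : lp (fun _ : ℕ => ℝ) 2) (y0 : SB.GraphSpace σ)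
    (u : L2 Ω) (y : SB.GraphSpace σ) (ψ : lp (fun _ : ℕ => ℝ) 2) (w : L2 Ω)
    (μ : SA.EnergySpace r) : Prop where
  energy_ne_top : energy βh (GraphSpace.toH y) ≠ ∞
  riesz_eq : ψ = -(EnergySpace.coeffEquiv hr μ - ⟪k, EnergySpace.coeffEquiv hr μ⟫ • k)
  inner_kernel : ⟪k, SA.embed hr (GraphSpace.toH (y - y0))⟫ = 0
  viscous : τ = 0 → w = 0
  ineq : ∀ v : SB.GraphSpace σ, energy βh (GraphSpace.toH v) ≠ ∞ →
    ⟪w, GraphSpace.toH (y - v)⟫ + ⟪GraphSpace.op y, GraphSpace.op (y - v)⟫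
      + ⟪N (GraphSpace.toH y) - u, GraphSpace.toH (y - v)⟫ + (energy βh (GraphSpace.toH y)).toReal
    ≤ ⟪EnergySpace.toH μ, GraphSpace.toH (y - v)⟫ + (energy βh (GraphSpace.toH v)).toReal

variable {SA : EigenSystem A} {SB : EigenSystem B} {r σ τ : ℝ} {hr : 0 < r}
  {βh : ℝ → ℝ≥0∞} {πh : ℝ → ℝ} {N : L2 Ω → L2 Ω} {L : ℝ≥0} {k : lp (fun _ : ℕ => ℝ) 2}
  {y0 : SB.GraphSpace σ} {u u' : L2 Ω} {y y' : SB.GraphSpace σ} {ψ ψ' : lp (fun _ : ℕ => ℝ) 2}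
  {w w' : L2 Ω} {μ μ' : SA.EnergySpace r}

namespace GoodTime

/-- Trades the chemical potential for the time derivative. The uncontrolled coefficient of `μ` along
the kernel is seen only by those `d` that have a component there. -/
theorem inner_mu (h : GoodTime SA SB hr σ τ βh N k y0 u y ψ w μ) (d : L2 Ω) :
    ⟪EnergySpace.toH μ, d⟫ = -⟪ψ, SA.embed hr d⟫
      + ⟪k, EnergySpace.coeffEquiv hr μ⟫ * ⟪k, SA.embed hr d⟫ := by
  rw [h.riesz_eq, inner_neg_left, inner_sub_left, real_inner_smul_left,
    real_inner_comm (SA.embed hr d) (EnergySpace.coeffEquiv hr μ), SA.inner_embed,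
    real_inner_comm]
  ring

/-- The inequality for differences of two states. -/
theorem difference_le (hτ : 0 ≤ τ) (hN : ∀ v w, ‖N v - N w‖ ≤ L * ‖v - w‖) {C : ℝ}
    (hE : ∀ v : SB.GraphSpace σ, ‖GraphSpace.toH v‖ ^ 2
      ≤ 1 / (2 * (L + 1)) * ‖GraphSpace.op v‖ ^ 2 + C * ‖SA.embed hr (GraphSpace.toH v)‖ ^ 2)
    (hC : 0 ≤ C)
    (h : GoodTime SA SB hr σ τ βh N k y0 u y ψ w μ)
    (h' : GoodTime SA SB hr σ τ βh N k y0 u' y' ψ' w' μ') :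
    ⟪WithLp.toLp 2 (ψ, (√τ)⁻¹ • w) - WithLp.toLp 2 (ψ', (√τ)⁻¹ • w'),
        phaseMap (SA.embed hr) τ (GraphSpace.toH (y - y'))⟫ + 1 / 2 * ‖y - y'‖ ^ 2
      ≤ ((L + 1) * C + 1) * (‖phaseMap (SA.embed hr) τ (GraphSpace.toH (y - y'))‖ ^ 2
        + ‖u - u'‖ ^ 2) := by
  set d := y - y' with hd
  set D := GraphSpace.toH d with hD
  -- Each state is the test function of the other, so that the convex energies cancel on addition.
  have e1 := h.ineq y' h'.energy_ne_top
  have e2 := h'.ineq y h.energy_ne_top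
  have hneg : y' - y = -d := by rw [hd]; abel
  rw [← hd, ← hD] at e1
  rw [hneg, map_neg, map_neg, ← hD, inner_neg_right, inner_neg_right, inner_neg_right,
    inner_neg_right] at e2
  -- Both states have the kernel component of `y0`, so their difference has none.
  have hk : ⟪k, SA.embed hr D⟫ = 0 := by
    have : d = (y - y0) - (y' - y0) := by rw [hd]; abel
    rw [hD, this, map_sub, map_sub, inner_sub_right, h.inner_kernel, h'.inner_kernel, sub_zero]
  rw [h.inner_mu, hk, mul_zero, add_zero] at e1
  rw [h'.inner_mu, hk, mul_zero, add_zero] at e2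
  rw [inner_sub_left, inner_toLp_phaseMap _ hτ h.viscous, inner_toLp_phaseMap _ hτ h'.viscous]
  have e3 : ⟪GraphSpace.op y, GraphSpace.op d⟫ - ⟪GraphSpace.op y', GraphSpace.op d⟫
      = ‖GraphSpace.op d‖ ^ 2 := by
    rw [← inner_sub_left, ← map_sub, ← hd, real_inner_self_eq_norm_sq]
  have hDd : GraphSpace.toH y - GraphSpace.toH y' = D := by rw [← map_sub]
  have e4 : -(L * ‖D‖ ^ 2) ≤ ⟪N (GraphSpace.toH y) - N (GraphSpace.toH y'), D⟫ := by
    have h1 := neg_le_of_abs_le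
      (abs_real_inner_le_norm (N (GraphSpace.toH y) - N (GraphSpace.toH y')) D)
    have h2 := hN (GraphSpace.toH y) (GraphSpace.toH y')
    rw [hDd] at h2
    nlinarith [norm_nonneg D, mul_le_mul_of_nonneg_right h2 (norm_nonneg D)]
  have e5 := real_inner_le_norm (u - u') D
  rw [inner_sub_left] at e1 e2 e4 e5
  have e6 : ‖u - u'‖ * ‖D‖ ≤ 1 / 2 * ‖u - u'‖ ^ 2 + 1 / 2 * ‖D‖ ^ 2 := by
    nlinarith [sq_nonneg (‖u - u'‖ - ‖D‖)]
  have e7 := hE d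
  rw [← hD] at e7
  have hL : (0 : ℝ) < L + 1 := by positivity
  have e8 : (L + 1) * ‖D‖ ^ 2 ≤ 1 / 2 * ‖GraphSpace.op d‖ ^ 2
      + (L + 1) * C * ‖SA.embed hr D‖ ^ 2 := by
    have := mul_le_mul_of_nonneg_left e7 hL.le
    calc _ ≤ _ := this
      _ = _ := by field_simp
  have e9 : ‖SA.embed hr D‖ ^ 2 ≤ ‖phaseMap (SA.embed hr) τ D‖ ^ 2 := by
    have := norm_fst_le_toLp (SA.embed hr D) (√τ • D)
    rw [phaseMap_apply]
    gcongr
  have e10 : (L + 1) * C * ‖SA.embed hr D‖ ^ 2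
      ≤ (L + 1) * C * ‖phaseMap (SA.embed hr) τ D‖ ^ 2 := by gcongr
  have e11 : 0 ≤ (L + 1) * C * ‖u - u'‖ ^ 2 := by positivity
  rw [GraphSpace.norm_sq, ← hD]
  nlinarith [sq_nonneg ‖phaseMap (SA.embed hr) τ D‖, sq_nonneg ‖u - u'‖]

/-- The inequality for the difference from the initial state, given an approximate subgradient
`b` of the convex part at the initial state. -/
theorem initial_le (hτ : 0 ≤ τ) (hN : ∀ v w, ‖N v - N w‖ ≤ L * ‖v - w‖) {C : ℝ}
    (hE : ∀ v : SB.GraphSpace σ, ‖GraphSpace.toH v‖ ^ 2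
      ≤ 1 / (2 * (L + 1)) * ‖GraphSpace.op v‖ ^ 2 + C * ‖SA.embed hr (GraphSpace.toH v)‖ ^ 2)
    (hC : 0 ≤ C) {x0 : SB.GraphSpace (2 * σ)} (hx0 : y0 = GraphSpace.ofTwoMul x0)
    (h0 : energy βh (GraphSpace.toH x0) ≠ ∞)
    (h : GoodTime SA SB hr σ τ βh N k y0 u y ψ w μ) {b : L2 Ω} {η M : ℝ}
    (hb : (energy βh (GraphSpace.toH x0)).toReal + ⟪b, GraphSpace.toH y - GraphSpace.toH x0⟫
      ≤ (energy βh (GraphSpace.toH y)).toReal + η)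
    (hM : -⟪GraphSpace.op x0 + b + N (GraphSpace.toH x0) - u, GraphSpace.toH (y - y0)⟫
      ≤ M * ‖phaseMap (SA.embed hr) τ (GraphSpace.toH (y - y0))‖) :
    ⟪WithLp.toLp 2 (ψ, (√τ)⁻¹ • w), phaseMap (SA.embed hr) τ (GraphSpace.toH (y - y0))⟫
      ≤ ((L + 1) * C + 1) * ‖phaseMap (SA.embed hr) τ (GraphSpace.toH (y - y0))‖ ^ 2
        + M * ‖phaseMap (SA.embed hr) τ (GraphSpace.toH (y - y0))‖ + η := by
  have hx : GraphSpace.toH y0 = GraphSpace.toH x0 := by rw [hx0, GraphSpace.toH_ofTwoMul]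
  set d := y - y0 with hd
  set D := GraphSpace.toH d with hD
  have e1 := h.ineq y0 (by rwa [hx])
  rw [← hd, ← hD, h.inner_mu, show ⟪k, SA.embed hr D⟫ = 0 from h.inner_kernel, mul_zero, add_zero,
    hx] at e1
  rw [inner_toLp_phaseMap _ hτ h.viscous]
  have hDd : GraphSpace.toH y - GraphSpace.toH x0 = D := by rw [hD, hd, map_sub, hx]
  rw [hDd] at hb
  -- Splitting `y = d + y0` isolates the coercive term, and the remainder is an inner product in `H`
  -- with `B^(2σ) y0`.
  have e3 : ⟪GraphSpace.op y, GraphSpace.op d⟫ = ‖GraphSpace.op d‖ ^ 2 + ⟪GraphSpace.op x0, D⟫ := by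
    have : y = d + y0 := by rw [hd]; abel
    rw [this, map_add, inner_add_left, real_inner_self_eq_norm_sq, hx0, GraphSpace.inner_op_ofTwoMul]
  have e4 : -(L * ‖D‖ ^ 2) ≤ ⟪N (GraphSpace.toH y) - N (GraphSpace.toH x0), D⟫ := by
    have h1 := neg_le_of_abs_le
      (abs_real_inner_le_norm (N (GraphSpace.toH y) - N (GraphSpace.toH x0)) D)
    have h2 := hN (GraphSpace.toH y) (GraphSpace.toH x0)
    rw [hDd] at h2
    nlinarith [norm_nonneg D, mul_le_mul_of_nonneg_right h2 (norm_nonneg D)]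
  rw [inner_sub_left] at e1 e4
  rw [inner_sub_left, inner_add_left, inner_add_left] at hM
  have e7 := hE d
  rw [← hD] at e7
  have hL : (0 : ℝ) < L + 1 := by positivity
  have e8 : (L + 1) * ‖D‖ ^ 2 ≤ 1 / 2 * ‖GraphSpace.op d‖ ^ 2
      + (L + 1) * C * ‖SA.embed hr D‖ ^ 2 := by
    have := mul_le_mul_of_nonneg_left e7 hL.le
    calc _ ≤ _ := this
      _ = _ := by field_simp
  have e9 : ‖SA.embed hr D‖ ^ 2 ≤ ‖phaseMap (SA.embed hr) τ D‖ ^ 2 := by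
    have := norm_fst_le_toLp (SA.embed hr D) (√τ • D)
    rw [phaseMap_apply]
    gcongr
  have e10 : (L + 1) * C * ‖SA.embed hr D‖ ^ 2
      ≤ (L + 1) * C * ‖phaseMap (SA.embed hr) τ D‖ ^ 2 := by gcongr
  nlinarith [sq_nonneg ‖phaseMap (SA.embed hr) τ D‖, sq_nonneg ‖D‖, sq_nonneg ‖GraphSpace.op d‖]

/-- The bound for the component of the chemical potential along the kernel of `A^r`, obtained by
testing with `v`. -/
theorem kernel_component_le (h : GoodTime SA SB hr σ τ βh N k y0 u y ψ w μ)
    {v : SB.GraphSpace σ} {K Ky Kv Ku Kw Ke : ℝ}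
    (hv : (energy βh (GraphSpace.toH v)) ≤ ENNReal.ofReal Ke) (hKe : 0 ≤ Ke)
    (hvn : ‖v‖ ≤ Kv) (hy : ‖y‖ ≤ Ky) (hu : ‖N (GraphSpace.toH y) - u‖ ≤ Ku) (hw : ‖w‖ ≤ Kw)
    (hψ : ‖ψ‖ ≤ K) :
    ⟪k, EnergySpace.coeffEquiv hr μ⟫ * ⟪k, SA.embed hr (GraphSpace.toH (v - y0))⟫
      ≤ Ke + (Kw + Ky + Ku + K * ‖SA.embed hr‖) * (Ky + Kv) := by
  have hvt : energy βh (GraphSpace.toH v) ≠ ∞ := (hv.trans_lt ENNReal.ofReal_lt_top).ne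
  have e1 := h.ineq v hvt
  have hE : (energy βh (GraphSpace.toH v)).toReal ≤ Ke := ENNReal.toReal_le_of_le_ofReal hKe hv
  set d := y - v with hd
  set D := GraphSpace.toH d with hD
  -- The kernel component of `y - y0` vanishes, so only the test function retains the unknown
  -- coefficient; all other terms are bounded, and the energy of `y` is nonnegative.
  have hk : ⟪k, SA.embed hr D⟫ = -⟪k, SA.embed hr (GraphSpace.toH (v - y0))⟫ := by
    have : d = (y - y0) - (v - y0) := by rw [hd]; abel
    rw [hD, this, map_sub, map_sub, inner_sub_right, h.inner_kernel, zero_sub]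
  rw [h.inner_mu, hk] at e1
  have hdn : ‖d‖ ≤ Ky + Kv := (norm_sub_le _ _).trans (add_le_add hy hvn)
  have hDn : ‖D‖ ≤ Ky + Kv := (GraphSpace.norm_toH_le d).trans hdn
  have hon : ‖GraphSpace.op d‖ ≤ Ky + Kv := (GraphSpace.norm_op_le d).trans hdn
  have hoy : ‖GraphSpace.op y‖ ≤ Ky := (GraphSpace.norm_op_le y).trans hy
  have key : ∀ {F : Type} [NormedAddCommGroup F] [InnerProductSpace ℝ F] (a b : F) (p q : ℝ),
      ‖a‖ ≤ p → ‖b‖ ≤ q → -(p * q) ≤ ⟪a, b⟫ := fun a b p q ha hb =>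
    neg_le_of_abs_le ((abs_real_inner_le_norm a b).trans
      (mul_le_mul ha hb (norm_nonneg _) ((norm_nonneg _).trans ha)))
  have i1 := key _ _ _ _ hw hDn
  have i2 := key _ _ _ _ hoy hon
  have i3 := key _ _ _ _ hu hDn
  have hi : ‖SA.embed hr D‖ ≤ ‖SA.embed hr‖ * (Ky + Kv) :=
    ((SA.embed hr).le_opNorm D).trans (by gcongr)
  have i4 := key _ _ _ _ hψ hi
  have i5 : 0 ≤ (energy βh (GraphSpace.toH y)).toReal := ENNReal.toReal_nonneg
  nlinarith

end GoodTime

end Estimates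

open EigenSystem

/-! ### From the weak formulation to almost every time; the kernel component -/

section Assembly

theorem ne_top_and_toReal_add_le {a b : ℝ} {p q : ℝ≥0∞}
    (h : (a : EReal) + (p : EReal) ≤ (b : EReal) + (q : EReal)) (hq : q ≠ ∞) :
    p ≠ ∞ ∧ a + p.toReal ≤ b + q.toReal := by
  rw [← EReal.coe_ennreal_toReal hq] at h
  have hp : p ≠ ∞ := by
    intro hp
    rw [hp, EReal.coe_ennreal_top, EReal.coe_add_top, top_le_iff] at h
    exact EReal.coe_ne_top (b + q.toReal) (by exact_mod_cast h)
  rw [← EReal.coe_ennreal_toReal hp] at h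
  exact ⟨hp, by exact_mod_cast h⟩

variable {Ω : Set (EuclideanSpace ℝ (Fin 3))} {A B : L2 Ω →ₗ.[ℝ] L2 Ω}
  {SA : EigenSystem A} {SB : EigenSystem B} {r σ τ T : ℝ}
  {βh : ℝ → ℝ≥0∞} {πh : ℝ → ℝ} {N : L2 Ω → L2 Ω} {k : lp (fun _ : ℕ => ℝ) 2}

/-- A solution satisfies the system in Hilbert space terms at almost every time. -/
theorem IsSolution.ae_goodTime (hr : 0 < r) (hT : 0 < T)
    (hN : ∀ v : L2 Ω, N v =ᵐ[volume.restrict Ω] fun x => deriv πh (v x))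
    (hk1 : k = 0 ∨ ‖k‖ = 1)
    (hk : ∀ v w : SA.EnergySpace r, ⟪EnergySpace.op v, EnergySpace.op w⟫
      = ⟪EnergySpace.coeffEquiv hr v, EnergySpace.coeffEquiv hr w⟫
        - ⟪k, EnergySpace.coeffEquiv hr v⟫ * ⟪k, EnergySpace.coeffEquiv hr w⟫)
    {u : ℝ → L2 Ω} {y0 : SB.GraphSpace σ} (h0 : energy βh (GraphSpace.toH y0) ≠ ∞)
    {y : ℝ → SB.GraphSpace σ} {dy : ℝ → SA.DualSpace r} {μ : ℝ → SA.EnergySpace r}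
    (hsol : IsSolution SA SB r σ τ T βh πh u (GraphSpace.toH y0) y dy μ) :
    ∃ w : ℝ → L2 Ω, MemLp w 2 (timeMeasure T) ∧
      (∀ᵐ t ∂(timeMeasure T), SA.embed hr (w t) = τ • SA.riesz hr (dy t)) ∧
      ∀ᵐ t ∂(timeMeasure T),
        GoodTime SA SB hr σ τ βh N k y0 (u t) (y t) (SA.riesz hr (dy t)) (w t) (μ t) ∧
        SA.embed hr (GraphSpace.toH (y t - y0)) = ∫ s in (0 : ℝ)..t, SA.riesz hr (dy s) := by
  obtain ⟨w, hw, hwr, hvi⟩ := hsol.second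
  obtain ⟨Y, hY0, hY, hYt⟩ := hsol.y_eq_integral
  have hψ : MemLp (fun t => SA.riesz hr (dy t)) 2 (timeMeasure T) :=
    (SA.riesz hr).toContinuousLinearMap.comp_memLp' hsol.dy_memLp
  have hembed : ∀ᵐ t ∂(timeMeasure T), SA.embed hr (w t) = τ • SA.riesz hr (dy t) := by
    filter_upwards [hwr] with t ht
    rw [← (SA.represents_iff hr).1 ht, map_smul]
  have hriesz : ∀ᵐ t ∂(timeMeasure T), SA.riesz hr (dy t)
      = -(EnergySpace.coeffEquiv hr (μ t) - ⟪k, EnergySpace.coeffEquiv hr (μ t)⟫ • k) := by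
    filter_upwards [hsol.first] with t ht
    refine SA.eq_of_inner_coeffEquiv hr fun v => ?_
    rw [SA.inner_riesz, inner_neg_left, inner_sub_left, real_inner_smul_left, ← hk]
    linarith [ht v]
  -- The derivative is orthogonal to `k`, since `k` is zero or a unit vector. Integrated in time,
  -- this is conservation of the mean.
  have hkr : ∀ᵐ t ∂(timeMeasure T), ⟪k, SA.riesz hr (dy t)⟫ = 0 := by
    filter_upwards [hriesz] with t ht
    rw [ht, inner_neg_right, inner_sub_right, real_inner_smul_right, real_inner_self_eq_norm_sq]
    rcases hk1 with h | h
    · simp [h]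
    · rw [h]; ring
  refine ⟨w, hw, hembed, ?_⟩
  filter_upwards [hembed, hriesz, hYt, hvi, ae_restrict_mem measurableSet_Ioo]
    with t h1 h2 h3 h4 htm
  have htm' := Ioo_subset_Icc_self htm
  have hm0 : (0 : ℝ) ∈ Icc 0 T := ⟨le_rfl, hT.le⟩
  have hint : SA.embed hr (GraphSpace.toH (y t - y0)) = ∫ s in (0 : ℝ)..t, SA.riesz hr (dy s) := by
    rw [map_sub, map_sub, ← (SA.represents_iff hr).1 h3, ← (SA.represents_iff hr).1 hY0,
      hY t htm', map_add, add_sub_cancel_left]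
    exact ((SA.riesz hr).toContinuousLinearMap.intervalIntegral_comp_comm
      (intervalIntegrable_of_memLp hsol.dy_memLp hm0 htm')).symm
  refine ⟨⟨?_, h2, ?_, fun hτ => ?_, fun v hv => ?_⟩, hint⟩
  -- The test function `y0` has finite energy, which forces the energy of `y t` to be finite.
  · exact (ne_top_and_toReal_add_le (h4 y0) h0).1
  · rw [hint]
    have hc := (innerSL ℝ k).intervalIntegral_comp_comm
      (intervalIntegrable_of_memLp hψ hm0 htm')
    rw [← innerSL_apply_apply ℝ, ← hc]
    refine intervalIntegral.integral_zero_ae ?_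
    rw [ae_restrict_iff' measurableSet_Ioo] at hkr
    filter_upwards [hkr] with s hs hsm
    rw [uIoc_of_le htm.1.le] at hsm
    exact hs ⟨hsm.1, hsm.2.trans_lt htm.2⟩
  · apply SA.embed_injective hr
    rw [h1, hτ, zero_smul, map_zero]
  · have h5 := (ne_top_and_toReal_add_le (h4 v) hv).2
    have h6 : ∫ x in Ω, (deriv πh (GraphSpace.toH (y t) x) - u t x) * GraphSpace.toH (y t - v) x
        = ⟪N (GraphSpace.toH (y t)) - u t, GraphSpace.toH (y t - v)⟫ := by
      rw [inner_eq_integral]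
      refine integral_congr_ae ?_
      filter_upwards [hN (GraphSpace.toH (y t)), Lp.coeFn_sub (N (GraphSpace.toH (y t))) (u t)]
        with x e1 e2
      rw [e2, Pi.sub_apply, e1]
    rw [h6] at h5
    exact h5

/-- Integrals against a constant normalized function. -/
theorem average_eq_of_constant (hΩ : volume Ω ≠ ∞) {e : L2 Ω} {c : ℝ}
    (he : e =ᵐ[volume.restrict Ω] fun _ => c) (he1 : ‖e‖ = 1) :
    c ≠ 0 ∧ ∀ v : L2 Ω, ⨍ x in Ω, v x = c * ⟪e, v⟫ := by
  have hfin : IsFiniteMeasure (volume.restrict Ω) := ⟨by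
    rw [Measure.restrict_apply_univ]; exact hΩ.lt_top⟩
  have h1 : ∀ v : L2 Ω, ⟪e, v⟫ = c * ∫ x in Ω, v x := fun v => by
    rw [inner_eq_integral, ← integral_const_mul]
    refine integral_congr_ae ?_
    filter_upwards [he] with x hx
    rw [hx]
  -- Normalization reads `c² |Ω| = 1`, which expresses the mean value through the inner product with
  -- the eigenvector.
  have h2 : c * (c * volume.real Ω) = 1 := by
    have h3 := h1 e
    rw [real_inner_self_eq_norm_sq, he1, integral_congr_ae he, integral_const, smul_eq_mul,
      measureReal_restrict_apply_univ] at h3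
    linarith
  have hc : c ≠ 0 := fun h => by simp [h] at h2
  refine ⟨hc, fun v => ?_⟩
  have h4 : (volume.real Ω)⁻¹ = c * c := by
    refine inv_eq_of_mul_eq_one_right ?_
    linarith
  rw [setAverage_eq, smul_eq_mul, h4, h1]
  ring

/-- The bound for the component of the chemical potential along the kernel of `A^r`. -/
theorem exists_kernel_bound (hΩ : volume Ω ≠ ∞) (hr : 0 < r)
    (hvec : ∃ c : ℝ, SA.vec 0 =ᵐ[volume.restrict Ω] fun _ => c)
    (hconst : ∀ (c : ℝ) (v : L2 Ω), (v =ᵐ[volume.restrict Ω] fun _ => c) → v ∈ SB.domPow σ)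
    (hk : ∀ w : L2 Ω, ⟪k, SA.embed hr w⟫ = ⟪SA.vec 0, w⟫) (h0 : βh 0 = 0) {R δ : ℝ} (hδ : 0 < δ)
    {K Ky Ku Kw : ℝ} :
    ∃ Ka : ℝ, ∀ y0 : SB.GraphSpace σ, ‖GraphSpace.toH y0‖ ≤ R →
      Icc ((⨍ x in Ω, GraphSpace.toH y0 x) - δ) ((⨍ x in Ω, GraphSpace.toH y0 x) + δ)
        ⊆ subdiffDom βh →
      ∀ u y ψ w (μ : SA.EnergySpace r), GoodTime SA SB hr σ τ βh N k y0 u y ψ w μ →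
        ‖y‖ ≤ Ky → ‖N (GraphSpace.toH y) - u‖ ≤ Ku → ‖w‖ ≤ Kw → ‖ψ‖ ≤ K →
        |⟪k, EnergySpace.coeffEquiv hr μ⟫| ≤ Ka := by
  obtain ⟨c, hc⟩ := hvec
  obtain ⟨hc0, hav⟩ := average_eq_of_constant hΩ hc (SA.orthonormal.1 0)
  obtain ⟨M, hM, hgrid⟩ := exists_grid_bound h0 hδ (|c| * R)
  set e : SB.GraphSpace σ := ⟨SA.vec 0, hconst c _ hc⟩ with he
  have heH : GraphSpace.toH e = SA.vec 0 := GraphSpace.toH_mk _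
  set Kv : ℝ := (|c| * R + δ) * |c|⁻¹ * ‖e‖ with hKv
  set Ke : ℝ := M * volume.real Ω with hKe
  set Q : ℝ := Ke + (Kw + Ky + Ku + K * ‖SA.embed hr‖) * (Ky + Kv) with hQ
  refine ⟨Q * |c| * (δ / 2)⁻¹, fun y0 hy0 hsub u y ψ w μ hg hy hu hw hψ => ?_⟩
  set m := ⨍ x in Ω, GraphSpace.toH y0 x with hm
  have hm' : m = c * ⟪SA.vec 0, GraphSpace.toH y0⟫ := hav _
  have hmR : |m| ≤ |c| * R := by
    rw [hm', abs_mul]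
    gcongr
    refine (abs_real_inner_le_norm _ _).trans ?_
    rw [SA.orthonormal.1 0, one_mul]
    exact hy0
  set a := ⟪k, EnergySpace.coeffEquiv hr μ⟫ with ha
  -- The test function is the constant `g`, written as `g / c` times the eigenvector, so that its
  -- kernel component relative to `y0` is `(g - m) / c`.
  have key : ∀ g : ℝ, |g| ≤ |c| * R + δ → βh g ≤ ENNReal.ofReal M → a / c * (g - m) ≤ Q := by
    intro g hgR hgM
    set v : SB.GraphSpace σ := (g / c) • e with hv
    have hvH : GraphSpace.toH v = (g / c) • SA.vec 0 := by rw [hv, map_smul, heH]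
    have hvc : (GraphSpace.toH v : L2 Ω) =ᵐ[volume.restrict Ω] fun _ => g := by
      rw [hvH]
      filter_upwards [hc, Lp.coeFn_smul (g / c) (SA.vec 0)] with x h1 h2
      rw [h2, Pi.smul_apply, h1, smul_eq_mul, div_mul_cancel₀ _ hc0]
    have hve : energy βh (GraphSpace.toH v) ≤ ENNReal.ofReal Ke := by
      have : energy βh (GraphSpace.toH v) = ∫⁻ _ in Ω, βh g :=
        lintegral_congr_ae (hvc.mono fun x hx => congrArg βh hx)
      rw [this, setLIntegral_const, hKe, ENNReal.ofReal_mul hM, measureReal_def,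
        ENNReal.ofReal_toReal hΩ]
      gcongr
    have hvn : ‖v‖ ≤ Kv := by
      rw [hv, norm_smul, Real.norm_eq_abs, abs_div, hKv, div_eq_mul_inv]
      gcongr
    have h1 := hg.kernel_component_le hve (by positivity) hvn hy hu hw hψ
    rw [hk, map_sub, inner_sub_right, hvH, real_inner_smul_right, real_inner_self_eq_norm_sq,
      SA.orthonormal.1 0, one_pow, mul_one] at h1
    have h2 : ⟪SA.vec 0, GraphSpace.toH y0⟫ = m / c := by
      rw [hm', mul_div_cancel_left₀ _ hc0]
    rw [h2, ← ha] at h1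
    calc a / c * (g - m) = a * (g / c - m / c) := by ring
      _ ≤ Q := h1
  have hmb := abs_le.1 hmR
  -- One constant above and one below the mean, each at distance at least `δ/2`, bound the
  -- coefficient from both sides.
  obtain ⟨⟨g₁, hg₁, hb₁⟩, g₂, hg₂, hb₂⟩ := hgrid m hmR hsub
  have k1 := key g₁ (abs_le.2 ⟨by linarith [hg₁.1], by linarith [hg₁.2]⟩) hb₁
  have k2 := key g₂ (abs_le.2 ⟨by linarith [hg₂.1], by linarith [hg₂.2]⟩) hb₂
  have h3 : |a / c| * (δ / 2) ≤ Q := by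
    rcases le_total 0 (a / c) with h | h
    · rw [abs_of_nonneg h]
      have := mul_le_mul_of_nonneg_left (by linarith [hg₁.1] : δ / 2 ≤ g₁ - m) h
      linarith
    · rw [abs_of_nonpos h]
      have := mul_le_mul_of_nonneg_left (by linarith [hg₂.2] : δ / 2 ≤ m - g₂) (neg_nonneg.2 h)
      nlinarith
  rw [abs_div, div_mul_eq_mul_div, div_le_iff₀ (abs_pos.2 hc0)] at h3
  rw [← div_eq_mul_inv, le_div_iff₀ (by positivity)]
  exact h3

end Assembly

end FracCH

end

/-! ### The regularity theorem -/

set_option maxHeartbeats 1000000 in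
open FracCH EigenSystem in
theorem theorem2p2
    (Ω : Set (EuclideanSpace ℝ (Fin 3))) (hΩo : IsOpen Ω) (hΩb : Bornology.IsBounded Ω)
    (hΩc : IsConnected Ω)
    (A B : L2 Ω →ₗ.[ℝ] L2 Ω) (hA : IsAdmissibleOperator A) (hB : IsAdmissibleOperator B)
    (SA : EigenSystem A) (SB : EigenSystem B)
    (r σ : ℝ) (hr : 0 < r) (hσ : 0 < σ)
    -- either the first eigenvalue of `A` is positive, or it is zero and simple with a constant
    -- eigenfunction, and then the constants belong to `D(B^σ)`
    (hsimple : 0 < SA.lam 0 ∨ (SA.lam 0 = 0 ∧ 0 < SA.lam 1 ∧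
      ∃ c : ℝ, SA.vec 0 =ᵐ[volume.restrict Ω] fun _ => c))
    (hconst : SA.lam 0 = 0 → ∀ (c : ℝ) (v : L2 Ω), (v =ᵐ[volume.restrict Ω] fun _ => c) →
      v ∈ SB.domPow σ)
    (τ : ℝ) (hτ : 0 ≤ τ)
    (βh : ℝ → ℝ≥0∞) (πh : ℝ → ℝ) (hpot : IsAdmissiblePotential βh πh)
    (T : ℝ) (hT : 0 < T)
    -- a bound for the norms of the data, the width of an interval around the mean value, and the
    -- bound for the initial chemical potential if `τ = 0`
    (R δ₀ M₀ : ℝ) (hδ₀ : 0 < δ₀) :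
    ∃ K₃ : ℝ, ∀ (u du : ℝ → L2 Ω) (y0 : SB.GraphSpace (2 * σ)),
      IsH1 T u du →
      eLpNorm u 2 (timeMeasure T) ≤ ENNReal.ofReal R →
      eLpNorm du 2 (timeMeasure T) ≤ ENNReal.ofReal R →
      ‖y0‖ ≤ R →
      energy βh (GraphSpace.toH y0) ≤ ENNReal.ofReal R →
      (SA.lam 0 = 0 →
        Icc ((⨍ x in Ω, GraphSpace.toH y0 x) - δ₀) ((⨍ x in Ω, GraphSpace.toH y0 x) + δ₀)
          ⊆ subdiffDom βh) →
      (0 < τ → ViscousData βh (GraphSpace.toH y0) R) →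
      (τ = 0 → NonviscousData SA SB r σ βh πh u y0 M₀) →
      ∀ (y : ℝ → SB.GraphSpace σ) (dy : ℝ → SA.DualSpace r) (μ : ℝ → SA.EnergySpace r),
        IsSolution SA SB r σ τ T βh πh u (GraphSpace.toH y0) y dy μ →
        MemLp dy ∞ (timeMeasure T) ∧ MemLp μ ∞ (timeMeasure T) ∧
        ∃ z : ℝ → SB.GraphSpace σ,
          (∀ᵐ t ∂(timeMeasure T), SA.Represents (dy t) (GraphSpace.toH (z t))) ∧
          MemLp z 2 (timeMeasure T) ∧
          (0 < τ → MemLp (fun t => GraphSpace.toH (z t)) ∞ (timeMeasure T)) ∧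
          (0 < τ → ∃ m : ℝ → SA.EnergySpace (2 * r),
            (∀ᵐ t ∂(timeMeasure T), EnergySpace.toH (m t) = EnergySpace.toH (μ t)) ∧
            MemLp m ∞ (timeMeasure T)) ∧
          ∃ n : ℝ → SA.EnergySpace (2 * r),
            (∀ᵐ t ∂(timeMeasure T), EnergySpace.toH (n t) = √τ • EnergySpace.toH (μ t)) ∧
            eLpNorm dy ∞ (timeMeasure T) + eLpNorm z 2 (timeMeasure T)
              + eLpNorm μ ∞ (timeMeasure T)
              + eLpNorm (fun t => √τ • GraphSpace.toH (z t)) ∞ (timeMeasure T)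
              + eLpNorm n ∞ (timeMeasure T) ≤ ENNReal.ofReal K₃ := by
  -- A negative `R` admits no data, because `‖y0‖ ≤ R` fails.
  by_cases hR : 0 ≤ R
  swap
  · exact ⟨0, fun u du y0 _ _ _ h => absurd ((norm_nonneg y0).trans h) hR⟩
  have hΩ : volume Ω ≠ ∞ := hΩb.measure_lt_top.ne
  have hsimple' : 0 < SA.lam 0 ∨ SA.lam 0 = 0 ∧ 0 < SA.lam 1 := hsimple.imp_right fun h =>
    ⟨h.1, h.2.1⟩
  -- Gives access to the separability of `L²(Ω)`, required for the measurability of the derivative.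
  have : Fact ((2 : ℝ≥0∞) ≠ ∞) := ⟨by simp⟩
  have hr2 : 0 < 2 * r := by positivity
  obtain ⟨L, hL⟩ := hpot.lipschitz
  obtain ⟨N, hNae, hN⟩ := exists_superposition hΩ hL
  obtain ⟨k, hk0, hk1, hkembed, hkop⟩ := SA.exists_kernel_vector hsimple' hr
  have hkn : k = 0 ∨ ‖k‖ = 1 := by
    by_cases h : SA.lam 0 = 0
    · exact Or.inr (hk1 h)
    · exact Or.inl (hk0 h)
  have hinj := SA.embed_injective hr
  obtain ⟨C, hC, hE⟩ := GraphSpace.ehrling (S := SB) (SA.embed hr) hinj hσ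
    (ε := 1 / (2 * ((L : ℝ) + 1))) (by positivity)
  obtain ⟨CA, hCA⟩ := EnergySpace.exists_norm_toH_le (S := SA) hr
  set Cu : ℝ := (R + 1) / √T + 2 * (√T * R) with hCu
  have hCu0 : 0 ≤ Cu := by positivity
  set M' : ℝ := R + R + (‖N 0‖ + L * R) + Cu with hM'
  -- One constant for both cases: the first summand serves `τ > 0`, and for `τ = 0` it vanishes
  -- because `(√0)⁻¹ = 0`.
  set M : ℝ := (√τ)⁻¹ * M' + |M₀| with hM
  have hM0 : 0 ≤ M := by positivity
  have hN0 : ∀ v, ‖N v‖ ≤ ‖N 0‖ + L * ‖v‖ := fun v => by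
    have h1 := hN v 0
    rw [sub_zero] at h1
    have h2 := norm_sub_norm_le (N v) (N 0)
    linarith
  set J : L2 Ω →L[ℝ] WithLp 2 (lp (fun _ : ℕ => ℝ) 2 × L2 Ω) := phaseMap (SA.embed hr) τ with hJ
  set j : SB.GraphSpace σ →L[ℝ] WithLp 2 (lp (fun _ : ℕ => ℝ) 2 × L2 Ω) :=
    J.comp GraphSpace.toHL with hj
  have hja : ∀ v, j v = J (GraphSpace.toH v) := fun v => rfl
  have hjinj : Function.Injective j :=
    (phaseMap_injective hinj τ).comp GraphSpace.toH_injective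
  obtain ⟨K, hK, hcore⟩ := exists_derivative_of_difference_inequality (U := L2 Ω) j hjinj hT
    (C := (L + 1) * C + 1) (M := M) (R := R) (by positivity) hM0 hR
  set Ky : ℝ := 2 * R + √T * K with hKy
  have hKy0 : 0 ≤ Ky := by positivity
  set Ku : ℝ := ‖N 0‖ + L * Ky + Cu with hKu
  obtain ⟨Ka, hKa⟩ : ∃ Ka : ℝ, ∀ y0 : SB.GraphSpace σ, ‖GraphSpace.toH y0‖ ≤ R →
      (SA.lam 0 = 0 → Icc ((⨍ x in Ω, GraphSpace.toH y0 x) - δ₀)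
        ((⨍ x in Ω, GraphSpace.toH y0 x) + δ₀) ⊆ subdiffDom βh) →
      ∀ u y ψ w (μ : SA.EnergySpace r), GoodTime SA SB hr σ τ βh N k y0 u y ψ w μ →
        ‖y‖ ≤ Ky → ‖N (GraphSpace.toH y) - u‖ ≤ Ku → ‖w‖ ≤ √τ * K → ‖ψ‖ ≤ K →
        |⟪k, EnergySpace.coeffEquiv hr μ⟫| ≤ Ka := by
    by_cases h : SA.lam 0 = 0
    · obtain ⟨-, -, hvec⟩ := hsimple.resolve_left h.not_gt
      obtain ⟨Ka, hKa⟩ := exists_kernel_bound (N := N) (τ := τ) hΩ hr hvec (hconst h) (hkembed h)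
        hpot.zero hδ₀ (R := R) (K := K) (Ky := Ky) (Ku := Ku) (Kw := √τ * K)
      exact ⟨Ka, fun y0 hy0 hsub => hKa y0 hy0 (hsub h)⟩
    · refine ⟨0, fun y0 _ _ u y ψ w μ _ _ _ _ _ => ?_⟩
      rw [hk0 h, inner_zero_left, abs_zero]
  set Kμ : ℝ := K + |Ka| with hKμ
  -- The summands match the five norms in order. The last one bounds `√τ (‖∂ₜy‖ + |⟪e_0, μ⟫|)`, with
  -- `CA` the norm of the inclusion of `D(A^r)` into `H`.
  refine ⟨K + K + Kμ + K + (K + √τ * (|CA| * Kμ)), ?_⟩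
  intro u du x0 hu hun hdun hx0 hen hsub hvisc hnonv y dy μ hsol
  set y0 : SB.GraphSpace σ := GraphSpace.ofTwoMul x0 with hy0
  have hy0H : GraphSpace.toH y0 = GraphSpace.toH x0 := GraphSpace.toH_ofTwoMul x0
  have hx0fin : energy βh (GraphSpace.toH x0) ≠ ∞ := (hen.trans_lt ENNReal.ofReal_lt_top).ne
  have hx0H : ‖GraphSpace.toH x0‖ ≤ R := (GraphSpace.norm_toH_le x0).trans hx0
  have hsol' : IsSolution SA SB r σ τ T βh πh u (GraphSpace.toH y0) y dy μ := by rwa [hy0H]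
  obtain ⟨w, hw, hwψ, hgood⟩ := hsol'.ae_goodTime hr hT hNae hkn hkop (by rwa [hy0H])
  set ψ : ℝ → lp (fun _ : ℕ => ℝ) 2 := fun t => SA.riesz hr (dy t) with hψdef
  have hψ : MemLp ψ 2 (timeMeasure T) :=
    (SA.riesz hr).toContinuousLinearMap.comp_memLp' hsol.dy_memLp
  set G : ℝ → WithLp 2 (lp (fun _ : ℕ => ℝ) 2 × L2 Ω) :=
    fun t => WithLp.toLp 2 (ψ t, (√τ)⁻¹ • w t) with hG
  have hGm : MemLp G 2 (timeMeasure T) := memLp_toLp hψ hw _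
  set P : ℝ → Prop := fun t => t ∈ Ioo 0 T ∧
    GoodTime SA SB hr σ τ βh N k y0 (u t) (y t) (ψ t) (w t) (μ t) ∧
    SA.embed hr (GraphSpace.toH (y t - y0)) = ∫ s in (0 : ℝ)..t, ψ s with hP
  have hPae : ∀ᵐ t ∂(timeMeasure T), P t := by
    filter_upwards [hgood, ae_restrict_mem measurableSet_Ioo] with t h1 h2
    exact ⟨h2, h1⟩
  have hub : ∀ t ∈ Icc 0 T, ‖u t‖ ≤ Cu := fun t ht => hu.norm_le hT hR hun hdun ht
  have hF : ∀ t, P t → j (y t - y0) = ∫ s in (0 : ℝ)..t, G s := fun t ht => by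
    rw [hja]
    exact phaseMap_eq_integral hinj hψ hw hwψ (Ioo_subset_Icc_self ht.1) ht.2.2
  have hdiff : ∀ s t, P s → P t → ⟪G t - G s, j (y t - y s)⟫ + 1 / 2 * ‖y t - y s‖ ^ 2
      ≤ ((L + 1) * C + 1) * (‖j (y t - y s)‖ ^ 2 + ‖u t - u s‖ ^ 2) := fun s t hs ht =>
    ht.2.1.difference_le hτ hN hE hC hs.2.1
  have hinit : ∃ ε : ℝ, 0 < ε ∧ ∀ t, P t → t < ε → ⟪G t, j (y t - y0)⟫
      ≤ ((L + 1) * C + 1) * ‖j (y t - y0)‖ ^ 2 + M * ‖j (y t - y0)‖ := by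
    rcases hτ.eq_or_lt with hτ0 | hτ0
    · obtain ⟨ε, hε, hdata⟩ := hnonv hτ0.symm
      refine ⟨ε, hε, fun t ht htε => ?_⟩
      have htm : t ∈ Ioo 0 ε := ⟨ht.1.1, htε⟩
      have hd : ∀ lam, ∃ m : SA.EnergySpace r, lam ∈ Ioo 0 ε →
          (∀ᵐ x ∂(volume.restrict Ω), EnergySpace.toH m x =
            GraphSpace.op x0 x + yosida βh lam (GraphSpace.toH x0 x)
              + deriv πh (GraphSpace.toH x0 x) - u t x) ∧ ‖m‖ ≤ M₀ := fun lam => by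
        by_cases hl : lam ∈ Ioo 0 ε
        · obtain ⟨m, hm⟩ := hdata lam hl t htm
          exact ⟨m, fun _ => hm⟩
        · exact ⟨0, fun h => absurd h hl⟩
      choose m hm using hd
      -- Chosen so that `B^(2σ) y0 + b + N y0 - u` is exactly the given element of `D(A^r)`. The
      -- hypothesis on the data then identifies `b` with the Yosida approximation at `y0`.
      set b : ℝ → L2 Ω := fun lam => EnergySpace.toH (m lam) - GraphSpace.op x0
        - N (GraphSpace.toH x0) + u t with hb
      have hbx : ∀ lam ∈ Ioo 0 ε, ∀ᵐ x ∂(volume.restrict Ω),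
          b lam x = yosida βh lam (GraphSpace.toH x0 x) := fun lam hl => by
        filter_upwards [(hm lam hl).1, hNae (GraphSpace.toH x0),
          Lp.coeFn_add (EnergySpace.toH (m lam) - GraphSpace.op x0 - N (GraphSpace.toH x0)) (u t),
          Lp.coeFn_sub (EnergySpace.toH (m lam) - GraphSpace.op x0) (N (GraphSpace.toH x0)),
          Lp.coeFn_sub (EnergySpace.toH (m lam)) (GraphSpace.op x0)] with x e1 e2 e3 e4 e5
        simp only [hb]
        rw [e3, Pi.add_apply, e4, Pi.sub_apply, e5, Pi.sub_apply, e1, e2]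
        ring
      refine le_of_forall_pos_le_add fun η hη => ?_
      obtain ⟨lam, hl, hle⟩ := exists_energy_add_inner_le hpot hx0fin ht.2.1.energy_ne_top hε b
        hbx hη
      refine ht.2.1.initial_le hτ hN hE hC rfl hx0fin hle ?_
      have e1 : GraphSpace.op x0 + b lam + N (GraphSpace.toH x0) - u t
          = EnergySpace.toH (m lam) := by simp only [hb]; abel
      -- As an element of `D(A^r)`, `m lam` is paired with the dual norm of `y - y0`, the only norm
      -- available when `τ = 0`.
      rw [e1, real_inner_comm, ← SA.inner_embed hr]
      have e2 := neg_le_of_abs_le (abs_real_inner_le_norm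
        (SA.embed hr (GraphSpace.toH (y t - y0))) (EnergySpace.coeffEquiv hr (m lam)))
      rw [LinearIsometryEquiv.norm_map] at e2
      have e3 : ‖SA.embed hr (GraphSpace.toH (y t - y0))‖
          ≤ ‖phaseMap (SA.embed hr) τ (GraphSpace.toH (y t - y0))‖ := norm_fst_le_toLp _ _
      have e4 : ‖m lam‖ ≤ M := by
        rw [hM, ← hτ0, Real.sqrt_zero, inv_zero, zero_mul, zero_add]
        exact (hm lam hl).2.trans (le_abs_self _)
      have e5 := mul_le_mul e3 e4 (norm_nonneg _) (norm_nonneg _)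
      linarith
    · refine ⟨1, one_pos, fun t ht _ => ?_⟩
      obtain ⟨b, hbs, hbR⟩ := hvisc hτ0
      have hle := energy_add_inner_le hpot hx0fin ht.2.1.energy_ne_top (hbs.mono fun x hx => hx.1)
      have hmain := ht.2.1.initial_le (η := 0) (b := b) (M := M) hτ hN hE hC rfl hx0fin
        (by rw [add_zero]; exact hle) ?_
      · rw [add_zero] at hmain
        exact hmain
      have e2 := neg_le_of_abs_le (abs_real_inner_le_norm
        (GraphSpace.op x0 + b + N (GraphSpace.toH x0) - u t) (GraphSpace.toH (y t - y0)))
      have e3 : ‖GraphSpace.op x0 + b + N (GraphSpace.toH x0) - u t‖ ≤ M' := by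
        refine (norm_sub_le _ _).trans (add_le_add ((norm_add_le _ _).trans (add_le_add
          ((norm_add_le _ _).trans (add_le_add ((GraphSpace.norm_op_le x0).trans hx0) hbR))
          ((hN0 _).trans ?_))) (hub t (Ioo_subset_Icc_self ht.1)))
        gcongr
      have hsq : 0 < √τ := Real.sqrt_pos.2 hτ0
      -- Viscosity puts `√τ` times the `H` norm into the norm of `X`, so an `L²` bound on the
      -- initial data suffices.
      have e4 : ‖GraphSpace.toH (y t - y0)‖
          ≤ (√τ)⁻¹ * ‖phaseMap (SA.embed hr) τ (GraphSpace.toH (y t - y0))‖ := by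
        rw [le_inv_mul_iff₀ hsq]
        have : ‖√τ • GraphSpace.toH (y t - y0)‖
          ≤ ‖phaseMap (SA.embed hr) τ (GraphSpace.toH (y t - y0))‖ := norm_snd_le_toLp _ _
        rwa [norm_smul, Real.norm_of_nonneg hsq.le] at this
      have e5 := mul_le_mul e3 e4 (norm_nonneg _) ((norm_nonneg _).trans e3)
      have e6 := mul_nonneg (abs_nonneg M₀)
        (norm_nonneg (phaseMap (SA.embed hr) τ (GraphSpace.toH (y t - y0))))
      rw [hM]
      linarith
  obtain ⟨ε, hε, hinit⟩ := hinit
  obtain ⟨z, hz, hzn, hzG⟩ := hcore G y u du P y0 ε hε hGm hsol.y_memLp.1 hu hdun hPae hF hdiff hinit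
  have hzψ : ∀ᵐ t ∂(timeMeasure T), SA.embed hr (GraphSpace.toH (z t)) = ψ t ∧
      √τ • GraphSpace.toH (z t) = (√τ)⁻¹ • w t ∧ ‖ψ t‖ ≤ K ∧ ‖(√τ)⁻¹ • w t‖ ≤ K := by
    filter_upwards [hzG] with t ht
    exact ⟨congrArg (fun p : WithLp 2 (lp (fun _ : ℕ => ℝ) 2 × L2 Ω) => p.fst) ht.1,
      congrArg (fun p : WithLp 2 (lp (fun _ : ℕ => ℝ) 2 × L2 Ω) => p.snd) ht.1,
      (norm_fst_le_toLp _ _).trans ht.2, (norm_snd_le_toLp _ _).trans ht.2⟩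
  have hrep : ∀ᵐ t ∂(timeMeasure T), SA.Represents (dy t) (GraphSpace.toH (z t)) := by
    filter_upwards [hzψ] with t ht
    exact (SA.represents_iff hr).2 ht.1.symm
  have hdyK : ∀ᵐ t ∂(timeMeasure T), ‖dy t‖ ≤ K := by
    filter_upwards [hzψ] with t ht
    rw [← (SA.riesz hr).norm_map]
    exact ht.2.2.1
  -- The integrability of `z = ∂ₜy` with values in `D(B^σ)` bounds `y` there by a constant
  -- independent of the solution, as the estimate of the kernel component of `μ` requires.
  have hyK : ∀ t, P t → ‖y t‖ ≤ Ky := fun t ht => by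
    have htm := Ioo_subset_Icc_self ht.1
    have e1 : y t - y0 = ∫ s in (0 : ℝ)..t, z s := by
      apply hjinj
      rw [hF t ht, ← j.intervalIntegral_comp_comm (intervalIntegrable_of_memLp hz
        ⟨le_rfl, hT.le⟩ htm)]
      refine intervalIntegral.integral_congr_ae ?_
      have hzG' := hzG
      rw [ae_restrict_iff' measurableSet_Ioo] at hzG'
      filter_upwards [hzG'] with s hs hsm
      rw [uIoc_of_le htm.1] at hsm
      exact (hs ⟨hsm.1, hsm.2.trans_lt ht.1.2⟩).1.symm
    have e2 : y t = y0 + ∫ s in (0 : ℝ)..t, z s := by rw [← e1]; abel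
    rw [e2]
    refine (norm_add_le _ _).trans (add_le_add ((GraphSpace.norm_ofTwoMul_le x0).trans ?_)
      (norm_integral_le hz hK hzn htm))
    gcongr
  have hμK : ∀ᵐ t ∂(timeMeasure T), ‖μ t‖ ≤ Kμ := by
    filter_upwards [hPae, hzψ] with t ht hzt
    obtain ⟨-, -, hψK, hwK⟩ := hzt
    have hwn : ‖w t‖ ≤ √τ * K := by
      rcases hτ.eq_or_lt with h | h
      · rw [ht.2.1.viscous h.symm, norm_zero]; positivity
      · have hsq : 0 < √τ := Real.sqrt_pos.2 h
        rw [norm_smul, norm_inv, Real.norm_of_nonneg hsq.le, inv_mul_le_iff₀ hsq] at hwK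
        exact hwK
    have hNu : ‖N (GraphSpace.toH (y t)) - u t‖ ≤ Ku := by
      refine (norm_sub_le _ _).trans (add_le_add ((hN0 _).trans ?_)
        (hub t (Ioo_subset_Icc_self ht.1)))
      have := (GraphSpace.norm_toH_le (y t)).trans (hyK t ht)
      gcongr
    have ha := hKa y0 (by rwa [hy0H]) (by rwa [hy0H]) _ _ _ _ _ ht.2.1 (hyK t ht) hNu hwn hψK
    -- Decomposition of `μ` into minus the time derivative and the kernel component, each already
    -- bounded.
    have e1 : EnergySpace.coeffEquiv hr (μ t)
        = -ψ t + ⟪k, EnergySpace.coeffEquiv hr (μ t)⟫ • k := by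
      rw [ht.2.1.riesz_eq]; abel
    rw [← (EnergySpace.coeffEquiv hr).norm_map (μ t), e1]
    refine (norm_add_le _ _).trans (add_le_add (by rwa [norm_neg]) ?_)
    rw [norm_smul, Real.norm_eq_abs]
    have hk1' : ‖k‖ ≤ 1 := by
      rcases hkn with h | h
      · simp [h]
      · exact h.le
    exact (mul_le_of_le_one_right (abs_nonneg _) hk1').trans (ha.trans (le_abs_self _))
  have hKμ0 : 0 ≤ Kμ := by positivity
  set m : ℝ → SA.EnergySpace (2 * r) := fun t =>
    SA.inversePow hr2 (GraphSpace.toH (z t)) ⟪SA.vec 0, EnergySpace.toH (μ t)⟫ with hm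
  have hmμ : ∀ᵐ t ∂(timeMeasure T), EnergySpace.toH (m t) = EnergySpace.toH (μ t) := by
    filter_upwards [hrep, hsol.first] with t h1 h2
    refine SA.toH_inversePow hsimple' hr2 fun v => ?_
    rw [← h1 v]
    exact h2 v
  have hμ0 : ∀ᵐ t ∂(timeMeasure T), |⟪SA.vec 0, EnergySpace.toH (μ t)⟫| ≤ |CA| * Kμ := by
    filter_upwards [hμK] with t ht
    refine (abs_real_inner_le_norm _ _).trans ?_
    rw [SA.orthonormal.1 0, one_mul]
    refine (hCA (μ t)).trans ?_
    have := le_abs_self CA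
    gcongr
  have hzK : ∀ᵐ t ∂(timeMeasure T), ‖√τ • GraphSpace.toH (z t)‖ ≤ K := by
    filter_upwards [hzψ] with t ht
    rw [ht.2.1]
    exact ht.2.2.2
  have hzHm : AEStronglyMeasurable (fun t => GraphSpace.toH (z t)) (timeMeasure T) :=
    (GraphSpace.toHL (S := SB) (s := σ)).continuous.comp_aestronglyMeasurable hz.1
  have hzτ : 0 < τ → ∀ᵐ t ∂(timeMeasure T), ‖GraphSpace.toH (z t)‖ ≤ (√τ)⁻¹ * K := fun h => by
    have hsq : 0 < √τ := Real.sqrt_pos.2 h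
    filter_upwards [hzK] with t ht
    rwa [norm_smul, Real.norm_of_nonneg hsq.le, ← le_inv_mul_iff₀ hsq] at ht
  refine ⟨memLp_top_of_bound hsol.dy_memLp.1 K hdyK, memLp_top_of_bound hsol.mu_memLp.1 Kμ hμK,
    z, hrep, hz, fun h => memLp_top_of_bound hzHm _ (hzτ h), fun h => ⟨m, hmμ, ?_⟩,
    fun t => √τ • m t, ?_, ?_⟩
  · refine memLp_top_of_bound ?_ ((√τ)⁻¹ * K + |CA| * Kμ) ?_
    · have hμm : AEStronglyMeasurable (fun t => ⟪SA.vec 0, EnergySpace.toH (μ t)⟫)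
          (timeMeasure T) := by
        have : Continuous fun v : SA.EnergySpace r => ⟪SA.vec 0, EnergySpace.toHL hr v⟫ :=
          continuous_const.inner (EnergySpace.toHL hr).continuous
        exact this.comp_aestronglyMeasurable hsol.mu_memLp.1
      refine (EnergySpace.coeffEquiv hr2).symm.continuous.comp_aestronglyMeasurable ?_
      exact (SA.basis.repr.continuous.comp_aestronglyMeasurable hzHm).neg.add
        (hμm.smul aestronglyMeasurable_const)
    · filter_upwards [hzτ h, hμ0] with t h1 h2
      exact (SA.norm_inversePow_le hr2 _ _).trans (add_le_add h1 h2)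
  · filter_upwards [hmμ] with t ht
    rw [map_smul, ht]
  -- For `τ = 0` only the product `√τ m` is known to be bounded, hence the factor is kept inside the
  -- estimate.
  · have hn : ∀ᵐ t ∂(timeMeasure T), ‖√τ • m t‖ ≤ K + √τ * (|CA| * Kμ) := by
      filter_upwards [hzK, hμ0] with t h1 h2
      rw [norm_smul, Real.norm_of_nonneg (Real.sqrt_nonneg τ)] at h1 ⊢
      calc √τ * ‖m t‖ ≤ √τ * (‖GraphSpace.toH (z t)‖ + |⟪SA.vec 0, EnergySpace.toH (μ t)⟫|) := by
            gcongr
            exact SA.norm_inversePow_le hr2 _ _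
        _ ≤ _ := by
            rw [mul_add]
            gcongr
    rw [eLpNorm_exponent_top, eLpNorm_exponent_top, eLpNorm_exponent_top, eLpNorm_exponent_top,
      ENNReal.ofReal_add (by positivity) (by positivity), ENNReal.ofReal_add (by positivity) hK,
      ENNReal.ofReal_add (by positivity) hKμ0, ENNReal.ofReal_add hK hK]
    exact add_le_add (add_le_add (add_le_add (add_le_add (eLpNormEssSup_le_of_ae_bound hdyK) hzn)
      (eLpNormEssSup_le_of_ae_bound hμK)) (eLpNormEssSup_le_of_ae_bound hzK))
      (eLpNormEssSup_le_of_ae_bound hn)
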